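/- **Setting.** Let $V$ be a separable UMD $\mathbb R$-Banach space with type $2$, let $U$ be a separable $\mathbb R$-Hilbert space, let $\gamma(U,V)$ be the space of $\gamma$-radonifying operators from $U$ to $V$, let $T\in(0,\infty)$, let $(\Omega,\mathcal F,\mathbb P)$ be a probability space with a normal filtration $(\mathcal F_t)_{t\in[0,T]}$ (that is, $\mathcal F_0$ contains all $\mathbb P$-null sets of $\mathcal F$ and $\mathcal F_t=\bigcap_{s\in(t,T]}\mathcal F_s$ for $t\in[0,T)$), let $(W_t)_{t\in[0,T]}$ be an $\operatorname{Id}_U$-cylindrical $(\mathcal F_t)_{t\in[0,T]}$-Wiener process, and let $p\in[2,\infty)$, $\vartheta\in[0,1)$, $\mathbf y,\mathbf z\in[0,\infty)$. For a Banach space $E$ write $\|\cdot\|_{L^p(\mathbb P;E)}$ for the usual $L^p$-norm. Let $$\Upsilon_p=\sup\left\{\frac{\big\|\int_0^T A_t\,dW_t\big\|_{L^p(\mathbb P;V)}}{\big(\int_0^T\|A_t\|^2_{L^p(\mathbb P;\gamma(U,V))}\,dt\big)^{1/2}}\;:\; A\colon[0,T]\times\Omega\to\gamma(U,V)\text{ predictable},\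 \int_0^T\|A_t\|^2_{L^p(\mathbb P;\gamma(U,V))}\,dt\in(0,\infty)\right\}$$ (with $\sup\emptyset=0$), for $r\in(0,\infty)$, $x\in[0,\infty)$ let $\mathcal E_r[x]=\Big[\sum_{n=0}^\infty\frac{x^{2n}\,\Gamma(r)^n}{\Gamma(nr+1)}\Big]^{1/2}$, and let $$C=\sqrt2\;\mathcal E_{1-\vartheta}\!\left[\frac{\mathbf y\sqrt2\,T^{1-\vartheta}}{\sqrt{1-\vartheta}}+\mathbf z\,\Upsilon_p\sqrt{2\,T^{1-\vartheta}}\right],\qquad K=1+\frac{\mathbf y\,T^{1-\vartheta}}{1-\vartheta}+\frac{\mathbf z\,\Upsilon_p\sqrt{T^{1-\vartheta}}}{\sqrt{1-\vartheta}}.$$ Then $\Upsilon_p<\infty$, and the following two assertions hold. **A priori estimate.** Let $X\colon[0,T]\times\Omega\to V$ be a stochastic process with $\sup_{s\in[0,T]}\|X_s\|_{L^p(\mathbb P;V)}<\infty$ and, for every $t\in(0,T]$, let $Y^t\colon[0,t]\times\Omega\to V$ and $Z^t\colon[0,t]\times\Omega\to\gamma(U,V)$ be $(\mathcal F_s)_{s\in[0,t]}$-predictable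 processes which satisfy for all $s\in(0,t)$ that $$\|Y^t_s\|_{L^p(\mathbb P;V)}\le\frac{\mathbf y\,\sup_{u\in[0,s]}\|X_u\|_{L^p(\mathbb P;V)}}{(t-s)^{\vartheta}},\qquad \|Z^t_s\|_{L^p(\mathbb P;\gamma(U,V))}\le\frac{\mathbf z\,\sup_{u\in[0,s]}\|X_u\|_{L^p(\mathbb P;V)}}{(t-s)^{\vartheta/2}}.$$ Then (i) for all $t\in[0,T]$ it holds $\mathbb P$-a.s. that $\int_0^t\|Y^t_s\|_V+\|Z^t_s\|^2_{\gamma(U,V)}\,ds<\infty$ (and the stochastic integral $\int_0^tZ^t_s\,dW_s$ exists), and (ii) $$\sup_{t\in[0,T]}\|X_t\|_{L^p(\mathbb P;V)}\le C\,\sup_{t\in[0,T]}\Big\|X_t-\Big[\int_0^tY^t_s\,ds+\int_0^tZ^t_s\,dW_s\Big]\Big\|_{L^p(\mathbb P;V)}\le K\,C\,\sup_{t\in[0,T]}\|X_t\|_{L^p(\mathbb P;V)}<\infty .$$ **Perturbation estimate.** Let $X,\bar X\colon[0,T]\times\Omega\to V$ be stochastic processes with $\sup_{s\in[0,T]}\|X_s-\bar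 X_s\|_{L^p(\mathbb P;V)}<\infty$ and, for every $t\in(0,T]$, let $Y^t,\bar Y^t\colon[0,t]\times\Omega\to V$ and $Z^t,\bar Z^t\colon[0,t]\times\Omega\to\gamma(U,V)$ be $(\mathcal F_s)_{s\in[0,t]}$-predictable processes such that $\mathbb P$-a.s. $\int_0^t\|Y^t_r\|_V+\|\bar Y^t_r\|_V+\|Z^t_r\|^2_{\gamma(U,V)}+\|\bar Z^t_r\|^2_{\gamma(U,V)}\,dr<\infty$ and such that for all $s\in(0,t)$ $$\|Y^t_s-\bar Y^t_s\|_{L^p(\mathbb P;V)}\le\frac{\mathbf y\,\sup_{u\in[0,s]}\|X_u-\bar X_u\|_{L^p(\mathbb P;V)}}{(t-s)^{\vartheta}},\qquad \|Z^t_s-\bar Z^t_s\|_{L^p(\mathbb P;\gamma(U,V))}\le\frac{\mathbf z\,\sup_{u\in[0,s]}\|X_u-\bar X_u\|_{L^p(\mathbb P;V)}}{(t-s)^{\vartheta/2}}.$$ Then the stochastic integrals $\int_0^tZ^t_s\,dW_s$ and $\int_0^t\bar Z^t_s\,dW_s$ exist for all $t\in[0,T]$, and $$\sup_{t\in[0,T]}\|X_t-\bar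 X_t\|_{L^p(\mathbb P;V)}\le C\,\sup_{t\in[0,T]}\Big\|X_t-\Big[\int_0^tY^t_s\,ds+\int_0^tZ^t_s\,dW_s\Big]+\Big[\int_0^t\bar Y^t_s\,ds+\int_0^t\bar Z^t_s\,dW_s\Big]-\bar X_t\Big\|_{L^p(\mathbb P;V)}\le C\,K\,\sup_{t\in[0,T]}\|X_t-\bar X_t\|_{L^p(\mathbb P;V)}<\infty .$$ -/

import Mathlib

open MeasureTheory ProbabilityTheory Filter Topology
open scoped NNReal ENNReal

universe w u v

noncomputable section

/-! ### Geometry of the state space -/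

/-- A Banach space `V` has the UMD property (unconditional martingale differences): for every
`p ∈ (1, ∞)` there is a constant `β` such that, for all finite `V`-valued `L^p`-martingales `f` and
all choices of signs `ε`, `‖∑ ε_k (f_{k+1} - f_k)‖_{L^p} ≤ β ‖∑ (f_{k+1} - f_k)‖_{L^p}`. -/
def IsUMD (V : Type u) [NormedAddCommGroup V] [NormedSpace ℝ V] [CompleteSpace V] : Prop :=
  ∀ p : ℝ, 1 < p → ∃ β : ℝ≥0,
    ∀ (Ω : Type w) (m : MeasurableSpace Ω) (μ : Measure Ω) (_ : IsProbabilityMeasure μ)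
      (𝓖 : Filtration ℕ m) (f : ℕ → Ω → V),
      Martingale f 𝓖 μ → (∀ n, MemLp (f n) (ENNReal.ofReal p) μ) →
      ∀ (N : ℕ) (ε : ℕ → ℝ), (∀ k, ε k = 1 ∨ ε k = -1) →
        eLpNorm (∑ k ∈ Finset.range N, ε k • (f (k + 1) - f k)) (ENNReal.ofReal p) μ
          ≤ β * eLpNorm (∑ k ∈ Finset.range N, (f (k + 1) - f k)) (ENNReal.ofReal p) μ

/-- (Rademacher) type 2: `𝔼 ‖∑ r_i x_i‖² ≤ τ² ∑ ‖x_i‖²` for independent random signs `r_i`; the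
expectation is written as the average over all `2^N` sign patterns. -/
def HasTypeTwo (V : Type*) [NormedAddCommGroup V] [NormedSpace ℝ V] : Prop :=
  ∃ τ : ℝ≥0, ∀ (N : ℕ) (x : Fin N → V),
    ((2 : ℝ) ^ N)⁻¹ * ∑ ε : Fin N → ℤˣ, ‖∑ i, ((ε i : ℤ) : ℝ) • x i‖ ^ 2
      ≤ (τ : ℝ) ^ 2 * ∑ i, ‖x i‖ ^ 2

/-! ### γ-radonifying operators -/

section Gamma

variable {U : Type*} [NormedAddCommGroup U] [InnerProductSpace ℝ U]
variable {V : Type*} [NormedAddCommGroup V] [NormedSpace ℝ V]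

/-- The γ-norm of `R : U → V`: the supremum over all finite orthonormal systems `h` of
`(𝔼 ‖∑ g_i R h_i‖²)^{1/2}` with independent standard normal `g_i`. -/
def gammaNorm (R : U →L[ℝ] V) : ℝ≥0∞ :=
  ⨆ (n : ℕ) (h : Fin n → U) (_ : Orthonormal ℝ h),
    eLpNorm (fun g : Fin n → ℝ => ∑ i, g i • R (h i)) 2 (Measure.pi fun _ => gaussianReal 0 1)

lemma gammaNorm_aesm {n : ℕ} (R : U →L[ℝ] V) (h : Fin n → U) :
    AEStronglyMeasurable (fun g : Fin n → ℝ => ∑ i, g i • R (h i))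
      (Measure.pi fun _ => gaussianReal 0 1) :=
  Continuous.aestronglyMeasurable (by fun_prop)

lemma gammaNorm_add_le (R S : U →L[ℝ] V) : gammaNorm (R + S) ≤ gammaNorm R + gammaNorm S := by
  refine iSup_le fun n => iSup_le fun h => iSup_le fun hh => ?_
  have e : (fun g : Fin n → ℝ => ∑ i, g i • (R + S) (h i))
      = (fun g : Fin n → ℝ => ∑ i, g i • R (h i)) + fun g : Fin n → ℝ => ∑ i, g i • S (h i) := by
    funext g
    simp [Finset.sum_add_distrib]
  rw [e]
  refine (eLpNorm_add_le (gammaNorm_aesm R h) (gammaNorm_aesm S h) (by norm_num)).trans ?_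
  exact add_le_add
    (le_iSup_of_le n (le_iSup_of_le h (le_iSup_of_le hh le_rfl)))
    (le_iSup_of_le n (le_iSup_of_le h (le_iSup_of_le hh le_rfl)))

lemma gammaNorm_smul (c : ℝ) (R : U →L[ℝ] V) : gammaNorm (c • R) = ‖c‖ₑ * gammaNorm R := by
  unfold gammaNorm
  simp only [ENNReal.mul_iSup]
  refine iSup_congr fun n => iSup_congr fun h => iSup_congr fun _ => ?_
  have e : (fun g : Fin n → ℝ => ∑ i, g i • (c • R) (h i))
      = c • fun g : Fin n → ℝ => ∑ i, g i • R (h i) := by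
    funext g
    simp [Finset.smul_sum, smul_comm c]
  rw [e, eLpNorm_const_smul]

lemma gammaNorm_zero : gammaNorm (0 : U →L[ℝ] V) = 0 := by
  simp [gammaNorm]

lemma eq_zero_of_gammaNorm_eq_zero (R : U →L[ℝ] V) (hR : gammaNorm R = 0) : R = 0 := by
  have key : ∀ u : U, ‖u‖ = 1 → R u = 0 := by
    intro u hu
    have ho : Orthonormal ℝ (fun _ : Fin 1 => u) := by
      refine ⟨fun _ => hu, fun i j hij => absurd (Subsingleton.elim i j) hij⟩
    have h0 : eLpNorm (fun g : Fin 1 → ℝ => ∑ i, g i • R u) 2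
        (Measure.pi fun _ => gaussianReal 0 1) = 0 := by
      refine le_antisymm ?_ bot_le
      rw [← hR]
      exact le_iSup_of_le 1 (le_iSup_of_le (fun _ => u) (le_iSup_of_le ho le_rfl))
    rw [eLpNorm_eq_zero_iff (gammaNorm_aesm R fun _ : Fin 1 => u) (by norm_num)] at h0
    by_contra hne
    have h1 : ∀ᵐ g ∂(Measure.pi fun _ : Fin 1 => gaussianReal 0 1), g 0 = 0 := by
      filter_upwards [h0] with g hg
      simpa [hne] using hg
    have h2 : ∀ᵐ x ∂(gaussianReal 0 1), x = 0 := by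
      have hmp := measurePreserving_eval (fun _ : Fin 1 => gaussianReal 0 1) 0
      rw [← hmp.map_eq]
      exact (ae_map_iff hmp.measurable.aemeasurable (measurableSet_singleton (0 : ℝ))).2 h1
    have hna := nullSingletonClass_gaussianReal (μ := 0) (v := 1) (by norm_num)
    have h3 : ∀ᵐ x ∂(gaussianReal 0 1), x ≠ 0 := by
      simp [ae_iff, measure_singleton]
    have h4 : ∀ᵐ _x ∂(gaussianReal 0 1), False := by
      filter_upwards [h2, h3] with x a b using b a
    rw [eventually_false_iff_eq_bot, ae_eq_bot] at h4
    exact IsProbabilityMeasure.ne_zero _ h4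
  ext u
  by_cases hu : u = 0
  · simp [hu]
  · have h := key ((‖u‖⁻¹ : ℝ) • u) (by simp [norm_smul, hu])
    rw [map_smul, smul_eq_zero] at h
    simpa [hu] using h

variable (U V) in
/-- The operators of finite γ-norm which are limits of finite rank operators in the γ-norm. -/
def gammaSubmodule : Submodule ℝ (U →L[ℝ] V) where
  carrier := {R | gammaNorm R < ⊤ ∧ ∀ ε : ℝ≥0∞, 0 < ε →
    ∃ S : U →L[ℝ] V, FiniteDimensional ℝ (LinearMap.range (S : U →ₗ[ℝ] V)) ∧
      gammaNorm (R - S) < ε}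
  zero_mem' := by
    refine ⟨by simp [gammaNorm_zero], fun ε hε => ⟨0, ?_, by simpa [gammaNorm_zero] using hε⟩⟩
    have : LinearMap.range ((0 : U →L[ℝ] V) : U →ₗ[ℝ] V) = ⊥ := by simp
    rw [this]
    infer_instance
  add_mem' := by
    rintro R S ⟨hR, hR'⟩ ⟨hS, hS'⟩
    refine ⟨(gammaNorm_add_le R S).trans_lt (ENNReal.add_lt_top.2 ⟨hR, hS⟩), fun ε hε => ?_⟩
    obtain ⟨A, hA, hA'⟩ := hR' (ε / 2) (ENNReal.half_pos hε.ne')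
    obtain ⟨B, hB, hB'⟩ := hS' (ε / 2) (ENNReal.half_pos hε.ne')
    refine ⟨A + B, ?_, ?_⟩
    · refine Submodule.finiteDimensional_of_le (S₂ := LinearMap.range (A : U →ₗ[ℝ] V) ⊔
        LinearMap.range (B : U →ₗ[ℝ] V)) ?_
      rintro _ ⟨u, rfl⟩
      exact Submodule.add_mem_sup ⟨u, rfl⟩ ⟨u, rfl⟩
    · rw [add_sub_add_comm]
      refine (gammaNorm_add_le _ _).trans_lt ?_
      calc _ < ε / 2 + ε / 2 := ENNReal.add_lt_add hA' hB'
        _ = ε := ENNReal.add_halves ε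
  smul_mem' := by
    rintro c R ⟨hR, hR'⟩
    by_cases hc : c = 0
    · subst hc
      refine ⟨by simp [gammaNorm_zero], fun ε hε => ⟨0, ?_, by simpa [gammaNorm_zero] using hε⟩⟩
      have : LinearMap.range ((0 : U →L[ℝ] V) : U →ₗ[ℝ] V) = ⊥ := by simp
      rw [this]
      infer_instance
    have hc0 : ‖c‖ₑ ≠ 0 := by simpa using hc
    refine ⟨by rw [gammaNorm_smul]; exact ENNReal.mul_lt_top (by simp) hR, fun ε hε => ?_⟩
    obtain ⟨A, hA, hA'⟩ := hR' (ε / ‖c‖ₑ) (ENNReal.div_pos hε.ne' (by simp))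
    refine ⟨c • A, ?_, ?_⟩
    · refine Submodule.finiteDimensional_of_le (S₂ := LinearMap.range (A : U →ₗ[ℝ] V)) ?_
      rintro _ ⟨u, rfl⟩
      exact Submodule.smul_mem _ c ⟨u, rfl⟩
    · rw [← smul_sub, gammaNorm_smul, mul_comm]
      exact (ENNReal.lt_div_iff_mul_lt (Or.inl hc0) (Or.inl (by simp))).1 hA'

variable (U V) in
/-- The space `γ(U, V)` of γ-radonifying operators. A type of its own, since it carries the γ-norm
(and the corresponding Borel structure), not the operator norm. -/
def GammaRad : Type _ := gammaSubmodule U V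

instance : AddCommGroup (GammaRad U V) := inferInstanceAs (AddCommGroup (gammaSubmodule U V))

instance : Module ℝ (GammaRad U V) := inferInstanceAs (Module ℝ (gammaSubmodule U V))

/-- The bounded operator underlying a γ-radonifying operator. -/
def GammaRad.toCLM (R : GammaRad U V) : U →L[ℝ] V := (R : gammaSubmodule U V).1

instance : Norm (GammaRad U V) := ⟨fun R => (gammaNorm R.toCLM).toReal⟩

lemma gammaRad_core : NormedSpace.Core ℝ (GammaRad U V) where
  norm_nonneg R := ENNReal.toReal_nonneg
  norm_smul c R := by
    change (gammaNorm (c • R.toCLM)).toReal = ‖c‖ * (gammaNorm R.toCLM).toReal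
    rw [gammaNorm_smul, ENNReal.toReal_mul, toReal_enorm]
  norm_triangle R S := by
    change (gammaNorm (R.toCLM + S.toCLM)).toReal
      ≤ (gammaNorm R.toCLM).toReal + (gammaNorm S.toCLM).toReal
    have hR : gammaNorm R.toCLM ≠ ⊤ := R.2.1.ne
    have hS : gammaNorm S.toCLM ≠ ⊤ := S.2.1.ne
    rw [← ENNReal.toReal_add hR hS]
    exact ENNReal.toReal_mono (ENNReal.add_ne_top.2 ⟨hR, hS⟩) (gammaNorm_add_le _ _)
  norm_eq_zero_iff R := by
    constructor
    · intro h
      have h' : gammaNorm R.toCLM = 0 :=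
        ((ENNReal.toReal_eq_zero_iff _).1 h).resolve_right R.2.1.ne
      exact Subtype.ext (eq_zero_of_gammaNorm_eq_zero _ h')
    · rintro rfl
      change (gammaNorm (0 : U →L[ℝ] V)).toReal = 0
      simp [gammaNorm_zero]

instance : NormedAddCommGroup (GammaRad U V) := NormedAddCommGroup.ofCore gammaRad_core

instance : NormedSpace ℝ (GammaRad U V) := NormedSpace.ofCore gammaRad_core

end Gamma

/-! ### Filtrations, predictability and Wiener processes

Time runs through `ℝ≥0`, but only the interval `[0, T]` matters: nothing is required of filtrations
and processes after time `T`. -/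

section Stoch

/-- Lebesgue measure on `[0, t]`, as a measure on the time axis `ℝ≥0`. -/
def lebUpTo (t : ℝ≥0) : Measure ℝ≥0 :=
  ((volume : Measure ℝ).comap NNReal.toReal).restrict (Set.Iic t)

variable {Ω : Type*} {mΩ : MeasurableSpace Ω}

/-- `(𝓕 t)`, `t ∈ [0, T]`, is a normal filtration: `𝓕 0` contains all null sets, and `𝓕` is
right-continuous on `[0, T)`. -/
structure IsNormalFiltration (P : Measure Ω) (T : ℝ≥0) (𝓕 : Filtration ℝ≥0 mΩ) : Prop where
  null_mem : ∀ A : Set Ω, MeasurableSet A → P A = 0 → MeasurableSet[𝓕 0] A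
  right_cont : ∀ t < T, ∀ A : Set Ω,
    (∀ s, t < s → s ≤ T → MeasurableSet[𝓕 s] A) → MeasurableSet[𝓕 t] A

/-- The restriction of the process `Z` to `[0, t] × Ω` is predictable for `(𝓕 s)`, `s ∈ [0, t]`. The
predictable σ-algebra on `[0, t] × Ω` is the trace of the one on `[0, ∞) × Ω`, so this amounts to
predictability of the extension of `Z` by zero. -/
def IsPredictableUpTo {E : Type*} [NormedAddCommGroup E] (𝓕 : Filtration ℝ≥0 mΩ) (t : ℝ≥0)
    (Z : ℝ≥0 → Ω → E) : Prop :=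
  IsStronglyPredictable 𝓕 ((Set.Iic t).indicator Z)

variable {U : Type*} [NormedAddCommGroup U] [InnerProductSpace ℝ U]
variable {V : Type*} [NormedAddCommGroup V] [NormedSpace ℝ V]

/-- `W = (W_t(u))`, `t ∈ [0, T]`, `u ∈ U`, is an `Id_U`-cylindrical Wiener process with respect to
the filtration `𝓕`. -/
structure IsCylindricalWiener (P : Measure Ω) (T : ℝ≥0) (𝓕 : Filtration ℝ≥0 mΩ)
    (W : ℝ≥0 → U → Ω → ℝ) : Prop where
  adapted : ∀ t ≤ T, ∀ u, StronglyMeasurable[𝓕 t] (W t u)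
  linear : ∀ t ≤ T, ∀ (a : ℝ) (u v : U), W t (a • u + v) =ᵐ[P] a • W t u + W t v
  zero : ∀ u, W 0 u =ᵐ[P] 0
  law : ∀ s t, s ≤ t → t ≤ T → ∀ u,
    P.map (W t u - W s u) = gaussianReal 0 ((t - s) * ‖u‖₊ ^ 2)
  indep : ∀ s t, s ≤ t → t ≤ T → ∀ u,
    Indep (MeasurableSpace.comap (W t u - W s u) inferInstance) (𝓕 s) P
  cont : ∀ u, ∀ᵐ ω ∂P, ContinuousOn (fun t => W t u ω) (Set.Iic T)

/-! ### The stochastic integral -/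

variable (U V) in
/-- The data of an elementary integrand `1_{(a, b]} 1_A ⟨h, ·⟩ x` with `A ∈ 𝓕 a`. -/
structure ElemTerm (𝓕 : Filtration ℝ≥0 mΩ) where
  a : ℝ≥0
  b : ℝ≥0
  a_le_b : a ≤ b
  A : Set Ω
  measurable_A : MeasurableSet[𝓕 a] A
  h : U
  x : V

/-- The value at `(s, ω)` of the integrand `1_{(a, b]} 1_A ⟨h, ·⟩ x`. -/
def ElemTerm.eval {𝓕 : Filtration ℝ≥0 mΩ} (e : ElemTerm U V 𝓕) (s : ℝ≥0) (ω : Ω) : U →L[ℝ] V :=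
  (Set.Ioc e.a e.b ×ˢ e.A).indicator (fun _ => (innerSL ℝ e.h).smulRight e.x) (s, ω)

/-- The integral `∫₀ᵗ 1_{(a, b]} 1_A ⟨h, ·⟩ x dW = 1_A (W_{b ∧ t}(h) - W_{a ∧ t}(h)) x`. -/
def ElemTerm.integral {𝓕 : Filtration ℝ≥0 mΩ} (W : ℝ≥0 → U → Ω → ℝ) (t : ℝ≥0)
    (e : ElemTerm U V 𝓕) (ω : Ω) : V :=
  e.A.indicator (fun ω => (W (min e.b t) e.h ω - W (min e.a t) e.h ω) • e.x) ω

/-- The elementary process given by a finite sum of elementary integrands. -/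
def elemProcess {𝓕 : Filtration ℝ≥0 mΩ} (L : List (ElemTerm U V 𝓕)) (s : ℝ≥0) (ω : Ω) :
    U →L[ℝ] V :=
  (L.map fun e => e.eval s ω).sum

/-- The stochastic integral over `[0, t]` of an elementary process. -/
def elemIntegral {𝓕 : Filtration ℝ≥0 mΩ} (W : ℝ≥0 → U → Ω → ℝ) (t : ℝ≥0)
    (L : List (ElemTerm U V 𝓕)) (ω : Ω) : V :=
  (L.map fun e => e.integral W t ω).sum

/-- `I` is (a version of) the stochastic integral `∫₀ᵗ Z_s dW_s`: there are elementary processes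
`Φ_n` with `∫₀ᵗ ‖Z_s - Φ_n(s)‖²_{γ(U,V)} ds → 0` in probability and `∫₀ᵗ Φ_n dW → I` in
probability. -/
def IsStochIntegral (P : Measure Ω) (𝓕 : Filtration ℝ≥0 mΩ) (W : ℝ≥0 → U → Ω → ℝ) (t : ℝ≥0)
    (Z : ℝ≥0 → Ω → GammaRad U V) (I : Ω → V) : Prop :=
  ∃ L : ℕ → List (ElemTerm U V 𝓕),
    (∀ ε : ℝ≥0∞, 0 < ε → Tendsto (fun n => P {ω | ε ≤ ∫⁻ s,
      gammaNorm ((Z s ω).toCLM - elemProcess (L n) s ω) ^ 2 ∂lebUpTo t}) atTop (𝓝 0)) ∧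
    TendstoInMeasure P (fun n => elemIntegral W t (L n)) atTop I

open Classical in
/-- The stochastic integral `∫₀ᵗ Z_s dW_s` (a version of it; `0` if it does not exist). -/
def stochIntegral (P : Measure Ω) (𝓕 : Filtration ℝ≥0 mΩ) (W : ℝ≥0 → U → Ω → ℝ) (t : ℝ≥0)
    (Z : ℝ≥0 → Ω → GammaRad U V) : Ω → V :=
  if h : ∃ I, IsStochIntegral P 𝓕 W t Z I then h.choose else 0

variable (V) in
/-- The Burkholder-Davis-Gundy type constant `Υ_p`: the supremum of
`‖∫₀ᵀ Z dW‖_{L^p} / (∫₀ᵀ ‖Z_t‖²_{L^p} dt)^{1/2}` over all predictable `Z : [0, T] × Ω → γ(U, V)` for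
which the denominator lies in `(0, ∞)`. -/
def bdgConst (P : Measure Ω) (T : ℝ≥0) (𝓕 : Filtration ℝ≥0 mΩ) (W : ℝ≥0 → U → Ω → ℝ) (p : ℝ) :
    ℝ≥0∞ :=
  ⨆ (Z : ℝ≥0 → Ω → GammaRad U V) (_ : IsPredictableUpTo 𝓕 T Z)
    (_ : 0 < ∫⁻ t, eLpNorm (Z t) (ENNReal.ofReal p) P ^ 2 ∂lebUpTo T)
    (_ : ∫⁻ t, eLpNorm (Z t) (ENNReal.ofReal p) P ^ 2 ∂lebUpTo T < ⊤),
    eLpNorm (stochIntegral P 𝓕 W T Z) (ENNReal.ofReal p) P /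
      (∫⁻ t, eLpNorm (Z t) (ENNReal.ofReal p) P ^ 2 ∂lebUpTo T) ^ (1 / 2 : ℝ)

end Stoch

/-- `𝓔_r(x) = (∑_{n ≥ 0} x^{2n} Γ(r)^n / Γ(n r + 1))^{1/2}`. -/
def henryE (r x : ℝ) : ℝ :=
  √(∑' n : ℕ, x ^ (2 * n) * Real.Gamma r ^ n / Real.Gamma (n * r + 1))

/-- `√2 · 𝓔_{1-ϑ}[ y √2 T^{1-ϑ} / √(1-ϑ) + z Υ √(2 T^{1-ϑ}) ]`. -/
def aprioriConst (T ϑ y z Υ : ℝ) : ℝ :=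
  √2 * henryE (1 - ϑ)
    (y * √2 * T ^ (1 - ϑ) / √(1 - ϑ) + z * Υ * √(2 * T ^ (1 - ϑ)))

/-- `1 + y T^{1-ϑ} / (1-ϑ) + z Υ √(T^{1-ϑ}) / √(1-ϑ)`. -/
def reverseConst (T ϑ y z Υ : ℝ) : ℝ :=
  1 + y * T ^ (1 - ϑ) / (1 - ϑ) + z * Υ * √(T ^ (1 - ϑ)) / √(1 - ϑ)

end

/-!
The two estimates are a Gronwall argument built on one analytic fact, the inequality
`‖∫₀ᵗ Z dW‖_{L^p} ≤ Υ_p (∫₀ᵗ ‖Z_s‖²_{L^p} ds)^{1/2}` with `Υ_p < ∞`.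

*The inequality for elementary integrands.* Over a time grid adapted to an elementary process, its
integral is a sum of martingale differences `d_k`. Averaging the UMD inequality over all choices of
signs and applying type 2 (upgraded from second to `p`-th moments of sign averages by an
exponential moment bound) gives `‖∑ d_k‖_{L^p} ≤ C (∑ ‖d_k‖²_{L^p})^{1/2}`
(`IsUMD.exists_eLpNorm_sum_le`). Conditionally on the past, `d_k` is a Gaussian sum, so by Fernique's
theorem its `p`-th moment is controlled by the γ-norm of the integrand
(`IsCylindricalWiener.setLIntegral_stepInc_le`). No decoupling is needed. Stopping the grid sums
when the square function exceeds a level gives a tail bound of Lenglart type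
(`IsCylindricalWiener.exists_measure_elemIntegral_ge_le`).

*General integrands.* Elementary processes are dense among predictable ones, since finite sums of
rank one operators are dense in `γ(U, V)` and predictable rectangles generate the predictable
σ-algebra (`exists_elemGamma_eLpNorm_sub_le`). With the tail bound, the integral exists for every
predictable process which is almost surely square integrable in time
(`IsCylindricalWiener.isStochIntegral_stochIntegral`) and is unique (`IsStochIntegral.ae_eq`); the
moment bound passes to the limit, so that `Υ_p < ∞` (`IsCylindricalWiener.bdgConst_lt_top`).

*The estimates.* Let `e_t = ‖X_t - X'_t‖_{L^p}`. Minkowski's integral inequality for the drift and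
the definition of `Υ_p` for the diffusion bound the difference of the two mild right-hand sides.
Cauchy–Schwarz with respect to the kernel `(t - s)^{-ϑ}` then yields
`e_t² ≤ 2 D² + b ∫₀ᵗ (t - s)^{-ϑ} sup_{u ≤ s} e_u² ds`, where `D` is the supremum of the defect.
Iterating this inequality and evaluating the beta integrals produces the Mittag-Leffler type series
in the constant (`sq_le_of_le_add_lintegral_rpow`, `iSup_le_aprioriConst_mul`). The reverse
inequality is the triangle inequality. The a priori estimate is the perturbation estimate with all
comparison processes equal to zero.
-/

/-! ### Averages over random signs -/

/-- McDiarmid's inequality for the exponential moment of a function of `N` independent signs. -/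
lemma signAverage_exp_le (N : ℕ) (f : (Fin N → ℤˣ) → ℝ) (c : Fin N → ℝ)
    (hf : ∀ ε i a, |f (Function.update ε i a) - f ε| ≤ c i) :
    ((2 : ℝ) ^ N)⁻¹ * ∑ ε, Real.exp (f ε)
      ≤ Real.exp (((2 : ℝ) ^ N)⁻¹ * ∑ ε, f ε + (∑ i, c i ^ 2) / 8) := by
  induction N with
  | zero => simp
  | succ N ih =>
    have hsum (F : (Fin (N + 1) → ℤˣ) → ℝ) : ∑ ε, F ε
        = ∑ ε : Fin N → ℤˣ, (F (Fin.cons 1 ε) + F (Fin.cons (-1) ε)) := by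
      rw [← (Fin.consEquiv fun _ => ℤˣ).sum_comp, Fintype.sum_prod_type_right]
      refine Finset.sum_congr rfl fun ε _ => ?_
      have : (Finset.univ : Finset ℤˣ) = {1, -1} := by decide
      rw [this, Finset.sum_pair (by decide)]
      rfl
    set f' : (Fin N → ℤˣ) → ℝ := fun ε => (f (Fin.cons 1 ε) + f (Fin.cons (-1) ε)) / 2 with hf'
    have key := ih f' (fun i => c i.succ) (fun ε i a => by
      have h1 := hf (Fin.cons 1 ε) i.succ a
      have h2 := hf (Fin.cons (-1) ε) i.succ a
      rw [← Fin.cons_update] at h1 h2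
      rw [abs_le] at *
      simp only [hf']
      constructor <;> linarith [h1.1, h2.1, h1.2, h2.2])
    have hstep (ε : Fin N → ℤˣ) :
        (Real.exp (f (Fin.cons 1 ε)) + Real.exp (f (Fin.cons (-1) ε))) / 2
          ≤ Real.exp (c 0 ^ 2 / 8) * Real.exp (f' ε) := by
      set d := (f (Fin.cons 1 ε) - f (Fin.cons (-1) ε)) / 2 with hd
      have e1 : f (Fin.cons 1 ε) = f' ε + d := by simp only [hf', hd]; ring
      have e2 : f (Fin.cons (-1) ε) = f' ε + -d := by simp only [hf', hd]; ring
      have e3 : (Real.exp (f (Fin.cons 1 ε)) + Real.exp (f (Fin.cons (-1) ε))) / 2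
          = Real.exp (f' ε) * Real.cosh d := by
        rw [e1, e2, Real.exp_add, Real.exp_add, Real.cosh_eq]; ring
      rw [e3, mul_comm (Real.exp (c 0 ^ 2 / 8))]
      refine mul_le_mul_of_nonneg_left ?_ (Real.exp_pos _).le
      refine (Real.cosh_le_exp_half_sq d).trans (Real.exp_le_exp.2 ?_)
      have h1 := hf (Fin.cons (-1) ε) 0 1
      rw [Fin.update_cons_zero] at h1
      have h2 : (2 * d) ^ 2 ≤ c 0 ^ 2 := by
        rw [← sq_abs (2 * d)]
        refine pow_le_pow_left₀ (abs_nonneg _) ?_ 2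
        rw [hd, mul_div_cancel₀ _ (by norm_num : (2 : ℝ) ≠ 0)]
        exact h1
      nlinarith
    rw [hsum, hsum]
    calc ((2 : ℝ) ^ (N + 1))⁻¹ * ∑ ε : Fin N → ℤˣ,
          (Real.exp (f (Fin.cons 1 ε)) + Real.exp (f (Fin.cons (-1) ε)))
        = ((2 : ℝ) ^ N)⁻¹ * ∑ ε : Fin N → ℤˣ,
          (Real.exp (f (Fin.cons 1 ε)) + Real.exp (f (Fin.cons (-1) ε))) / 2 := by
          rw [← Finset.sum_div, pow_succ]; field_simp
      _ ≤ ((2 : ℝ) ^ N)⁻¹ * ∑ ε : Fin N → ℤˣ, Real.exp (c 0 ^ 2 / 8) * Real.exp (f' ε) := by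
          gcongr with ε
          exact hstep ε
      _ = Real.exp (c 0 ^ 2 / 8) * (((2 : ℝ) ^ N)⁻¹ * ∑ ε, Real.exp (f' ε)) := by
          rw [← Finset.mul_sum]; ring
      _ ≤ Real.exp (c 0 ^ 2 / 8) *
          Real.exp (((2 : ℝ) ^ N)⁻¹ * ∑ ε, f' ε + (∑ i : Fin N, c i.succ ^ 2) / 8) := by gcongr
      _ = _ := by
          rw [← Real.exp_add, Fin.sum_univ_succ]
          congr 1
          simp only [hf']
          rw [← Finset.sum_div, pow_succ]
          field_simp
          ring

lemma rpow_le_factorial_mul_exp {p x : ℝ} (hp : 0 ≤ p) (hx : 0 ≤ x) :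
    x ^ p ≤ (1 + (⌈p⌉₊.factorial : ℝ)) * Real.exp x := by
  have h1 : x ^ p ≤ 1 + x ^ ⌈p⌉₊ := by
    rcases le_total x 1 with h | h
    · exact (Real.rpow_le_one hx h hp).trans (by have := pow_nonneg hx ⌈p⌉₊; linarith)
    · have := Real.rpow_le_rpow_of_exponent_le h (Nat.le_ceil p)
      rw [Real.rpow_natCast] at this
      linarith
  have h2 := Real.pow_div_factorial_le_exp x hx ⌈p⌉₊
  rw [div_le_iff₀ (by positivity)] at h2
  have h3 := Real.one_le_exp hx
  nlinarith

/-- Type 2 self-improves to the `L^p`-average: the norm of a Rademacher sum has bounded differences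
`2 ‖x_i‖`, hence a sub-Gaussian deviation from its mean, and the mean is controlled by type 2. -/
lemma HasTypeTwo.exists_signAverage_rpow_le {V : Type*} [NormedAddCommGroup V] [NormedSpace ℝ V]
    (h : HasTypeTwo V) {p : ℝ} (hp : 0 < p) : ∃ C : ℝ, 0 ≤ C ∧ ∀ (N : ℕ) (x : Fin N → V),
      ((2 : ℝ) ^ N)⁻¹ * ∑ ε : Fin N → ℤˣ, ‖∑ i, ((ε i : ℤ) : ℝ) • x i‖ ^ p
        ≤ C * (∑ i, ‖x i‖ ^ 2) ^ (p / 2) := by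
  obtain ⟨τ, hτ⟩ := h
  refine ⟨(1 + (⌈p⌉₊.factorial : ℝ)) * Real.exp (τ + 1 / 2), by positivity, fun N x => ?_⟩
  set S := ∑ i, ‖x i‖ ^ 2 with hS
  have hS0 : 0 ≤ S := Finset.sum_nonneg fun i _ => by positivity
  rcases hS0.eq_or_lt with h0 | hpos
  · have hx : ∀ i, x i = 0 := fun i => by
      have := (Finset.sum_eq_zero_iff_of_nonneg (fun i _ => by positivity)).1 h0.symm i
        (Finset.mem_univ i)
      simpa using this
    rw [← h0]
    simp [hx, Real.zero_rpow hp.ne', Real.zero_rpow (show p / 2 ≠ 0 by positivity)]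
  set σ := √S with hσ
  have hσ0 : 0 < σ := Real.sqrt_pos.2 hpos
  have hσ2 : σ ^ 2 = S := Real.sq_sqrt hS0
  set f : (Fin N → ℤˣ) → ℝ := fun ε => ‖∑ i, ((ε i : ℤ) : ℝ) • x i‖ / σ with hf
  have hunit (a b : ℤˣ) : |((a : ℤ) : ℝ) - ((b : ℤ) : ℝ)| ≤ 2 := by
    rcases Int.units_eq_one_or a with rfl | rfl <;> rcases Int.units_eq_one_or b with rfl | rfl <;>
      norm_num
  have hdiff : ∀ ε i a, |f (Function.update ε i a) - f ε| ≤ 2 * ‖x i‖ / σ := by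
    intro ε i a
    simp only [hf]
    rw [← sub_div, abs_div, abs_of_pos hσ0]
    refine div_le_div_of_nonneg_right ((abs_norm_sub_norm_le _ _).trans ?_) hσ0.le
    have e : ∑ j, ((Function.update ε i a j : ℤ) : ℝ) • x j - ∑ j, ((ε j : ℤ) : ℝ) • x j
        = (((a : ℤ) : ℝ) - ((ε i : ℤ) : ℝ)) • x i := by
      rw [← Finset.sum_sub_distrib, Finset.sum_eq_single i]
      · simp [sub_smul]
      · intro j _ hj
        simp [Function.update_of_ne hj]
      · simp
    rw [e, norm_smul, Real.norm_eq_abs]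
    exact mul_le_mul_of_nonneg_right (hunit _ _) (norm_nonneg _)
  have key := signAverage_exp_le N f _ hdiff
  have hc : (∑ i, (2 * ‖x i‖ / σ) ^ 2) / 8 = 1 / 2 := by
    have : ∀ i, (2 * ‖x i‖ / σ) ^ 2 = 4 / S * ‖x i‖ ^ 2 := fun i => by
      rw [div_pow, mul_pow, hσ2]; ring
    simp_rw [this]
    rw [← Finset.mul_sum, ← hS]
    field_simp
    norm_num
  -- the mean is at most the quadratic mean, which type 2 bounds
  have hmean : ((2 : ℝ) ^ N)⁻¹ * ∑ ε, f ε ≤ τ := by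
    have hcard : (Fintype.card (Fin N → ℤˣ) : ℝ) = 2 ^ N := by simp
    have hcs : (∑ ε, f ε) ^ 2 ≤ 2 ^ N * ∑ ε, f ε ^ 2 := by
      have := sq_sum_le_card_mul_sum_sq (s := (Finset.univ : Finset (Fin N → ℤˣ))) (f := f)
      rwa [Finset.card_univ, hcard] at this
    have ht : ((2 : ℝ) ^ N)⁻¹ * ∑ ε, f ε ^ 2 ≤ τ ^ 2 := by
      have h1 := hτ N x
      have e : ∑ ε, f ε ^ 2 = (∑ ε : Fin N → ℤˣ, ‖∑ i, ((ε i : ℤ) : ℝ) • x i‖ ^ 2) / S := by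
        simp only [hf, div_pow, hσ2, Finset.sum_div]
      rw [e, ← mul_div_assoc, div_le_iff₀ hpos]
      exact h1
    refine abs_le_of_sq_le_sq' ?_ τ.2 |>.2
    refine le_trans ?_ ht
    rw [mul_pow]
    calc (((2 : ℝ) ^ N)⁻¹) ^ 2 * (∑ ε, f ε) ^ 2
        ≤ (((2 : ℝ) ^ N)⁻¹) ^ 2 * (2 ^ N * ∑ ε, f ε ^ 2) := by gcongr
      _ = _ := by field_simp
  have hσp : σ ^ p = S ^ (p / 2) := by
    rw [hσ, Real.sqrt_eq_rpow, ← Real.rpow_mul hS0]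
    congr 1; ring
  have hterm (ε : Fin N → ℤˣ) : ‖∑ i, ((ε i : ℤ) : ℝ) • x i‖ ^ p
      ≤ S ^ (p / 2) * (1 + (⌈p⌉₊.factorial : ℝ)) * Real.exp (f ε) := by
    have e : ‖∑ i, ((ε i : ℤ) : ℝ) • x i‖ = σ * f ε := by
      simp only [hf]; field_simp
    have hf0 : 0 ≤ f ε := by simp only [hf]; positivity
    rw [e, Real.mul_rpow hσ0.le hf0, hσp, mul_assoc]
    exact mul_le_mul_of_nonneg_left (rpow_le_factorial_mul_exp hp.le hf0) (by positivity)
  calc ((2 : ℝ) ^ N)⁻¹ * ∑ ε : Fin N → ℤˣ, ‖∑ i, ((ε i : ℤ) : ℝ) • x i‖ ^ p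
      ≤ ((2 : ℝ) ^ N)⁻¹ * ∑ ε : Fin N → ℤˣ,
          S ^ (p / 2) * (1 + (⌈p⌉₊.factorial : ℝ)) * Real.exp (f ε) := by
        gcongr with ε; exact hterm ε
    _ = S ^ (p / 2) * (1 + (⌈p⌉₊.factorial : ℝ)) *
          (((2 : ℝ) ^ N)⁻¹ * ∑ ε, Real.exp (f ε)) := by rw [← Finset.mul_sum]; ring
    _ ≤ S ^ (p / 2) * (1 + (⌈p⌉₊.factorial : ℝ)) * Real.exp (τ + 1 / 2) := by
        refine mul_le_mul_of_nonneg_left (key.trans (Real.exp_le_exp.2 ?_)) (by positivity)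
        rw [hc]; linarith
    _ = _ := by ring

/-! ### Martingale differences in UMD spaces of type 2 -/

lemma eLpNorm_ofReal_rpow {α E : Type*} {m : MeasurableSpace α} {μ : Measure α} [TopologicalSpace E]
    [ContinuousENorm E] {p : ℝ} (hp : 0 < p) (f : α → E) :
    eLpNorm f (ENNReal.ofReal p) μ ^ p = ∫⁻ a, ‖f a‖ₑ ^ p ∂μ := by
  rw [eLpNorm_eq_lintegral_rpow_enorm_toReal (by simpa using hp) ENNReal.ofReal_ne_top,
    ENNReal.toReal_ofReal hp.le, ← ENNReal.rpow_mul, one_div_mul_cancel hp.ne', ENNReal.rpow_one]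

lemma eLpNorm_ofReal_eq {α E : Type*} {m : MeasurableSpace α} {μ : Measure α} [TopologicalSpace E]
    [ContinuousENorm E] {p : ℝ} (hp : 0 < p) (f : α → E) :
    eLpNorm f (ENNReal.ofReal p) μ = (∫⁻ a, ‖f a‖ₑ ^ p ∂μ) ^ (1 / p) := by
  rw [← eLpNorm_ofReal_rpow hp, ← ENNReal.rpow_mul, mul_one_div_cancel hp.ne', ENNReal.rpow_one]

lemma lintegral_sum_rpow_le {α ι : Type*} {m : MeasurableSpace α} {μ : Measure α} {q : ℝ}
    (hq : 1 ≤ q) (s : Finset ι) (b : ι → α → ℝ≥0∞) (hb : ∀ i ∈ s, AEMeasurable (b i) μ) :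
    (∫⁻ a, (∑ i ∈ s, b i a) ^ q ∂μ) ^ (1 / q) ≤ ∑ i ∈ s, (∫⁻ a, b i a ^ q ∂μ) ^ (1 / q) := by
  have h := eLpNorm_sum_le (p := ENNReal.ofReal q) (μ := μ) (f := b) (s := s)
    (fun i hi => (hb i hi).aestronglyMeasurable) (by simpa using hq)
  simpa [eLpNorm_ofReal_eq (zero_lt_one.trans_le hq)] using h

lemma HasTypeTwo.exists_sum_enorm_rpow_le {V : Type*} [NormedAddCommGroup V] [NormedSpace ℝ V]
    (h : HasTypeTwo V) {p : ℝ} (hp : 0 < p) : ∃ C : ℝ≥0, ∀ (N : ℕ) (x : Fin N → V),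
      ∑ ε : Fin N → ℤˣ, ‖∑ i, ((ε i : ℤ) : ℝ) • x i‖ₑ ^ p
        ≤ 2 ^ N * (C * (∑ i, ‖x i‖ₑ ^ 2) ^ (p / 2)) := by
  obtain ⟨C, hC0, hC⟩ := h.exists_signAverage_rpow_le hp
  refine ⟨⟨C, hC0⟩, fun N x => ?_⟩
  have h1 := hC N x
  rw [inv_mul_le_iff₀ (by positivity)] at h1
  have h2 := ENNReal.ofReal_le_ofReal h1
  have e (v : V) : ‖v‖ₑ ^ p = ENNReal.ofReal (‖v‖ ^ p) := by
    rw [← ofReal_norm, ENNReal.ofReal_rpow_of_nonneg (norm_nonneg _) hp.le]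
  have e2 : ∑ i, ‖x i‖ₑ ^ 2 = ENNReal.ofReal (∑ i, ‖x i‖ ^ 2) := by
    rw [ENNReal.ofReal_sum_of_nonneg fun i _ => by positivity]
    simp_rw [ENNReal.ofReal_pow (norm_nonneg _), ofReal_norm]
  rw [ENNReal.ofReal_mul (by positivity), ENNReal.ofReal_mul hC0,
    ENNReal.ofReal_sum_of_nonneg fun i _ => by positivity] at h2
  rw [e2, ENNReal.ofReal_rpow_of_nonneg (Finset.sum_nonneg fun i _ => by positivity)
    (by positivity)]
  simp_rw [e]
  refine h2.trans_eq ?_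
  congr 1
  · rw [ENNReal.ofReal_pow (by norm_num)]; simp
  · congr 1
    exact ENNReal.ofReal_eq_coe_nnreal hC0

section UMD

variable {V : Type u} [NormedAddCommGroup V] [NormedSpace ℝ V] [CompleteSpace V]

/-- Any choice of signs in front of martingale differences can be removed at the cost of the UMD
constant. -/
lemma IsUMD.exists_eLpNorm_sum_le_signed (hUMD : IsUMD.{w, u} V) {p : ℝ} (hp : 1 < p) :
    ∃ β : ℝ≥0, ∀ (Ω : Type w) (m : MeasurableSpace Ω) (μ : Measure Ω) (_ : IsProbabilityMeasure μ)
      (𝓖 : Filtration ℕ m) (d : ℕ → Ω → V), (∀ k, StronglyMeasurable[𝓖 (k + 1)] (d k)) →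
      (∀ k, MemLp (d k) (ENNReal.ofReal p) μ) → (∀ k, μ[d k | 𝓖 k] =ᵐ[μ] 0) →
      ∀ (N : ℕ) (ε : ℕ → ℝ), (∀ k, ε k = 1 ∨ ε k = -1) →
        eLpNorm (∑ k ∈ Finset.range N, d k) (ENNReal.ofReal p) μ
          ≤ β * eLpNorm (∑ k ∈ Finset.range N, ε k • d k) (ENNReal.ofReal p) μ := by
  obtain ⟨β, hβ⟩ := hUMD p hp
  refine ⟨β, fun Ω m μ hμ 𝓖 d hd hdp hd0 N ε hε => ?_⟩
  have hp1 : (1 : ℝ≥0∞) ≤ ENNReal.ofReal p := by simpa using hp.le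
  set f : ℕ → Ω → V := fun n => ∑ k ∈ Finset.range n, ε k • d k with hf
  have hdiff (k : ℕ) : f (k + 1) - f k = ε k • d k := by
    simp [hf, Finset.sum_range_succ]
  have hfp (n : ℕ) : MemLp (f n) (ENNReal.ofReal p) μ :=
    memLp_finsetSum' _ fun k _ => (hdp k).const_smul _
  have hmart : Martingale f 𝓖 μ := by
    refine martingale_of_condExp_sub_eq_zero_nat (fun n => ?_)
      (fun n => (hfp n).integrable hp1) fun k => ?_
    · refine Finset.stronglyMeasurable_sum _ fun k hk => ?_
      exact ((hd k).mono (𝓖.mono (Finset.mem_range.1 hk))).const_smul _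
    · rw [hdiff]
      filter_upwards [condExp_smul (μ := μ) (ε k) (d k) (𝓖 k), hd0 k] with ω h1 h2
      simp [h1, h2]
  have h := hβ Ω m μ hμ 𝓖 f hmart hfp N ε hε
  simp_rw [hdiff] at h
  have hsq (k : ℕ) : ε k • ε k • d k = d k := by
    rw [smul_smul]
    rcases hε k with h | h <;> simp [h]
  simpa only [hsq] using h

/-- In a UMD space of type 2, `‖∑ d_k‖_{L^p} ≤ C (∑ ‖d_k‖_{L^p}²)^{1/2}` for martingale differences
`d_k` and `p ≥ 2`: average the UMD inequality over all signs, apply type 2 pointwise, and conclude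
with Minkowski's inequality in `L^{p/2}`. -/
lemma IsUMD.exists_eLpNorm_sum_le (hUMD : IsUMD.{w, u} V) (hType : HasTypeTwo V) {p : ℝ}
    (hp : 2 ≤ p) :
    ∃ C : ℝ≥0, ∀ (Ω : Type w) (m : MeasurableSpace Ω) (μ : Measure Ω) (_ : IsProbabilityMeasure μ)
      (𝓖 : Filtration ℕ m) (d : ℕ → Ω → V), (∀ k, StronglyMeasurable[𝓖 (k + 1)] (d k)) →
      (∀ k, MemLp (d k) (ENNReal.ofReal p) μ) → (∀ k, μ[d k | 𝓖 k] =ᵐ[μ] 0) →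
      ∀ N : ℕ, eLpNorm (∑ k ∈ Finset.range N, d k) (ENNReal.ofReal p) μ
          ≤ C * (∑ k ∈ Finset.range N, eLpNorm (d k) (ENNReal.ofReal p) μ ^ 2) ^ (1 / 2 : ℝ) := by
  have hp0 : 0 < p := by linarith
  obtain ⟨β, hβ⟩ := hUMD.exists_eLpNorm_sum_le_signed (show 1 < p by linarith)
  obtain ⟨C, hC⟩ := hType.exists_sum_enorm_rpow_le hp0
  refine ⟨β * C ^ (1 / p), fun Ω m μ hμ 𝓖 d hd hdp hd0 N => ?_⟩
  have hsigned (ε : Fin N → ℤˣ) : ∫⁻ ω, ‖∑ k ∈ Finset.range N, d k ω‖ₑ ^ p ∂μ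
      ≤ (β : ℝ≥0∞) ^ p * ∫⁻ ω, ‖∑ i : Fin N, ((ε i : ℤ) : ℝ) • d i ω‖ₑ ^ p ∂μ := by
    let ε' : ℕ → ℝ := fun k => if h : k < N then ((ε ⟨k, h⟩ : ℤ) : ℝ) else 1
    have hε' (k : ℕ) : ε' k = 1 ∨ ε' k = -1 := by
      by_cases h : k < N
      · rcases Int.units_eq_one_or (ε ⟨k, h⟩) with h' | h' <;> simp [ε', h, h']
      · simp [ε', h]
    have h := ENNReal.rpow_le_rpow (hβ Ω m μ hμ 𝓖 d hd hdp hd0 N ε' hε') hp0.le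
    rw [ENNReal.mul_rpow_of_nonneg _ _ hp0.le, eLpNorm_ofReal_rpow hp0,
      eLpNorm_ofReal_rpow hp0] at h
    simp only [Finset.sum_apply, Pi.smul_apply] at h
    refine h.trans_eq ?_
    congr 2 with ω
    rw [Finset.sum_range]
    simp [ε']
  have hmeas (ε : Fin N → ℤˣ) :
      AEMeasurable (fun ω => ‖∑ i : Fin N, ((ε i : ℤ) : ℝ) • d i ω‖ₑ ^ p) μ := by
    refine AEMeasurable.pow_const (AEStronglyMeasurable.enorm ?_) _
    have : AEStronglyMeasurable (∑ i : Fin N, ((ε i : ℤ) : ℝ) • d i) μ :=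
      Finset.aestronglyMeasurable_sum _ fun i _ => (hdp i).1.const_smul _
    refine this.congr (ae_of_all _ fun ω => ?_)
    simp
  have h2N : (2 : ℝ≥0∞) ^ N ≠ 0 := by positivity
  have h2N' : (2 : ℝ≥0∞) ^ N ≠ ⊤ := by finiteness
  have hmain : ∫⁻ ω, ‖∑ k ∈ Finset.range N, d k ω‖ₑ ^ p ∂μ
      ≤ (β : ℝ≥0∞) ^ p * (C * ∫⁻ ω, (∑ k ∈ Finset.range N, ‖d k ω‖ₑ ^ 2) ^ (p / 2) ∂μ) := by
    have hcard : (Fintype.card (Fin N → ℤˣ) : ℝ≥0∞) = 2 ^ N := by simp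
    refine (ENNReal.mul_le_mul_iff_right h2N h2N').1 ?_
    calc (2 : ℝ≥0∞) ^ N * ∫⁻ ω, ‖∑ k ∈ Finset.range N, d k ω‖ₑ ^ p ∂μ
        = ∑ _ε : Fin N → ℤˣ, ∫⁻ ω, ‖∑ k ∈ Finset.range N, d k ω‖ₑ ^ p ∂μ := by
          rw [Finset.sum_const, Finset.card_univ, nsmul_eq_mul, hcard]
      _ ≤ ∑ ε : Fin N → ℤˣ,
          (β : ℝ≥0∞) ^ p * ∫⁻ ω, ‖∑ i : Fin N, ((ε i : ℤ) : ℝ) • d i ω‖ₑ ^ p ∂μ :=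
          Finset.sum_le_sum fun ε _ => hsigned ε
      _ = (β : ℝ≥0∞) ^ p *
          ∫⁻ ω, ∑ ε : Fin N → ℤˣ, ‖∑ i : Fin N, ((ε i : ℤ) : ℝ) • d i ω‖ₑ ^ p ∂μ := by
          rw [← Finset.mul_sum, lintegral_finsetSum' _ fun ε _ => hmeas ε]
      _ ≤ (β : ℝ≥0∞) ^ p * ∫⁻ ω, 2 ^ N * (C * (∑ i : Fin N, ‖d i ω‖ₑ ^ 2) ^ (p / 2)) ∂μ := by
          gcongr with ω
          exact hC N fun i => d i ω
      _ = _ := by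
          rw [lintegral_const_mul' _ _ h2N', lintegral_const_mul' _ _ ENNReal.coe_ne_top]
          simp_rw [Finset.sum_range]
          ring
  have hmink := lintegral_sum_rpow_le (μ := μ) (q := p / 2) (by linarith) (Finset.range N)
    (fun k ω => ‖d k ω‖ₑ ^ 2) fun k _ => (hdp k).1.enorm.pow_const _
  have hterm (k : ℕ) : (∫⁻ ω, (‖d k ω‖ₑ ^ 2) ^ (p / 2) ∂μ) ^ (1 / (p / 2))
      = eLpNorm (d k) (ENNReal.ofReal p) μ ^ 2 := by
    rw [eLpNorm_ofReal_eq hp0, ← ENNReal.rpow_natCast, ← ENNReal.rpow_mul]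
    congr 1
    · congr 1 with ω
      rw [← ENNReal.rpow_natCast, ← ENNReal.rpow_mul]
      congr 1
      push_cast
      ring
    · push_cast
      field_simp
  simp_rw [hterm] at hmink
  rw [eLpNorm_ofReal_eq hp0]
  simp only [Finset.sum_apply]
  refine (ENNReal.rpow_le_rpow hmain (by positivity)).trans ?_
  rw [ENNReal.mul_rpow_of_nonneg _ _ (by positivity),
    ENNReal.mul_rpow_of_nonneg _ _ (by positivity), ← ENNReal.rpow_mul,
    mul_one_div_cancel hp0.ne', ENNReal.rpow_one, ENNReal.coe_mul,
    ENNReal.coe_rpow_of_nonneg _ (by positivity), mul_assoc]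
  gcongr
  have h := ENNReal.rpow_le_rpow hmink (show 0 ≤ (1 / 2 : ℝ) by norm_num)
  rw [← ENNReal.rpow_mul] at h
  rwa [show 1 / (p / 2) * (1 / 2) = 1 / p by field_simp] at h

end UMD

/-! ### Moments of Gaussian sums -/

/-- The Kahane–Khintchine inequality for centered Gaussian measures, with a constant depending on
`p` only. By Chebyshev's inequality the ball of radius twice the quadratic mean has measure at least
`3 / 4`, and Fernique's theorem bounds an exponential square moment in terms of such a radius. -/
lemma exists_lintegral_enorm_rpow_le_of_gaussian {p : ℝ} (hp : 0 < p) : ∃ K : ℝ≥0,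
    ∀ (E : Type u) [NormedAddCommGroup E] [NormedSpace ℝ E] [CompleteSpace E]
      [SecondCountableTopology E] [MeasurableSpace E] [BorelSpace E] (μ : Measure E) [IsGaussian μ],
      (∀ L : StrongDual ℝ E, μ[L] = 0) →
      ∫⁻ x, ‖x‖ₑ ^ p ∂μ ≤ K * (∫⁻ x, ‖x‖ₑ ^ 2 ∂μ) ^ (p / 2) := by
  set c : ℝ≥0∞ := 3 / 4 with hc
  have hc3 : c = ENNReal.ofReal (3 / 4) := by
    rw [hc, ENNReal.ofReal_div_of_pos (by norm_num)]; simp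
  have hc1 : 1 - c = ENNReal.ofReal (1 / 4) := by
    rw [hc3, ← ENNReal.ofReal_one, ← ENNReal.ofReal_sub _ (by norm_num)]; norm_num
  have hc_gt : 2⁻¹ < c := by
    rw [hc3, show (2⁻¹ : ℝ≥0∞) = ENNReal.ofReal (1 / 2) by
      rw [ENNReal.ofReal_div_of_pos (by norm_num)]; simp]
    exact (ENNReal.ofReal_lt_ofReal_iff (by norm_num)).2 (by norm_num)
  have hc_lt : c < 1 := by
    rw [hc3, ← ENNReal.ofReal_one]
    exact (ENNReal.ofReal_lt_ofReal_iff (by norm_num)).2 (by norm_num)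
  set κ := Fernique.logRatio c with hκ
  have hκ0 : 0 < κ := Fernique.logRatio_pos hc_gt hc_lt
  set M : ℝ≥0∞ := .ofReal (Real.exp κ)
    + ∑' n : ℕ, .ofReal (Real.exp (-2⁻¹ * Real.log (c / (1 - c)).toReal * 2 ^ n)) with hM
  have hMtop : M ≠ ⊤ := by
    refine ENNReal.add_ne_top.2 ⟨ENNReal.ofReal_ne_top, ne_of_lt ?_⟩
    refine Summable.tsum_ofReal_lt_top <|
      Real.summable_exp_nat_mul_of_ge ?_ (fun i ↦ mod_cast (Nat.lt_pow_self (by simp)).le)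
    refine mul_neg_of_neg_of_pos (by simp) (Real.log_pos ?_)
    rw [hc1, hc3, ENNReal.toReal_div, ENNReal.toReal_ofReal (by norm_num),
      ENNReal.toReal_ofReal (by norm_num)]
    norm_num
  set D : ℝ := 1 + (⌈p / 2⌉₊.factorial : ℝ) with hD
  have hD0 : 0 < D := by positivity
  refine ⟨(ENNReal.ofReal ((4 / κ) ^ (p / 2) * D) * M).toNNReal, ?_⟩
  intro E _ _ _ _ _ _ μ _ hμ
  rw [ENNReal.coe_toNNReal (ENNReal.mul_ne_top ENNReal.ofReal_ne_top hMtop)]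
  set I := ∫⁻ x, ‖x‖ₑ ^ 2 ∂μ with hI
  have hItop : I ≠ ⊤ := by
    have h := (IsGaussian.memLp_id μ 2 (by simp)).2
    rw [eLpNorm_lt_top_iff_lintegral_rpow_enorm_lt_top (by simp) (by simp)] at h
    simpa [hI] using h.ne
  by_cases hI0 : I = 0
  · have h0 : ∀ᵐ x ∂μ, ‖x‖ₑ ^ 2 = 0 := by
      rw [hI, lintegral_eq_zero_iff (by fun_prop)] at hI0
      exact hI0
    have : ∫⁻ x, ‖x‖ₑ ^ p ∂μ = 0 := by
      rw [lintegral_eq_zero_iff (by fun_prop)]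
      filter_upwards [h0] with x hx
      have : x = 0 := by simpa using hx
      simp [this, hp]
    rw [this]
    exact zero_le
  have hIr : 0 < I.toReal := ENNReal.toReal_pos hI0 hItop
  set a : ℝ := 2 * √I.toReal with ha
  have ha0 : 0 < a := by positivity
  have ha2 : a ^ 2 = 4 * I.toReal := by
    rw [ha, mul_pow, Real.sq_sqrt hIr.le]; norm_num
  have hball : c ≤ μ {x | ‖x‖ ≤ a} := by
    have hcompl : μ {x | ‖x‖ ≤ a}ᶜ ≤ 1 - c := by
      have h1 : {x : E | ‖x‖ ≤ a}ᶜ ⊆ {x | 4 * I ≤ ‖x‖ₑ ^ 2} := by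
        intro x hx
        simp only [Set.mem_compl_iff, Set.mem_ofPred_eq, not_le] at hx ⊢
        rw [← ofReal_norm, ← ENNReal.ofReal_pow (norm_nonneg _), ← ENNReal.ofReal_toReal hItop,
          show (4 : ℝ≥0∞) = ENNReal.ofReal 4 by simp, ← ENNReal.ofReal_mul (by norm_num), ← ha2]
        exact ENNReal.ofReal_le_ofReal (pow_le_pow_left₀ ha0.le hx.le 2)
      refine (measure_mono h1).trans ((meas_ge_le_lintegral_div (by fun_prop) ?_ ?_).trans ?_)
      · simpa using hI0
      · finiteness
      · rw [← hI, hc1, ENNReal.div_le_iff (by simpa using hI0) (by finiteness), ← mul_assoc,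
          show (4 : ℝ≥0∞) = ENNReal.ofReal 4 by simp, ← ENNReal.ofReal_mul (by norm_num)]
        norm_num
    have hm : MeasurableSet {x : E | ‖x‖ ≤ a} := measurableSet_le (by fun_prop) (by fun_prop)
    have h2 := prob_compl_eq_one_sub (μ := μ) hm.compl
    rw [compl_compl] at h2
    rw [h2]
    calc c = 1 - (1 - c) := (ENNReal.sub_sub_cancel (by simp) hc_lt.le).symm
      _ ≤ _ := tsub_le_tsub_left hcompl _
  have hF := lintegral_exp_mul_sq_norm_le_of_map_rotation_eq_self
    (IsGaussian.map_rotation_eq_self_of_forall_strongDual_eq_zero hμ _) hball hc_gt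
  rw [← hκ, ← hM] at hF
  have hpt (x : E) : ‖x‖ₑ ^ p ≤ ENNReal.ofReal ((a ^ 2 / κ) ^ (p / 2) * D) *
      ENNReal.ofReal (Real.exp (κ * a⁻¹ ^ 2 * ‖x‖ ^ 2)) := by
    rw [← ofReal_norm, ENNReal.ofReal_rpow_of_nonneg (norm_nonneg _) hp.le,
      ← ENNReal.ofReal_mul (by positivity)]
    refine ENNReal.ofReal_le_ofReal ?_
    have h := rpow_le_factorial_mul_exp (show 0 ≤ p / 2 by positivity)
      (show 0 ≤ κ * a⁻¹ ^ 2 * ‖x‖ ^ 2 by positivity)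
    have e : ‖x‖ ^ p = (a ^ 2 / κ) ^ (p / 2) * (κ * a⁻¹ ^ 2 * ‖x‖ ^ 2) ^ (p / 2) := by
      rw [← Real.mul_rpow (by positivity) (by positivity)]
      have : a ^ 2 / κ * (κ * a⁻¹ ^ 2 * ‖x‖ ^ 2) = ‖x‖ ^ 2 := by field_simp
      rw [this, ← Real.rpow_natCast, ← Real.rpow_mul (norm_nonneg _)]
      congr 1
      push_cast; ring
    rw [e, mul_assoc ((a ^ 2 / κ) ^ (p / 2))]
    gcongr
  calc ∫⁻ x, ‖x‖ₑ ^ p ∂μ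
      ≤ ∫⁻ x, ENNReal.ofReal ((a ^ 2 / κ) ^ (p / 2) * D) *
        ENNReal.ofReal (Real.exp (κ * a⁻¹ ^ 2 * ‖x‖ ^ 2)) ∂μ := lintegral_mono hpt
    _ = ENNReal.ofReal ((a ^ 2 / κ) ^ (p / 2) * D) *
        ∫⁻ x, ENNReal.ofReal (Real.exp (κ * a⁻¹ ^ 2 * ‖x‖ ^ 2)) ∂μ :=
        lintegral_const_mul' _ _ ENNReal.ofReal_ne_top
    _ ≤ ENNReal.ofReal ((a ^ 2 / κ) ^ (p / 2) * D) * M := by gcongr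
    _ = ENNReal.ofReal ((4 / κ) ^ (p / 2) * D) * M * I ^ (p / 2) := by
        rw [ha2, show 4 * I.toReal / κ = 4 / κ * I.toReal by ring,
          Real.mul_rpow (by positivity) hIr.le, mul_right_comm,
          ENNReal.ofReal_mul (by positivity),
          ← ENNReal.ofReal_rpow_of_nonneg hIr.le (by positivity), ENNReal.ofReal_toReal hItop]
        ring

/-- The linear map `g ↦ ∑ g_i v_i`. -/
noncomputable def linCombCLM {V : Type*} [NormedAddCommGroup V] [NormedSpace ℝ V] {n : ℕ}
    (v : Fin n → V) : EuclideanSpace ℝ (Fin n) →L[ℝ] V :=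
  ∑ i, (EuclideanSpace.proj i : EuclideanSpace ℝ (Fin n) →L[ℝ] ℝ).smulRight (v i)

@[simp] lemma linCombCLM_apply {V : Type*} [NormedAddCommGroup V] [NormedSpace ℝ V] {n : ℕ}
    (v : Fin n → V) (g : EuclideanSpace ℝ (Fin n)) : linCombCLM v g = ∑ i, g i • v i := by
  simp [linCombCLM]

lemma measurable_enorm_linCombCLM_pow {V : Type*} [NormedAddCommGroup V] [NormedSpace ℝ V] {n : ℕ}
    (v : Fin n → V) (k : ℕ) : Measurable fun g => ‖linCombCLM v g‖ₑ ^ k :=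
  (linCombCLM v).continuous.enorm.measurable.pow_const k

/-- The Kahane–Khintchine inequality for Gaussian sums `∑ gᵢ vᵢ`, with a constant independent of the
number of summands. -/
lemma exists_lintegral_linCombCLM_rpow_le {V : Type u} [NormedAddCommGroup V] [NormedSpace ℝ V]
    [CompleteSpace V] [SecondCountableTopology V] {p : ℝ} (hp : 0 < p) : ∃ K : ℝ≥0,
    ∀ (n : ℕ) (v : Fin n → V),
      ∫⁻ g, ‖linCombCLM v g‖ₑ ^ p ∂stdGaussian (EuclideanSpace ℝ (Fin n))
        ≤ K * (∫⁻ g, ‖linCombCLM v g‖ₑ ^ 2 ∂stdGaussian (EuclideanSpace ℝ (Fin n))) ^ (p / 2) := by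
  obtain ⟨K, hK⟩ := exists_lintegral_enorm_rpow_le_of_gaussian.{u} hp
  refine ⟨K, fun n v => ?_⟩
  let _ : MeasurableSpace V := borel V
  have : BorelSpace V := ⟨rfl⟩
  have h := hK V ((stdGaussian (EuclideanSpace ℝ (Fin n))).map (linCombCLM v)) fun L => by
    rw [integral_map (by fun_prop) (by fun_prop)]
    exact integral_strongDual_stdGaussian (L.comp (linCombCLM v))
  rwa [lintegral_map (by fun_prop) (by fun_prop), lintegral_map (by fun_prop) (by fun_prop)] at h

lemma lintegral_sq_le_gammaNorm {U V : Type*} [NormedAddCommGroup U]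
    [InnerProductSpace ℝ U] [NormedAddCommGroup V] [NormedSpace ℝ V] {n : ℕ} {h : Fin n → U}
    (hh : Orthonormal ℝ h) (R : U →L[ℝ] V) :
    ∫⁻ g, ‖linCombCLM (fun i => R (h i)) g‖ₑ ^ 2 ∂stdGaussian (EuclideanSpace ℝ (Fin n))
      ≤ gammaNorm R ^ 2 := by
  have h1 : eLpNorm (fun g : Fin n → ℝ => ∑ i, g i • R (h i)) 2
      (Measure.pi fun _ => gaussianReal 0 1) ≤ gammaNorm R :=
    le_iSup_of_le n (le_iSup_of_le h (le_iSup_of_le hh le_rfl))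
  refine le_trans (le_of_eq ?_) (pow_le_pow_left' h1 2)
  rw [← map_pi_eq_stdGaussian, lintegral_map (measurable_enorm_linCombCLM_pow _ 2) (by fun_prop),
    eLpNorm_eq_lintegral_rpow_enorm_toReal (by simp) (by simp), ← ENNReal.rpow_natCast,
    ← ENNReal.rpow_mul]
  simp

/-! ### Increments of a cylindrical Wiener process -/

section Increments

variable {Ω : Type*} {mΩ : MeasurableSpace Ω} {P : Measure Ω} {T : ℝ≥0}
  {𝓕 : Filtration ℝ≥0 mΩ} {U : Type*} [NormedAddCommGroup U] [InnerProductSpace ℝ U]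
  {W : ℝ≥0 → U → Ω → ℝ}

lemma IsCylindricalWiener.sum_ae (hW : IsCylindricalWiener P T 𝓕 W) {t : ℝ≥0} (ht : t ≤ T)
    {ι : Type*} (s : Finset ι) (c : ι → ℝ) (e : ι → U) :
    W t (∑ i ∈ s, c i • e i) =ᵐ[P] fun ω => ∑ i ∈ s, c i * W t (e i) ω := by
  classical
  induction s using Finset.induction_on with
  | empty =>
    have h := hW.linear t ht 1 0 0
    filter_upwards [h] with ω hω
    simpa using hω
  | insert i s hi ih =>
    rw [Finset.sum_insert hi]
    filter_upwards [hW.linear t ht (c i) (e i) (∑ j ∈ s, c j • e j), ih] with ω h1 h2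
    rw [h1, Finset.sum_insert hi]
    simp [h2]

lemma IsCylindricalWiener.measurable_sub (hW : IsCylindricalWiener P T 𝓕 W) {s t : ℝ≥0}
    (hst : s ≤ t) (ht : t ≤ T) (u : U) : StronglyMeasurable[𝓕 t] (W t u - W s u) :=
  (hW.adapted t ht u).sub ((hW.adapted s (hst.trans ht) u).mono (𝓕.mono hst))

/-- The increment `W_t u - W_s u` is independent of `𝓕 s`. -/
lemma IsCylindricalWiener.setIntegral_comp [IsProbabilityMeasure P]
    (hW : IsCylindricalWiener P T 𝓕 W) {s t : ℝ≥0}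
    (hst : s ≤ t) (ht : t ≤ T) (u : U) {A : Set Ω} (hA : MeasurableSet[𝓕 s] A) {F : Type*}
    [NormedAddCommGroup F] [NormedSpace ℝ F] [CompleteSpace F] {φ : ℝ → F}
    (hφ : StronglyMeasurable φ) (hint : Integrable φ (gaussianReal 0 ((t - s) * ‖u‖₊ ^ 2))) :
    ∫ ω in A, φ (W t u ω - W s u ω) ∂P
      = P.real A • ∫ x, φ x ∂gaussianReal 0 ((t - s) * ‖u‖₊ ^ 2) := by
  set X : Ω → ℝ := W t u - W s u with hX
  have hXm : Measurable X := ((hW.measurable_sub hst ht u).mono (𝓕.le t)).measurable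
  have hmap := hW.law s t hst ht u
  have hint' : Integrable (φ ∘ X) P := by
    rw [← integrable_map_measure hφ.aestronglyMeasurable hXm.aemeasurable, hmap]
    exact hint
  have h1 := condExp_indep_eq (μ := P) (f := φ ∘ X) (hXm.comap_le) (𝓕.le s)
    (hφ.comp_measurable (comap_measurable X)) (hW.indep s t hst ht u)
  have h2 := setIntegral_condExp (𝓕.le s) hint' hA
  calc ∫ ω in A, φ (W t u ω - W s u ω) ∂P = ∫ ω in A, (φ ∘ X) ω ∂P := rfl
    _ = ∫ ω in A, (P[φ ∘ X | 𝓕 s]) ω ∂P := h2.symm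
    _ = ∫ ω in A, (∫ ω', (φ ∘ X) ω' ∂P) ∂P := integral_congr_ae (ae_restrict_of_ae h1)
    _ = P.real A • ∫ ω', (φ ∘ X) ω' ∂P := by rw [setIntegral_const]
    _ = _ := by
        rw [← hmap, integral_map hXm.aemeasurable hφ.aestronglyMeasurable]
        rfl

/-- The increments of the Wiener process along an orthonormal system are independent centered
Gaussian variables of variance `t - s`, jointly independent of `𝓕 s`. -/
lemma IsCylindricalWiener.map_restrict_increments [IsProbabilityMeasure P]
    (hW : IsCylindricalWiener P T 𝓕 W) {s t : ℝ≥0}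
    (hst : s ≤ t) (ht : t ≤ T) {n : ℕ} {e : Fin n → U} (he : Orthonormal ℝ e) {A : Set Ω}
    (hA : MeasurableSet[𝓕 s] A) :
    (P.restrict A).map (fun ω => WithLp.toLp 2 (fun i => W t (e i) ω - W s (e i) ω))
      = P A • (stdGaussian (EuclideanSpace ℝ (Fin n))).map (fun g => √((t : ℝ) - s) • g) := by
  have hXm : Measurable fun ω =>
      (WithLp.toLp 2 (fun i => W t (e i) ω - W s (e i) ω) : EuclideanSpace ℝ (Fin n)) := by
    refine (WithLp.measurable_toLp 2 (Fin n → ℝ)).comp (measurable_pi_iff.2 fun i => ?_)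
    exact ((hW.measurable_sub hst ht (e i)).mono (𝓕.le t)).measurable
  have : IsFiniteMeasure (P A • (stdGaussian (EuclideanSpace ℝ (Fin n))).map
      (fun g => √((t : ℝ) - s) • g)) := by
    have := Measure.isProbabilityMeasure_map (μ := stdGaussian (EuclideanSpace ℝ (Fin n)))
      (f := fun g => √((t : ℝ) - s) • g) (by fun_prop)
    exact Measure.smul_finite _ (measure_ne_top _ _)
  refine Measure.ext_of_charFun ?_
  ext c
  set x : U := ∑ i, c i • e i with hx
  have hnorm : ‖x‖ ^ 2 = ‖c‖ ^ 2 := by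
    have h := he.inner_sum (fun i => c i) (fun i => c i) Finset.univ
    rw [← real_inner_self_eq_norm_sq, hx, h, EuclideanSpace.real_norm_sq_eq]
    simp [sq]
  have hst' : (0 : ℝ) ≤ (t : ℝ) - s := sub_nonneg.2 (NNReal.coe_le_coe.2 hst)
  have hlin : (fun ω => ((∑ i, c i * (W t (e i) ω - W s (e i) ω) : ℝ) : ℂ))
      =ᵐ[P] fun ω => ((W t x ω - W s x ω : ℝ) : ℂ) := by
    filter_upwards [hW.sum_ae ht Finset.univ (fun i => c i) e,
      hW.sum_ae (hst.trans ht) Finset.univ (fun i => c i) e] with ω h1 h2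
    rw [← hx] at h1 h2
    rw [h1, h2, ← Finset.sum_sub_distrib]
    simp_rw [mul_sub]
  have hL : charFun ((P.restrict A).map
      (fun ω => WithLp.toLp 2 (fun i => W t (e i) ω - W s (e i) ω))) c
      = ∫ ω in A, Complex.exp (((W t x ω - W s x ω : ℝ) : ℂ) * Complex.I) ∂P := by
    rw [charFun_apply, integral_map hXm.aemeasurable (by fun_prop)]
    refine integral_congr_ae (ae_restrict_of_ae ?_)
    filter_upwards [hlin] with ω hω
    rw [← hω, PiLp.inner_apply]
    simp [mul_comm]
  rw [hL, hW.setIntegral_comp hst ht x hA (φ := fun r : ℝ => Complex.exp ((r : ℂ) * Complex.I))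
    (Continuous.stronglyMeasurable (by fun_prop))
    ((integrable_const (1 : ℝ)).mono' (by fun_prop)
      (ae_of_all _ fun r => by rw [Complex.norm_exp_ofReal_mul_I]))]
  have h1 : ∫ r : ℝ, Complex.exp ((r : ℂ) * Complex.I) ∂gaussianReal 0 ((t - s) * ‖x‖₊ ^ 2)
      = charFun (gaussianReal 0 ((t - s) * ‖x‖₊ ^ 2)) 1 := by
    rw [charFun_apply_real]; simp
  have h2 : charFun (P A • (stdGaussian (EuclideanSpace ℝ (Fin n))).map
      (fun g => √((t : ℝ) - s) • g)) c
      = P.real A • charFun ((stdGaussian (EuclideanSpace ℝ (Fin n))).map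
      (fun g => √((t : ℝ) - s) • g)) c := by
    rw [charFun_apply, charFun_apply, integral_smul_measure]; rfl
  rw [h1, h2, charFun_map_smul, charFun_stdGaussian, charFun_gaussianReal]
  congr 2
  have h3 : (((t - s) * ‖x‖₊ ^ 2 : ℝ≥0) : ℝ) = ‖√((t : ℝ) - s) • c‖ ^ 2 := by
    rw [norm_smul, mul_pow, ← hnorm, Real.norm_eq_abs, sq_abs, Real.sq_sqrt hst']
    push_cast [NNReal.coe_sub hst]
    rfl
  have h4 : ((((t - s) * ‖x‖₊ ^ 2 : ℝ≥0) : ℝ) : ℂ) = (‖√((t : ℝ) - s) • c‖ : ℂ) ^ 2 := by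
    rw [h3]; push_cast; rfl
  rw [h4]
  simp [neg_div]

/-- The moment of the increment `(W_t - W_s) Φ` of a finite rank operator `Φ = ∑ ⟨h_j, ·⟩ x_j`: expand
in an orthonormal basis of the span of the `h_j` and use the Gaussian moment comparison. -/
lemma IsCylindricalWiener.setLIntegral_increment_le [IsProbabilityMeasure P] {V : Type*}
    [NormedAddCommGroup V] [NormedSpace ℝ V]
    (hW : IsCylindricalWiener P T 𝓕 W) {p : ℝ} (hp : 0 < p) {K : ℝ≥0}
    (hK : ∀ (n : ℕ) (v : Fin n → V),
      ∫⁻ g, ‖linCombCLM v g‖ₑ ^ p ∂stdGaussian (EuclideanSpace ℝ (Fin n))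
        ≤ K * (∫⁻ g, ‖linCombCLM v g‖ₑ ^ 2 ∂stdGaussian (EuclideanSpace ℝ (Fin n))) ^ (p / 2))
    {s t : ℝ≥0} (hst : s ≤ t) (ht : t ≤ T) {A : Set Ω} (hA : MeasurableSet[𝓕 s] A)
    {ι : Type*} (J : Finset ι) (h : ι → U) (x : ι → V) :
    ∫⁻ ω in A, ‖∑ j ∈ J, (W t (h j) ω - W s (h j) ω) • x j‖ₑ ^ p ∂P
      ≤ K * ((t - s : ℝ≥0) : ℝ≥0∞) ^ (p / 2) *
        (P A * gammaNorm (∑ j ∈ J, (innerSL ℝ (h j)).smulRight (x j)) ^ p) := by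
  set Φ : U →L[ℝ] V := ∑ j ∈ J, (innerSL ℝ (h j)).smulRight (x j) with hΦ
  let S : Submodule ℝ U := Submodule.span ℝ (h '' J)
  have : FiniteDimensional ℝ S := FiniteDimensional.span_of_finite ℝ (J.finite_toSet.image h)
  let b := stdOrthonormalBasis ℝ S
  set n := Module.finrank ℝ S with hn
  let e : Fin n → U := fun i => (b i : U)
  have he : Orthonormal ℝ e := b.orthonormal.comp_linearIsometry S.subtypeₗᵢ
  have hrep (j : ι) (hj : j ∈ J) : h j = ∑ i, inner ℝ (e i) (h j) • e i := by
    have hjS : h j ∈ S := Submodule.subset_span ⟨j, hj, rfl⟩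
    have h1 := congrArg (Subtype.val) (b.sum_repr' ⟨h j, hjS⟩)
    simp only [Submodule.coe_sum, Submodule.coe_smul, Submodule.coe_inner] at h1
    exact h1.symm
  have hW' (r : ℝ≥0) (hr : r ≤ T) : ∀ᵐ ω ∂P, ∀ j ∈ J,
      W r (h j) ω = ∑ i, inner ℝ (e i) (h j) * W r (e i) ω := by
    refine (ae_ball_iff J.countable_toSet).2 fun j hj => ?_
    have h1 := hW.sum_ae hr Finset.univ (fun i => inner ℝ (e i) (h j)) e
    rwa [← hrep j hj] at h1
  have hsum : ∀ᵐ ω ∂P, ∑ j ∈ J, (W t (h j) ω - W s (h j) ω) • x j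
      = linCombCLM (fun i => Φ (e i)) (WithLp.toLp 2 fun i => W t (e i) ω - W s (e i) ω) := by
    filter_upwards [hW' t ht, hW' s (hst.trans ht)] with ω h1 h2
    rw [linCombCLM_apply]
    have hΦe (i : Fin n) : Φ (e i) = ∑ j ∈ J, inner ℝ (e i) (h j) • x j := by
      simp [hΦ, real_inner_comm]
    simp_rw [hΦe, Finset.smul_sum]
    rw [Finset.sum_comm]
    refine Finset.sum_congr rfl fun j hj => ?_
    rw [h1 j hj, h2 j hj, ← Finset.sum_sub_distrib, Finset.sum_smul]
    refine Finset.sum_congr rfl fun i _ => ?_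
    rw [smul_smul]
    congr 1
    ring
  have hXm : Measurable fun ω =>
      (WithLp.toLp 2 (fun i => W t (e i) ω - W s (e i) ω) : EuclideanSpace ℝ (Fin n)) := by
    refine (WithLp.measurable_toLp 2 (Fin n → ℝ)).comp (measurable_pi_iff.2 fun i => ?_)
    exact ((hW.measurable_sub hst ht (e i)).mono (𝓕.le t)).measurable
  have hFm : Measurable fun g => ‖linCombCLM (fun i => Φ (e i)) g‖ₑ ^ p :=
    (linCombCLM _).continuous.enorm.measurable.pow_const p
  have hst' : (0 : ℝ) ≤ (t : ℝ) - s := sub_nonneg.2 (NNReal.coe_le_coe.2 hst)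
  have hscale : ‖√((t : ℝ) - s)‖ₑ ^ p = ((t - s : ℝ≥0) : ℝ≥0∞) ^ (p / 2) := by
    rw [Real.sqrt_eq_rpow, Real.enorm_eq_ofReal (by positivity),
      ← ENNReal.ofReal_rpow_of_nonneg hst' (by norm_num), ← ENNReal.rpow_mul, ← NNReal.coe_sub hst,
      ENNReal.ofReal_coe_nnreal]
    congr 1
    ring
  calc ∫⁻ ω in A, ‖∑ j ∈ J, (W t (h j) ω - W s (h j) ω) • x j‖ₑ ^ p ∂P
      = ∫⁻ ω in A, ‖linCombCLM (fun i => Φ (e i))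
          (WithLp.toLp 2 fun i => W t (e i) ω - W s (e i) ω)‖ₑ ^ p ∂P := by
        refine lintegral_congr_ae (ae_restrict_of_ae ?_)
        filter_upwards [hsum] with ω hω
        rw [hω]
    _ = P A * ∫⁻ g, ‖linCombCLM (fun i => Φ (e i)) (√((t : ℝ) - s) • g)‖ₑ ^ p
          ∂stdGaussian (EuclideanSpace ℝ (Fin n)) := by
        rw [← lintegral_map (f := fun g => ‖linCombCLM (fun i => Φ (e i)) g‖ₑ ^ p) hFm hXm,
          hW.map_restrict_increments hst ht he hA, lintegral_smul_measure,
          lintegral_map hFm (by fun_prop)]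
        rfl
    _ = P A * (((t - s : ℝ≥0) : ℝ≥0∞) ^ (p / 2) * ∫⁻ g, ‖linCombCLM (fun i => Φ (e i)) g‖ₑ ^ p
          ∂stdGaussian (EuclideanSpace ℝ (Fin n))) := by
        rw [← lintegral_const_mul _ hFm]
        congr 2 with g
        rw [map_smul, enorm_smul, ENNReal.mul_rpow_of_nonneg _ _ hp.le, hscale]
    _ ≤ P A * (((t - s : ℝ≥0) : ℝ≥0∞) ^ (p / 2) * (K * gammaNorm Φ ^ p)) := by
        gcongr
        refine (hK n _).trans ?_
        gcongr
        refine (ENNReal.rpow_le_rpow (lintegral_sq_le_gammaNorm he Φ)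
          (by positivity)).trans_eq ?_
        rw [← ENNReal.rpow_natCast, ← ENNReal.rpow_mul]
        congr 1
        push_cast
        ring
    _ = _ := by ring

end Increments

/-! ### Elementary integrands on one interval of a time grid -/

section Step

variable {Ω : Type*} {mΩ : MeasurableSpace Ω} {P : Measure Ω} {T : ℝ≥0}
  {𝓕 : Filtration ℝ≥0 mΩ} {U : Type*} [NormedAddCommGroup U] [InnerProductSpace ℝ U]
  {V : Type*} [NormedAddCommGroup V] [NormedSpace ℝ V]
  {W : ℝ≥0 → U → Ω → ℝ}

open Classical in
/-- The set of indices `i` with `ω ∈ A i`. -/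
noncomputable def activeSet {ι : Type*} [Fintype ι] (A : ι → Set Ω) (ω : Ω) : Finset ι :=
  Finset.univ.filter fun i => ω ∈ A i

lemma activeSet_preimage_singleton {m : MeasurableSpace Ω} {ι : Type*} [Fintype ι] {A : ι → Set Ω}
    (hA : ∀ i, MeasurableSet[m] (A i)) (S : Finset ι) :
    MeasurableSet[m] (activeSet A ⁻¹' {S}) := by
  classical
  have : activeSet A ⁻¹' {S} = ⋂ i, if i ∈ S then A i else (A i)ᶜ := by
    ext ω
    simp only [Set.mem_preimage, Set.mem_singleton_iff, Set.mem_iInter, Finset.ext_iff, activeSet,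
      Finset.mem_filter, Finset.mem_univ, true_and]
    refine forall_congr' fun i => ?_
    by_cases hi : i ∈ S <;> simp [hi]
  rw [this]
  refine MeasurableSet.iInter fun i => ?_
  split_ifs
  · exact hA i
  · exact (hA i).compl

lemma sum_indicator_eq_sum_activeSet {ι E : Type*} [Fintype ι] [DecidableEq ι] [AddCommMonoid E]
    (A : ι → Set Ω) (J : Finset ι) (f : ι → Ω → E) (ω : Ω) :
    ∑ i ∈ J, (A i).indicator (f i) ω = ∑ i ∈ J ∩ activeSet A ω, f i ω := by
  rw [← Finset.filter_mem_eq_inter, Finset.sum_filter]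
  refine Finset.sum_congr rfl fun i _ => ?_
  by_cases h : ω ∈ A i <;> simp [activeSet, h]

/-- The value of an elementary integrand with coefficients `1_{A i}`, as an operator. -/
noncomputable def stepOp {ι : Type*} (J : Finset ι) (A : ι → Set Ω) (h : ι → U) (x : ι → V)
    (ω : Ω) : U →L[ℝ] V :=
  ∑ i ∈ J, (A i).indicator (fun _ => (innerSL ℝ (h i)).smulRight (x i)) ω

/-- The integral of an elementary integrand with coefficients `1_{A i}` over `(s, t]`. -/
noncomputable def stepInc {ι : Type*} (W : ℝ≥0 → U → Ω → ℝ) (s t : ℝ≥0) (J : Finset ι)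
    (A : ι → Set Ω) (h : ι → U) (x : ι → V) (ω : Ω) : V :=
  ∑ i ∈ J, (A i).indicator (fun ω => (W t (h i) ω - W s (h i) ω) • x i) ω

lemma measurable_gammaNorm_stepOp {m : MeasurableSpace Ω} {ι : Type*} [Fintype ι] (J : Finset ι)
    {A : ι → Set Ω} (hA : ∀ i, MeasurableSet[m] (A i)) (h : ι → U) (x : ι → V) :
    Measurable[m] fun ω => gammaNorm (stepOp J A h x ω) := by
  classical
  let _ : MeasurableSpace (Finset ι) := ⊤
  have h1 : Measurable[m] (activeSet A) :=
    measurable_to_countable' fun S => activeSet_preimage_singleton hA S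
  have h2 : (fun ω => gammaNorm (stepOp J A h x ω)) = (fun S : Finset ι =>
      gammaNorm (∑ i ∈ J ∩ S, (innerSL ℝ (h i)).smulRight (x i))) ∘ activeSet A := by
    funext ω
    simp only [stepOp, Function.comp_apply, sum_indicator_eq_sum_activeSet]
  rw [h2]
  exact Measurable.comp measurable_from_top h1

/-- Conditionally on `𝓕 s` the increment of an elementary integral is that of a deterministic finite
rank operator: split the event `B` according to which of the events `A i` occur. -/
lemma IsCylindricalWiener.setLIntegral_stepInc_le [IsProbabilityMeasure P]
    (hW : IsCylindricalWiener P T 𝓕 W) {p : ℝ} (hp : 0 < p) {K : ℝ≥0}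
    (hK : ∀ (n : ℕ) (v : Fin n → V),
      ∫⁻ g, ‖linCombCLM v g‖ₑ ^ p ∂stdGaussian (EuclideanSpace ℝ (Fin n))
        ≤ K * (∫⁻ g, ‖linCombCLM v g‖ₑ ^ 2 ∂stdGaussian (EuclideanSpace ℝ (Fin n))) ^ (p / 2))
    {s t : ℝ≥0} (hst : s ≤ t) (ht : t ≤ T) {B : Set Ω} (hB : MeasurableSet[𝓕 s] B)
    {ι : Type*} [Fintype ι] (J : Finset ι) {A : ι → Set Ω}
    (hA : ∀ i, MeasurableSet[𝓕 s] (A i)) (h : ι → U) (x : ι → V) :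
    ∫⁻ ω in B, ‖stepInc W s t J A h x ω‖ₑ ^ p ∂P
      ≤ K * ((t - s : ℝ≥0) : ℝ≥0∞) ^ (p / 2) *
        ∫⁻ ω in B, gammaNorm (stepOp J A h x ω) ^ p ∂P := by
  classical
  have hpre (S : Finset ι) : MeasurableSet[𝓕 s] (B ∩ activeSet A ⁻¹' {S}) :=
    hB.inter (activeSet_preimage_singleton hA S)
  have hsplit (g : Ω → ℝ≥0∞) : ∫⁻ ω in B, g ω ∂P
      = ∑ S : Finset ι, ∫⁻ ω in B ∩ activeSet A ⁻¹' {S}, g ω ∂P := by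
    have hU : B = ⋃ S ∈ (Finset.univ : Finset (Finset ι)), B ∩ activeSet A ⁻¹' {S} := by
      ext ω; simp
    conv_lhs => rw [hU]
    refine lintegral_biUnion_finset ?_ (fun S _ => 𝓕.le s _ (hpre S)) g
    intro S _ S' _ hne
    refine Set.disjoint_left.2 fun ω h1 h2 => hne ?_
    exact h1.2.symm.trans h2.2
  rw [hsplit, hsplit, Finset.mul_sum]
  refine Finset.sum_le_sum fun S _ => ?_
  have hm := 𝓕.le s _ (hpre S)
  have h1 := hW.setLIntegral_increment_le hp hK hst ht (hpre S) (J ∩ S) h x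
  calc ∫⁻ ω in B ∩ activeSet A ⁻¹' {S}, ‖stepInc W s t J A h x ω‖ₑ ^ p ∂P
      = ∫⁻ ω in B ∩ activeSet A ⁻¹' {S},
          ‖∑ j ∈ J ∩ S, (W t (h j) ω - W s (h j) ω) • x j‖ₑ ^ p ∂P := by
        refine setLIntegral_congr_fun hm fun ω hω => ?_
        have : activeSet A ω = S := hω.2
        simp only [stepInc]
        rw [sum_indicator_eq_sum_activeSet A J, this]
    _ ≤ _ := h1
    _ = K * ((t - s : ℝ≥0) : ℝ≥0∞) ^ (p / 2) * ∫⁻ ω in B ∩ activeSet A ⁻¹' {S},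
          gammaNorm (∑ j ∈ J ∩ S, (innerSL ℝ (h j)).smulRight (x j)) ^ p ∂P := by
        rw [setLIntegral_const, mul_comm (P _)]
    _ = _ := by
        congr 1
        refine setLIntegral_congr_fun hm fun ω hω => ?_
        have : activeSet A ω = S := hω.2
        simp only [stepOp]
        rw [sum_indicator_eq_sum_activeSet A J (fun i _ => (innerSL ℝ (h i)).smulRight (x i)), this]

lemma IsCylindricalWiener.memLp_increment [IsProbabilityMeasure P]
    (hW : IsCylindricalWiener P T 𝓕 W) {s t : ℝ≥0} (hst : s ≤ t) (ht : t ≤ T) (u : U) (x : V)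
    (p : ℝ≥0) : MemLp (fun ω => (W t u ω - W s u ω) • x) p P := by
  have hXm : Measurable (W t u - W s u) := ((hW.measurable_sub hst ht u).mono (𝓕.le t)).measurable
  have h1 : MemLp (W t u - W s u) p P := by
    have h2 := memLp_id_gaussianReal (μ := 0) (v := (t - s) * ‖u‖₊ ^ 2) p
    rw [← hW.law s t hst ht u, memLp_map_measure_iff (by fun_prop) hXm.aemeasurable] at h2
    exact h2
  exact ((1 : ℝ →L[ℝ] ℝ).smulRight x).comp_memLp' h1

lemma IsCylindricalWiener.condExp_increment [IsProbabilityMeasure P] [CompleteSpace V]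
    (hW : IsCylindricalWiener P T 𝓕 W) {s t : ℝ≥0} (hst : s ≤ t) (ht : t ≤ T) (u : U) (x : V) :
    P[fun ω => (W t u ω - W s u ω) • x | 𝓕 s] =ᵐ[P] 0 := by
  have hXm : Measurable (W t u - W s u) := ((hW.measurable_sub hst ht u).mono (𝓕.le t)).measurable
  have h1 := condExp_indep_eq (μ := P) (f := fun ω => (W t u ω - W s u ω) • x) (hXm.comap_le)
    (𝓕.le s) ((comap_measurable (W t u - W s u)).stronglyMeasurable.smul_const x)
    (hW.indep s t hst ht u)
  have h2 : ∫ ω, (W t u ω - W s u ω) • x ∂P = 0 := by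
    rw [integral_smul_const]
    have h3 : ∫ ω, (W t u ω - W s u ω) ∂P = ∫ r, r ∂(P.map (W t u - W s u)) := by
      rw [integral_map hXm.aemeasurable (by fun_prop)]; rfl
    rw [h3, hW.law s t hst ht u, integral_id_gaussianReal, zero_smul]
  filter_upwards [h1] with ω hω
  rw [hω, h2]; rfl

section

variable {ι : Type*} {s t : ℝ≥0} (J : Finset ι) {A : ι → Set Ω}

lemma indicator_stepInc (B : Set Ω) (h : ι → U) (x : ι → V) :
    B.indicator (stepInc W s t J A h x) = stepInc W s t J (fun i => B ∩ A i) h x := by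
  funext ω
  by_cases hω : ω ∈ B
  · rw [Set.indicator_of_mem hω]
    refine Finset.sum_congr rfl fun i _ => ?_
    by_cases hi : ω ∈ A i <;> simp [hi, hω]
  · rw [Set.indicator_of_notMem hω, stepInc]
    refine (Finset.sum_eq_zero fun i _ => ?_).symm
    simp [hω]

lemma IsCylindricalWiener.stronglyMeasurable_stepInc (hW : IsCylindricalWiener P T 𝓕 W)
    (hst : s ≤ t) (ht : t ≤ T) (hA : ∀ i, MeasurableSet[𝓕 s] (A i)) (h : ι → U) (x : ι → V) :
    StronglyMeasurable[𝓕 t] (stepInc W s t J A h x) := by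
  refine Finset.stronglyMeasurable_fun_sum _ fun i _ => ?_
  exact StronglyMeasurable.indicator ((hW.measurable_sub hst ht (h i)).smul_const (x i))
    (𝓕.mono hst _ (hA i))

lemma stepInc_eq_sum (h : ι → U) (x : ι → V) : stepInc W s t J A h x
    = ∑ i ∈ J, (A i).indicator (fun ω => (W t (h i) ω - W s (h i) ω) • x i) := by
  funext ω
  simp [stepInc]

lemma IsCylindricalWiener.memLp_stepInc [IsProbabilityMeasure P] (hW : IsCylindricalWiener P T 𝓕 W)
    (hst : s ≤ t) (ht : t ≤ T) (hA : ∀ i, MeasurableSet[𝓕 s] (A i)) (h : ι → U) (x : ι → V)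
    (p : ℝ≥0) : MemLp (stepInc W s t J A h x) p P := by
  rw [stepInc_eq_sum]
  exact memLp_finsetSum' _ fun i _ =>
    (hW.memLp_increment hst ht (h i) (x i) p).indicator (𝓕.le s _ (hA i))

lemma IsCylindricalWiener.condExp_stepInc [IsProbabilityMeasure P] [CompleteSpace V]
    (hW : IsCylindricalWiener P T 𝓕 W)
    (hst : s ≤ t) (ht : t ≤ T) (hA : ∀ i, MeasurableSet[𝓕 s] (A i)) (h : ι → U) (x : ι → V) :
    P[stepInc W s t J A h x | 𝓕 s] =ᵐ[P] 0 := by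
  have hint (i : ι) : Integrable (fun ω => (W t (h i) ω - W s (h i) ω) • x i) P :=
    (hW.memLp_increment hst ht (h i) (x i) 1).integrable le_rfl
  rw [stepInc_eq_sum]
  have h0 (i : ι) : P[(A i).indicator (fun ω => (W t (h i) ω - W s (h i) ω) • x i) | 𝓕 s]
      =ᵐ[P] 0 := by
    filter_upwards [condExp_indicator (hint i) (hA i), hW.condExp_increment hst ht (h i) (x i)]
      with ω h1 h2
    rw [h1]
    by_cases hω : ω ∈ A i <;> simp [hω, h2]
  refine (condExp_finsetSum (s := J)
    (fun i _ => (hint i).indicator (𝓕.le s _ (hA i))) (𝓕 s)).trans ?_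
  filter_upwards [(ae_ball_iff J.countable_toSet).2 fun i _ => h0 i] with ω hω
  rw [Finset.sum_apply]
  exact Finset.sum_eq_zero fun i hi => hω i hi

end

end Step

/-! ### Lebesgue measure on the time axis -/

lemma measurableEmbedding_nnreal_toReal : MeasurableEmbedding NNReal.toReal :=
  NNReal.isClosedEmbedding_coe.measurableEmbedding

lemma map_lebUpTo (t : ℝ≥0) :
    (lebUpTo t).map NNReal.toReal = (volume : Measure ℝ).restrict (Set.Icc 0 (t : ℝ)) := by
  have hpre : Set.Iic t = NNReal.toReal ⁻¹' Set.Iic (t : ℝ) := by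
    ext s; simp
  rw [lebUpTo, hpre, ← measurableEmbedding_nnreal_toReal.restrict_map,
    measurableEmbedding_nnreal_toReal.map_comap,
    Measure.restrict_restrict measurableSet_Iic]
  congr 1
  ext x
  simp only [Set.mem_inter_iff, Set.mem_Iic, Set.mem_range, Set.mem_Icc]
  exact ⟨fun ⟨h1, ⟨y, hy⟩⟩ => ⟨hy ▸ y.2, h1⟩, fun ⟨h1, h2⟩ => ⟨h2, ⟨⟨x, h1⟩, rfl⟩⟩⟩

lemma lintegral_lebUpTo (t : ℝ≥0) (f : ℝ≥0 → ℝ≥0∞) :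
    ∫⁻ s, f s ∂lebUpTo t = ∫⁻ x in Set.Ioo 0 (t : ℝ), f x.toNNReal := by
  rw [← restrict_Ioo_eq_restrict_Icc.symm, ← map_lebUpTo,
    measurableEmbedding_nnreal_toReal.lintegral_map]
  simp

lemma ae_lebUpTo {t : ℝ≥0} {p : ℝ≥0 → Prop} (h : ∀ s, 0 < s → s < t → p s) :
    ∀ᵐ s ∂lebUpTo t, p s := by
  have h1 : ∀ᵐ x ∂(lebUpTo t).map NNReal.toReal, p x.toNNReal := by
    rw [map_lebUpTo, restrict_Ioo_eq_restrict_Icc.symm, ae_restrict_iff' measurableSet_Ioo]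
    refine ae_of_all _ fun x hx => h _ (by simpa using hx.1) ?_
    rw [← NNReal.coe_lt_coe, Real.coe_toNNReal _ hx.1.le]
    exact hx.2
  have h2 := measurableEmbedding_nnreal_toReal.ae_map_iff.1 h1
  simpa using h2

lemma lebUpTo_Ioc {a b t : ℝ≥0} (hb : b ≤ t) : lebUpTo t (Set.Ioc a b) = ((b - a : ℝ≥0) : ℝ≥0∞) := by
  have hpre : Set.Ioc a b = NNReal.toReal ⁻¹' Set.Ioc (a : ℝ) b := by
    ext s; simp
  rw [hpre, ← measurableEmbedding_nnreal_toReal.map_apply, map_lebUpTo,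
    Measure.restrict_apply measurableSet_Ioc, Set.inter_eq_left.2, Real.volume_Ioc]
  · rw [ENNReal.ofReal, NNReal.sub_def]
  · intro x hx
    exact ⟨a.2.trans hx.1.le, hx.2.trans (NNReal.coe_le_coe.2 hb)⟩

lemma lebUpTo_univ (t : ℝ≥0) : lebUpTo t Set.univ = t := by
  have h : ∀ᵐ s ∂lebUpTo t, s ∈ Set.Ioc 0 t := ae_lebUpTo fun s h1 h2 => ⟨h1, h2.le⟩
  have h1 : (Set.univ : Set ℝ≥0) =ᵐ[lebUpTo t] Set.Ioc 0 t := by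
    filter_upwards [h] with s hs
    exact propext ⟨fun _ => hs, fun _ => trivial⟩
  rw [measure_congr h1, lebUpTo_Ioc le_rfl, tsub_zero]

instance (t : ℝ≥0) : IsFiniteMeasure (lebUpTo t) := ⟨by rw [lebUpTo_univ]; simp⟩

lemma lebUpTo_eq_restrict {t T : ℝ≥0} (h : t ≤ T) : lebUpTo t = (lebUpTo T).restrict (Set.Iic t) := by
  rw [lebUpTo, lebUpTo, Measure.restrict_restrict measurableSet_Iic, Set.inter_eq_left.2]
  exact Set.Iic_subset_Iic.2 h

/-- The integral over `[0, t]` of a function that is constant on the intervals of a grid. -/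
lemma lintegral_lebUpTo_eq_sum {t : ℝ≥0} {τ : ℕ → ℝ≥0} (hτ : Monotone τ) (h0 : τ 0 = 0) {N : ℕ}
    (hN : τ N = t) {f : ℝ≥0 → ℝ≥0∞} {c : ℕ → ℝ≥0∞}
    (hf : ∀ k < N, ∀ s, τ k < s → s ≤ τ (k + 1) → f s = c k) :
    ∫⁻ s, f s ∂lebUpTo t = ∑ k ∈ Finset.range N, ((τ (k + 1) - τ k : ℝ≥0) : ℝ≥0∞) * c k := by
  have hle (k : ℕ) (hk : k ≤ N) : τ k ≤ t := hN ▸ hτ hk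
  have h1 : lebUpTo t = (lebUpTo t).restrict (Set.Ioc 0 t) :=
    (Measure.restrict_eq_self_of_ae_mem (ae_lebUpTo (p := (· ∈ Set.Ioc 0 t)) fun s h1 h2 => ⟨h1, h2.le⟩)).symm
  have key (n : ℕ) (hn : n ≤ N) : ∫⁻ s in Set.Ioc 0 (τ n), f s ∂lebUpTo t
      = ∑ k ∈ Finset.range n, ((τ (k + 1) - τ k : ℝ≥0) : ℝ≥0∞) * c k := by
    induction n with
    | zero => simp [h0]
    | succ n ih =>
      have hs : Set.Ioc 0 (τ (n + 1)) = Set.Ioc 0 (τ n) ∪ Set.Ioc (τ n) (τ (n + 1)) :=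
        (Set.Ioc_union_Ioc_eq_Ioc bot_le (hτ n.le_succ)).symm
      rw [hs, lintegral_union measurableSet_Ioc
        (Set.disjoint_left.2 fun s h1 h2 => not_lt.2 h1.2 h2.1), ih (by omega),
        Finset.sum_range_succ]
      congr 1
      rw [setLIntegral_congr_fun measurableSet_Ioc
        (fun s hs => hf n (by omega) s hs.1 hs.2), setLIntegral_const,
        lebUpTo_Ioc (hle _ hn), mul_comm]
  rw [← key N le_rfl, hN, ← h1]

/-! ### Elementary integrals on a time grid -/

/-- The finite set `S` of times, cut off at `t`, is contained in the range of a partition of `[0, t]`,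
expressed by saying that no point of `S` lies strictly inside one of its intervals. -/
lemma exists_time_grid (t : ℝ≥0) (S : Finset ℝ≥0) : ∃ (N : ℕ) (τ : ℕ → ℝ≥0), Monotone τ ∧
    τ 0 = 0 ∧ τ N = t ∧ (∀ k, τ k ≤ t) ∧
    ∀ s ∈ S, ∀ k, min s t ≤ τ k ∨ τ (k + 1) ≤ min s t := by
  classical
  set S' : Finset ℝ≥0 := insert 0 (insert t (S.image fun s => min s t)) with hS'
  have hS't : ∀ s ∈ S', s ≤ t := by
    intro s hs
    simp only [hS', Finset.mem_insert, Finset.mem_image] at hs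
    rcases hs with rfl | rfl | ⟨r, -, rfl⟩
    · exact bot_le
    · exact le_rfl
    · exact min_le_right _ _
  set f := S'.orderEmbOfFin rfl with hf
  set τ : ℕ → ℝ≥0 := fun n => if h : n < S'.card then f ⟨n, h⟩ else t with hτ
  have hcard : 0 < S'.card := Finset.card_pos.2 ⟨0, by simp [hS']⟩
  have hτt (k : ℕ) : τ k ≤ t := by
    simp only [hτ]
    split_ifs with h
    · exact hS't _ (Finset.orderEmbOfFin_mem _ _ _)
    · exact le_rfl
  have hmono : Monotone τ := by
    intro m n hmn
    by_cases hn : n < S'.card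
    · have hm : m < S'.card := hmn.trans_lt hn
      simp only [hτ, hn, hm, dif_pos]
      exact f.monotone (by simpa using hmn)
    · have : τ n = t := by simp [hτ, hn]
      rw [this]
      exact hτt m
  have hmem (s : ℝ≥0) (hs : s ∈ S') : ∃ i, τ i = s := by
    have : s ∈ Set.range f := by
      rw [hf, Finset.range_orderEmbOfFin]; exact hs
    obtain ⟨i, hi⟩ := this
    exact ⟨i, by simp [hτ, hi]⟩
  refine ⟨S'.card, τ, hmono, ?_, by simp [hτ], hτt, ?_⟩
  · obtain ⟨i, hi⟩ := hmem 0 (by simp [hS'])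
    exact le_antisymm (hi ▸ hmono (Nat.zero_le i)) bot_le
  · intro s hs k
    obtain ⟨i, hi⟩ := hmem (min s t) (by
      simp only [hS', Finset.mem_insert, Finset.mem_image]
      exact Or.inr (Or.inr ⟨s, hs, rfl⟩))
    rw [← hi]
    rcases le_or_gt i k with h | h
    · exact Or.inl (hmono h)
    · exact Or.inr (hmono h)

section Grid

variable {Ω : Type*} {mΩ : MeasurableSpace Ω} {P : Measure Ω} {T : ℝ≥0}
  {𝓕 : Filtration ℝ≥0 mΩ} {U : Type*} [NormedAddCommGroup U] [InnerProductSpace ℝ U]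
  {V : Type*} [NormedAddCommGroup V] [NormedSpace ℝ V]
  {W : ℝ≥0 → U → Ω → ℝ}

/-- Every elementary process on `[0, t]` is adapted to some time grid: on each interval of the grid
it is an elementary integrand with coefficients known at the left end point. -/
lemma exists_grid_representation (L : List (ElemTerm U V 𝓕)) (t : ℝ≥0) :
    ∃ (N m : ℕ) (τ : ℕ → ℝ≥0) (A : ℕ → Fin m → Set Ω) (h : Fin m → U) (x : Fin m → V),
      Monotone τ ∧ τ 0 = 0 ∧ τ N = t ∧ (∀ k, τ k ≤ t) ∧
      (∀ k i, MeasurableSet[𝓕 (τ k)] (A k i)) ∧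
      (∀ W : ℝ≥0 → U → Ω → ℝ,
        elemIntegral W t L
          = ∑ k ∈ Finset.range N, stepInc W (τ k) (τ (k + 1)) Finset.univ (A k) h x) ∧
      (∀ k s ω, τ k < s → s ≤ τ (k + 1) →
        elemProcess L s ω = stepOp Finset.univ (A k) h x ω) := by
  classical
  obtain ⟨N, τ, hmono, h0, hN, hle, hgrid⟩ := exists_time_grid t
    ((L.map fun e => e.a).toFinset ∪ (L.map fun e => e.b).toFinset)
  have hga (e) (he : e ∈ L) (k) : min e.a t ≤ τ k ∨ τ (k + 1) ≤ min e.a t :=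
    hgrid _ (by simp only [Finset.mem_union, List.mem_toFinset, List.mem_map]
                exact Or.inl ⟨e, he, rfl⟩) k
  have hgb (e) (he : e ∈ L) (k) : min e.b t ≤ τ k ∨ τ (k + 1) ≤ min e.b t :=
    hgrid _ (by simp only [Finset.mem_union, List.mem_toFinset, List.mem_map]
                exact Or.inr ⟨e, he, rfl⟩) k
  -- an interval of the grid of positive length lies in `(a, b]` or is disjoint from it
  have hcompat (e) (he : e ∈ L) (k) (hk : τ k < τ (k + 1)) :
      (e.b ≤ τ k ∨ τ (k + 1) ≤ e.a) ∨ (e.a ≤ τ k ∧ τ (k + 1) ≤ e.b) := by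
    have hkt : τ k < t := hk.trans_le (hle _)
    rcases hgb e he k with h1 | h1
    · left; left
      rcases min_le_iff.1 h1 with h | h
      · exact h
      · exact absurd h (not_le.2 hkt)
    · rcases hga e he k with h2 | h2
      · right
        refine ⟨?_, h1.trans (min_le_left _ _)⟩
        rcases min_le_iff.1 h2 with h | h
        · exact h
        · exact absurd h (not_le.2 hkt)
      · left; right
        exact h2.trans (min_le_left _ _)
  let A : ℕ → Fin L.length → Set Ω := fun k i =>
    if L[i].a ≤ τ k ∧ τ (k + 1) ≤ L[i].b then L[i].A else ∅
  refine ⟨N, L.length, τ, A, fun i => L[i].h, fun i => L[i].x, hmono, h0, hN, hle, ?_, ?_, ?_⟩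
  · intro k i
    simp only [A]
    split_ifs with hk
    · exact 𝓕.mono hk.1 _ L[i].measurable_A
    · exact @MeasurableSet.empty _ (𝓕 (τ k))
  · intro W
    have hstep (k : ℕ) (ω : Ω) : elemIntegral W (τ (k + 1)) L ω - elemIntegral W (τ k) L ω
        = stepInc W (τ k) (τ (k + 1)) Finset.univ (A k) (fun i => L[i].h) (fun i => L[i].x) ω := by
      rw [elemIntegral, elemIntegral, stepInc, ← Fin.sum_univ_fun_getElem,
        ← Fin.sum_univ_fun_getElem, ← Finset.sum_sub_distrib]
      refine Finset.sum_congr rfl fun i _ => ?_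
      have he : L[i] ∈ L := List.getElem_mem _
      change ElemTerm.integral W _ L[i] ω - ElemTerm.integral W _ L[i] ω = _
      generalize hLe : L[i] = e at he
      simp only [A, hLe]
      rcases (hmono k.le_succ).eq_or_lt with heq | hlt
      · rw [← Nat.succ_eq_add_one, ← heq, sub_self]
        by_cases hω : ω ∈ (if e.a ≤ τ k ∧ τ k ≤ e.b then e.A else ∅)
        · rw [Set.indicator_of_mem hω]; simp
        · rw [Set.indicator_of_notMem hω]
      · have hk := hlt.le
        rcases hcompat e he k hlt with (h | h) | h
        · have h' : ¬ (e.a ≤ τ k ∧ τ (k + 1) ≤ e.b) := fun h' =>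
            absurd (h'.2.trans h) (not_le.2 hlt)
          have ha := e.a_le_b.trans h
          rw [if_neg h']
          simp only [ElemTerm.integral]
          rw [min_eq_left h, min_eq_left ha, min_eq_left (h.trans hk), min_eq_left (ha.trans hk)]
          simp
        · have h' : ¬ (e.a ≤ τ k ∧ τ (k + 1) ≤ e.b) := fun h' =>
            absurd (h.trans h'.1) (not_le.2 hlt)
          have hb := h.trans e.a_le_b
          rw [if_neg h']
          simp only [ElemTerm.integral]
          rw [min_eq_right h, min_eq_right hb, min_eq_right (hk.trans h),
            min_eq_right (hk.trans hb)]
          simp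
        · rw [if_pos h]
          simp only [ElemTerm.integral]
          rw [min_eq_right h.2, min_eq_left h.1, min_eq_right (hk.trans h.2),
            min_eq_left (h.1.trans hk)]
          by_cases hω : ω ∈ e.A
          · simp only [Set.indicator_of_mem hω]
            rw [← sub_smul]
            congr 1
            ring
          · simp [Set.indicator_of_notMem hω]
    funext ω
    rw [Finset.sum_apply, ← Finset.sum_congr rfl fun k _ => hstep k ω,
      Finset.sum_range_sub fun k => elemIntegral W (τ k) L ω, hN, h0]
    have : elemIntegral W 0 L ω = 0 := by
      rw [elemIntegral]
      refine List.sum_eq_zero fun y hy => ?_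
      obtain ⟨e, -, rfl⟩ := List.mem_map.1 hy
      simp [ElemTerm.integral]
    rw [this, sub_zero]
  · intro k s ω hs hs'
    rw [elemProcess, stepOp, ← Fin.sum_univ_fun_getElem]
    refine Finset.sum_congr rfl fun i _ => ?_
    have he : L[i] ∈ L := List.getElem_mem _
    change ElemTerm.eval L[i] s ω = _
    generalize hLe : L[i] = e at he
    simp only [A, hLe, ElemTerm.eval]
    have hlt := hs.trans_le hs'
    by_cases h : e.a ≤ τ k ∧ τ (k + 1) ≤ e.b
    · rw [if_pos h]
      have hmem : s ∈ Set.Ioc e.a e.b := ⟨h.1.trans_lt hs, hs'.trans h.2⟩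
      by_cases hω : ω ∈ e.A
      · rw [Set.indicator_of_mem (Set.mk_mem_prod hmem hω), Set.indicator_of_mem hω]
      · rw [Set.indicator_of_notMem (fun h => hω h.2), Set.indicator_of_notMem hω]
    · rw [if_neg h, Set.indicator_of_notMem, Set.indicator_empty]
      rintro ⟨hm, -⟩
      rcases hcompat e he k hlt with (h1 | h1) | h1
      · exact absurd (hs.trans_le (hm.2.trans h1)) (lt_irrefl _)
      · exact absurd (hm.1.trans_le (hs'.trans h1)) (lt_irrefl _)
      · exact h h1

end Grid

/-! ### Moment and tail estimates for elementary integrals -/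

section ElementaryBounds

variable {Ω : Type w} {mΩ : MeasurableSpace Ω} {P : Measure Ω} [IsProbabilityMeasure P] {T : ℝ≥0}
  {𝓕 : Filtration ℝ≥0 mΩ} {U : Type v} [NormedAddCommGroup U] [InnerProductSpace ℝ U]
  {V : Type u} [NormedAddCommGroup V] [NormedSpace ℝ V] [CompleteSpace V]
  [TopologicalSpace.SeparableSpace V] {W : ℝ≥0 → U → Ω → ℝ}

/-- The increments of an elementary integral over a grid, switched off by events `B k` known at the
left end points, are martingale differences to which the estimate in UMD spaces of type 2 applies. -/
lemma IsCylindricalWiener.exists_grid_bound (hUMD : IsUMD.{w, u} V) (hType : HasTypeTwo V)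
    (hW : IsCylindricalWiener P T 𝓕 W) {p : ℝ} (hp : 2 ≤ p) :
    ∃ C : ℝ≥0, ∀ (N m : ℕ) (τ : ℕ → ℝ≥0) (A : ℕ → Fin m → Set Ω) (h : Fin m → U) (x : Fin m → V)
      (B : ℕ → Set Ω), Monotone τ → (∀ k, τ k ≤ T) → (∀ k i, MeasurableSet[𝓕 (τ k)] (A k i)) →
      (∀ k, MeasurableSet[𝓕 (τ k)] (B k)) →
      eLpNorm (∑ k ∈ Finset.range N,
          (B k).indicator (stepInc W (τ k) (τ (k + 1)) Finset.univ (A k) h x)) (ENNReal.ofReal p) P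
        ≤ C * (∑ k ∈ Finset.range N, ((τ (k + 1) - τ k : ℝ≥0) : ℝ≥0∞) *
            (∫⁻ ω in B k, gammaNorm (stepOp Finset.univ (A k) h x ω) ^ p ∂P) ^ (2 / p))
              ^ (1 / 2 : ℝ) := by
  have hp0 : 0 < p := by linarith
  have := UniformSpace.secondCountable_of_separable V
  obtain ⟨C, hC⟩ := hUMD.exists_eLpNorm_sum_le hType hp
  obtain ⟨K, hK⟩ := exists_lintegral_linCombCLM_rpow_le (V := V) hp0
  refine ⟨C * (K ^ (2 / p)) ^ (1 / 2 : ℝ), fun N m τ A h x B hτ hτT hA hB => ?_⟩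
  let 𝓖 : Filtration ℕ mΩ :=
    { seq := fun k => 𝓕 (τ k), mono' := fun i j hij => 𝓕.mono (hτ hij), le' := fun k => 𝓕.le _ }
  set d : ℕ → Ω → V :=
    fun k => (B k).indicator (stepInc W (τ k) (τ (k + 1)) Finset.univ (A k) h x) with hd
  have hd' (k : ℕ) : d k
      = stepInc W (τ k) (τ (k + 1)) Finset.univ (fun i => B k ∩ A k i) h x :=
    indicator_stepInc _ _ _ _
  have hBA (k : ℕ) (i : Fin m) : MeasurableSet[𝓕 (τ k)] (B k ∩ A k i) := (hB k).inter (hA k i)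
  have h1 := hC Ω mΩ P inferInstance 𝓖 d
    (fun k => by
      rw [hd']
      exact hW.stronglyMeasurable_stepInc _ (hτ k.le_succ) (hτT _) (hBA k) h x)
    (fun k => by
      rw [hd']
      exact hW.memLp_stepInc _ (hτ k.le_succ) (hτT _) (hBA k) h x p.toNNReal)
    (fun k => by
      rw [hd']
      exact hW.condExp_stepInc _ (hτ k.le_succ) (hτT _) (hBA k) h x) N
  refine h1.trans ?_
  have hk (k : ℕ) : eLpNorm (d k) (ENNReal.ofReal p) P ^ 2
      ≤ ((K ^ (2 / p) : ℝ≥0) : ℝ≥0∞) * (((τ (k + 1) - τ k : ℝ≥0) : ℝ≥0∞) *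
        (∫⁻ ω in B k, gammaNorm (stepOp Finset.univ (A k) h x ω) ^ p ∂P) ^ (2 / p)) := by
    have h2 := hW.setLIntegral_stepInc_le hp0 hK (hτ k.le_succ) (hτT _) (hB k) Finset.univ
      (hA k) h x
    have h3 : ∫⁻ ω, ‖d k ω‖ₑ ^ p ∂P
        = ∫⁻ ω in B k, ‖stepInc W (τ k) (τ (k + 1)) Finset.univ (A k) h x ω‖ₑ ^ p ∂P := by
      rw [← lintegral_indicator (𝓕.le _ _ (hB k))]
      congr 1 with ω
      by_cases hω : ω ∈ B k <;> simp [hd, hω, hp0]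
    rw [eLpNorm_ofReal_eq hp0, h3, ← ENNReal.rpow_natCast, ← ENNReal.rpow_mul,
      show 1 / p * ((2 : ℕ) : ℝ) = 2 / p by push_cast; ring]
    refine (ENNReal.rpow_le_rpow h2 (by positivity)).trans_eq ?_
    rw [ENNReal.mul_rpow_of_nonneg _ _ (by positivity),
      ENNReal.mul_rpow_of_nonneg _ _ (by positivity), ← ENNReal.rpow_mul,
      show p / 2 * (2 / p) = 1 by field_simp, ENNReal.rpow_one, mul_assoc,
      ENNReal.coe_rpow_of_nonneg _ (by positivity)]
  rw [ENNReal.coe_mul, mul_assoc]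
  gcongr
  refine (ENNReal.rpow_le_rpow (Finset.sum_le_sum fun k _ => hk k) (by norm_num)).trans_eq ?_
  rw [← Finset.mul_sum, ENNReal.mul_rpow_of_nonneg _ _ (by norm_num),
    ENNReal.coe_rpow_of_nonneg (K ^ (2 / p)) (by norm_num : (0 : ℝ) ≤ 1 / 2)]

/-- The moment bound for elementary integrals: the bound on a time grid, without stopping. -/
lemma IsCylindricalWiener.exists_eLpNorm_elemIntegral_le (hUMD : IsUMD.{w, u} V)
    (hType : HasTypeTwo V) (hW : IsCylindricalWiener P T 𝓕 W) {p : ℝ} (hp : 2 ≤ p) :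
    ∃ C : ℝ≥0, ∀ (t : ℝ≥0) (L : List (ElemTerm U V 𝓕)), t ≤ T →
      eLpNorm (elemIntegral W t L) (ENNReal.ofReal p) P
        ≤ C * (∫⁻ s, (∫⁻ ω, gammaNorm (elemProcess L s ω) ^ p ∂P) ^ (2 / p) ∂lebUpTo t)
          ^ (1 / 2 : ℝ) := by
  obtain ⟨C, hC⟩ := hW.exists_grid_bound hUMD hType hp
  refine ⟨C, fun t L ht => ?_⟩
  obtain ⟨N, m, τ, A, h, x, hmono, h0, hN, hle, hA, hint, hop⟩ := exists_grid_representation L t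
  have h1 := hC N m τ A h x (fun _ => Set.univ) hmono (fun k => (hle k).trans ht) hA
    (fun k => MeasurableSet.univ)
  simp only [Set.indicator_univ, Measure.restrict_univ] at h1
  rw [hint W, lintegral_lebUpTo_eq_sum (N := N) (c := fun k =>
    (∫⁻ ω, gammaNorm (stepOp Finset.univ (A k) h x ω) ^ p ∂P) ^ (2 / p)) hmono h0 hN]
  · exact h1
  · intro k _ s hs hs'
    simp_rw [hop k s _ hs hs']

/-- A sum of nonnegative terms stopped just before it exceeds `δ` is at most `δ`. -/
lemma sum_stopped_le (q : ℕ → ℝ≥0∞) (δ : ℝ≥0∞) (N : ℕ) :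
    ∑ k ∈ Finset.range N, {k | ∑ j ∈ Finset.range (k + 1), q j ≤ δ}.indicator q k ≤ δ := by
  induction N with
  | zero => simp
  | succ N ih =>
    by_cases h : ∑ j ∈ Finset.range (N + 1), q j ≤ δ
    · exact (Finset.sum_le_sum fun k _ => Set.indicator_le_self _ q k).trans h
    · rw [Finset.sum_range_succ, Set.indicator_of_notMem (by exact h), add_zero]
      exact ih

/-- Lenglart's inequality for elementary integrals: the integral is small in probability when the
square function is. The integrand is stopped before the square function exceeds `δ`. -/
lemma IsCylindricalWiener.exists_measure_elemIntegral_ge_le (hUMD : IsUMD.{w, u} V)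
    (hType : HasTypeTwo V) (hW : IsCylindricalWiener P T 𝓕 W) :
    ∃ C : ℝ≥0, ∀ (t : ℝ≥0) (L : List (ElemTerm U V 𝓕)) (ε δ : ℝ≥0∞), t ≤ T → ε ≠ 0 → ε ≠ ⊤ →
      P {ω | ε ≤ ‖elemIntegral W t L ω‖ₑ}
        ≤ P {ω | δ < ∫⁻ s, gammaNorm (elemProcess L s ω) ^ 2 ∂lebUpTo t} + C * δ / ε ^ 2 := by
  obtain ⟨C, hC⟩ := hW.exists_grid_bound hUMD hType le_rfl
  refine ⟨C ^ 2, fun t L ε δ ht hε0 hεtop => ?_⟩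
  obtain ⟨N, m, τ, A, h, x, hmono, h0, hN, hle, hA, hint, hop⟩ := exists_grid_representation L t
  set q : ℕ → Ω → ℝ≥0∞ := fun k ω => ((τ (k + 1) - τ k : ℝ≥0) : ℝ≥0∞) *
    gammaNorm (stepOp Finset.univ (A k) h x ω) ^ 2 with hq
  set B : ℕ → Set Ω := fun k => {ω | ∑ j ∈ Finset.range (k + 1), q j ω ≤ δ} with hB
  have hqm (k : ℕ) : Measurable[𝓕 (τ k)] (q k) :=
    ((measurable_gammaNorm_stepOp _ (hA k) h x).pow_const 2).const_mul _
  have hBm (k : ℕ) : MeasurableSet[𝓕 (τ k)] (B k) := by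
    have hs : Measurable[𝓕 (τ k)] fun ω => ∑ j ∈ Finset.range (k + 1), q j ω := by
      refine Finset.measurable_fun_sum _ fun j hj => ?_
      exact (hqm j).mono (𝓕.mono (hmono (Nat.lt_succ_iff.1 (Finset.mem_range.1 hj)))) le_rfl
    exact hs measurableSet_Iic
  set I : Ω → V := ∑ k ∈ Finset.range N,
    (B k).indicator (stepInc W (τ k) (τ (k + 1)) Finset.univ (A k) h x) with hI
  have hsq (ω : Ω) : ∫⁻ s, gammaNorm (elemProcess L s ω) ^ 2 ∂lebUpTo t
      = ∑ k ∈ Finset.range N, q k ω :=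
    lintegral_lebUpTo_eq_sum hmono h0 hN fun k _ s hs hs' => by rw [hop k s ω hs hs']
  have hIm : AEStronglyMeasurable I P := by
    refine Finset.aestronglyMeasurable_sum _ fun k _ => ?_
    exact (((hW.stronglyMeasurable_stepInc _ (hmono k.le_succ) ((hle _).trans ht)
      (hA k) h x).mono (𝓕.le _)).indicator (𝓕.le _ _ (hBm k))).aestronglyMeasurable
  -- the stopped integral agrees with the integral where the square function is at most `δ`
  have hsub : {ω | ε ≤ ‖elemIntegral W t L ω‖ₑ}
      ⊆ {ω | δ < ∫⁻ s, gammaNorm (elemProcess L s ω) ^ 2 ∂lebUpTo t} ∪ {ω | ε ≤ ‖I ω‖ₑ} := by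
    intro ω hω
    by_cases hδ : δ < ∫⁻ s, gammaNorm (elemProcess L s ω) ^ 2 ∂lebUpTo t
    · exact Or.inl hδ
    · right
      rw [hsq, not_lt] at hδ
      have : I ω = elemIntegral W t L ω := by
        rw [hint W, hI, Finset.sum_apply, Finset.sum_apply]
        refine Finset.sum_congr rfl fun k hk => Set.indicator_of_mem ?_ _
        refine le_trans (Finset.sum_le_sum_of_subset ?_) hδ
        exact Finset.range_subset_range.2 (Finset.mem_range.1 hk)
      simpa only [Set.mem_ofPred_eq, this] using hω
  refine (measure_mono hsub).trans ((measure_union_le _ _).trans (add_le_add le_rfl ?_))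
  have h2 : eLpNorm I 2 P ^ 2 ≤ C ^ 2 * δ := by
    have h3 := hC N m τ A h x B hmono (fun k => (hle k).trans ht) hA hBm
    rw [← hI, show ENNReal.ofReal 2 = 2 by simp, show (2 : ℝ) / 2 = 1 by norm_num] at h3
    simp_rw [ENNReal.rpow_one] at h3
    refine (pow_le_pow_left' h3 2).trans ?_
    rw [mul_pow, ← ENNReal.rpow_natCast (_ ^ (1 / 2 : ℝ)), ← ENNReal.rpow_mul]
    norm_num
    gcongr
    calc ∑ k ∈ Finset.range N, ((τ (k + 1) - τ k : ℝ≥0) : ℝ≥0∞) *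
          ∫⁻ ω in B k, gammaNorm (stepOp Finset.univ (A k) h x ω) ^ 2 ∂P
        = ∑ k ∈ Finset.range N, ∫⁻ ω, (B k).indicator (q k) ω ∂P := by
          refine Finset.sum_congr rfl fun k _ => ?_
          rw [lintegral_indicator (𝓕.le _ _ (hBm k)), lintegral_const_mul' _ _ ENNReal.coe_ne_top]
      _ = ∫⁻ ω, ∑ k ∈ Finset.range N, (B k).indicator (q k) ω ∂P := by
          rw [lintegral_finsetSum]
          exact fun k _ => ((hqm k).mono (𝓕.le _) le_rfl).indicator (𝓕.le _ _ (hBm k))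
      _ ≤ ∫⁻ _ω, δ ∂P := by
          refine lintegral_mono fun ω => ?_
          exact sum_stopped_le (fun k => q k ω) δ N
      _ = δ := by simp
  rw [ENNReal.le_div_iff_mul_le (Or.inl (by simpa using hε0)) (Or.inl (by finiteness)), mul_comm]
  have h4 := mul_meas_ge_le_pow_eLpNorm P (p := 2) (by simp) (by simp) hIm (ε ^ 2)
  refine le_trans ?_ (h4.trans ?_)
  · refine mul_le_mul_right (measure_mono fun ω (h5 : ε ≤ ‖I ω‖ₑ) => ?_) _
    simpa using pow_le_pow_left' h5 2
  · simpa using h2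

end ElementaryBounds

/-! ### Finite rank operators in `γ(U, V)` -/

section RankOne

variable {U : Type*} [NormedAddCommGroup U] [InnerProductSpace ℝ U]
variable {V : Type*} [NormedAddCommGroup V] [NormedSpace ℝ V]

lemma GammaRad.enorm_eq (R : GammaRad U V) : ‖R‖ₑ = gammaNorm R.toCLM := by
  rw [← ofReal_norm]
  exact ENNReal.ofReal_toReal R.2.1.ne

lemma lintegral_inner_sq_stdGaussian {n : ℕ} (c : EuclideanSpace ℝ (Fin n)) :
    ∫⁻ g, ‖inner ℝ c g‖ₑ ^ 2 ∂stdGaussian (EuclideanSpace ℝ (Fin n)) = ‖c‖ₑ ^ 2 := by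
  have h1 := variance_dual_stdGaussian (E := EuclideanSpace ℝ (Fin n)) (innerSL ℝ c)
  rw [variance_of_integral_eq_zero (by fun_prop) (integral_strongDual_stdGaussian _),
    innerSL_apply_norm] at h1
  have h2 : ∫⁻ g, ‖inner ℝ c g‖ₑ ^ 2 ∂stdGaussian (EuclideanSpace ℝ (Fin n))
      = ENNReal.ofReal (∫ g, (innerSL ℝ c g) ^ 2 ∂stdGaussian (EuclideanSpace ℝ (Fin n))) := by
    rw [ofReal_integral_eq_lintegral_ofReal _ (ae_of_all _ fun g => sq_nonneg _)]
    · congr 1 with g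
      rw [innerSL_apply_apply, ← ofReal_norm, ← ENNReal.ofReal_pow (norm_nonneg _),
        Real.norm_eq_abs, sq_abs]
    · have h3 : MemLp (fun g => innerSL ℝ c g) 2 (stdGaussian (EuclideanSpace ℝ (Fin n))) :=
        (innerSL ℝ c).comp_memLp' IsGaussian.memLp_two_id
      exact h3.integrable_sq
  rw [h2, h1, ENNReal.ofReal_pow (norm_nonneg _), ofReal_norm]

lemma gammaNorm_rankOne_le (h : U) (x : V) :
    gammaNorm ((innerSL ℝ h).smulRight x) ≤ ‖h‖ₑ * ‖x‖ₑ := by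
  refine iSup_le fun n => iSup_le fun e => iSup_le fun he => ?_
  set c : EuclideanSpace ℝ (Fin n) := WithLp.toLp 2 fun i => inner ℝ h (e i) with hc
  have hcn : ‖c‖ₑ ≤ ‖h‖ₑ := by
    rw [enorm_le_iff_norm_le, ← abs_of_nonneg (norm_nonneg c), ← abs_of_nonneg (norm_nonneg h),
      ← sq_le_sq, EuclideanSpace.real_norm_sq_eq]
    have h1 := he.sum_inner_products_le (x := h) (s := Finset.univ)
    refine le_trans (le_of_eq (Finset.sum_congr rfl fun i _ => ?_)) h1
    rw [hc, Real.norm_eq_abs, sq_abs, real_inner_comm]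
  have h1 : eLpNorm (fun g : Fin n → ℝ => ∑ i, g i • (innerSL ℝ h).smulRight x (e i)) 2
      (Measure.pi fun _ => gaussianReal 0 1) ^ (2 : ℝ) = (‖c‖ₑ * ‖x‖ₑ) ^ (2 : ℝ) := by
    have hh := eLpNorm_ofReal_rpow (μ := Measure.pi fun _ : Fin n => gaussianReal 0 1)
      (show (0 : ℝ) < 2 by norm_num) (fun g : Fin n → ℝ =>
        ∑ i, g i • (innerSL ℝ h).smulRight x (e i))
    rw [show ENNReal.ofReal 2 = 2 by simp] at hh
    rw [hh]
    have hpt (g : Fin n → ℝ) : ‖∑ i, g i • (innerSL ℝ h).smulRight x (e i)‖ₑ ^ (2 : ℝ)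
        = ‖inner ℝ c (WithLp.toLp 2 g)‖ₑ ^ 2 * ‖x‖ₑ ^ 2 := by
      have : ∑ i, g i • (innerSL ℝ h).smulRight x (e i) = inner ℝ c (WithLp.toLp 2 g) • x := by
        simp [hc, PiLp.inner_apply, Finset.sum_smul, smul_smul]
      rw [this, enorm_smul, ENNReal.rpow_two, mul_pow]
    simp_rw [hpt]
    rw [lintegral_mul_const' _ _ (by finiteness), ENNReal.rpow_two, mul_pow,
      ← lintegral_inner_sq_stdGaussian c, ← map_pi_eq_stdGaussian, lintegral_map]
    · exact (innerSL ℝ c).continuous.enorm.measurable.pow_const 2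
    · fun_prop
  have h2 := (ENNReal.rpow_left_injective (show (2 : ℝ) ≠ 0 by norm_num)) h1
  rw [h2]
  gcongr

/-- The rank one operator `⟨h, ·⟩ x` as an element of `γ(U, V)`. -/
noncomputable def GammaRad.rankOne (h : U) (x : V) : GammaRad U V :=
  (⟨(innerSL ℝ h).smulRight x, (gammaNorm_rankOne_le h x).trans_lt (by finiteness), fun ε hε =>
    ⟨(innerSL ℝ h).smulRight x, by
      refine Submodule.finiteDimensional_of_le (S₂ := Submodule.span ℝ {x}) ?_
      rintro _ ⟨u, rfl⟩
      exact Submodule.smul_mem _ _ (Submodule.mem_span_singleton_self x),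
      by simpa [gammaNorm_zero] using hε⟩⟩ : gammaSubmodule U V)

lemma GammaRad.toCLM_rankOne (h : U) (x : V) :
    (GammaRad.rankOne h x).toCLM = (innerSL ℝ h).smulRight x := rfl

lemma GammaRad.toCLM_add (R S : GammaRad U V) : (R + S).toCLM = R.toCLM + S.toCLM := rfl

lemma GammaRad.toCLM_sub (R S : GammaRad U V) : (R - S).toCLM = R.toCLM - S.toCLM := rfl

lemma GammaRad.toCLM_zero : (0 : GammaRad U V).toCLM = 0 := rfl

lemma GammaRad.toCLM_injective {R S : GammaRad U V} (h : R.toCLM = S.toCLM) : R = S :=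
  Subtype.ext h

lemma GammaRad.toCLM_list_sum (l : List (GammaRad U V)) :
    l.sum.toCLM = (l.map GammaRad.toCLM).sum := by
  induction l with
  | nil => rfl
  | cons a l ih => rw [List.sum_cons, GammaRad.toCLM_add, ih, List.map_cons, List.sum_cons]

/-- Sums of rank one operators are dense in `γ(U, V)`: a bounded finite rank operator is such a sum
by the Riesz representation theorem. -/
lemma GammaRad.exists_rankOne_sum_near [CompleteSpace U] (R : GammaRad U V) {ε : ℝ≥0∞}
    (hε : 0 < ε) : ∃ l : List (U × V), ‖(l.map fun q => GammaRad.rankOne q.1 q.2).sum - R‖ₑ < ε := by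
  obtain ⟨S, hS, hSε⟩ := R.2.2 ε hε
  let F := LinearMap.range (S : U →ₗ[ℝ] V)
  let b := Module.finBasis ℝ F
  have hF (u : U) : S u ∈ F := LinearMap.mem_range_self (S : U →ₗ[ℝ] V) u
  let φ (i) : U →L[ℝ] ℝ := (LinearMap.toContinuousLinearMap (b.coord i)).comp
    (S.codRestrict F hF)
  let l : List (U × V) := List.ofFn fun i => ((InnerProductSpace.toDual ℝ U).symm (φ i), (b i : V))
  have hl : (l.map fun q => GammaRad.rankOne q.1 q.2).sum.toCLM = S := by
    rw [GammaRad.toCLM_list_sum, List.map_map, List.map_ofFn, List.sum_ofFn]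
    ext u
    have h1 := congrArg Subtype.val (b.sum_repr (S.codRestrict F hF u))
    simp only [Submodule.coe_sum, Submodule.coe_smul] at h1
    refine Eq.trans ?_ h1
    rw [sum_apply]
    refine Finset.sum_congr rfl fun i _ => ?_
    simp only [Function.comp_apply, GammaRad.toCLM_rankOne, ContinuousLinearMap.smulRight_apply,
      innerSL_apply_apply, InnerProductSpace.toDual_symm_apply]
    rfl
  refine ⟨l, ?_⟩
  rw [enorm_sub_rev, GammaRad.enorm_eq, GammaRad.toCLM_sub, hl]
  exact hSε

end RankOne

/-! ### Elementary processes with values in `γ(U, V)` -/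

section ElemGamma

variable {Ω : Type*} {mΩ : MeasurableSpace Ω} {𝓕 : Filtration ℝ≥0 mΩ}
  {U : Type*} [NormedAddCommGroup U] [InnerProductSpace ℝ U]
  {V : Type*} [NormedAddCommGroup V] [NormedSpace ℝ V]

/-- The elementary process of a list of elementary terms, as a function on `[0, ∞) × Ω` with values
in `γ(U, V)`. -/
noncomputable def elemGamma (L : List (ElemTerm U V 𝓕)) (z : ℝ≥0 × Ω) : GammaRad U V :=
  (L.map fun e => (Set.Ioc e.a e.b ×ˢ e.A).indicator (fun _ => GammaRad.rankOne e.h e.x) z).sum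

lemma toCLM_elemGamma (L : List (ElemTerm U V 𝓕)) (s : ℝ≥0) (ω : Ω) :
    (elemGamma L (s, ω)).toCLM = elemProcess L s ω := by
  rw [elemGamma, GammaRad.toCLM_list_sum, List.map_map, elemProcess]
  congr 1
  refine List.map_congr_left fun e _ => ?_
  rw [Function.comp_apply, ElemTerm.eval]
  by_cases h : (s, ω) ∈ Set.Ioc e.a e.b ×ˢ e.A
  · rw [Set.indicator_of_mem h, Set.indicator_of_mem h, GammaRad.toCLM_rankOne]
  · rw [Set.indicator_of_notMem h, Set.indicator_of_notMem h, GammaRad.toCLM_zero]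

lemma gammaNorm_elemProcess (L : List (ElemTerm U V 𝓕)) (s : ℝ≥0) (ω : Ω) :
    gammaNorm (elemProcess L s ω) = ‖elemGamma L (s, ω)‖ₑ := by
  rw [GammaRad.enorm_eq, toCLM_elemGamma]

lemma gammaNorm_sub_elemProcess (R : GammaRad U V) (L : List (ElemTerm U V 𝓕)) (s : ℝ≥0) (ω : Ω) :
    gammaNorm (R.toCLM - elemProcess L s ω) = ‖R - elemGamma L (s, ω)‖ₑ := by
  rw [GammaRad.enorm_eq, GammaRad.toCLM_sub, toCLM_elemGamma]

lemma stronglyMeasurable_elemGamma (L : List (ElemTerm U V 𝓕)) :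
    StronglyMeasurable[𝓕.predictable] (elemGamma L) := by
  induction L with
  | nil => exact stronglyMeasurable_const
  | cons e L ih =>
    have : elemGamma (e :: L) = fun z => (Set.Ioc e.a e.b ×ˢ e.A).indicator
        (fun _ => GammaRad.rankOne e.h e.x) z + elemGamma L z := by
      funext z
      rw [elemGamma, List.map_cons, List.sum_cons]; rfl
    rw [this]
    exact (StronglyMeasurable.indicator stronglyMeasurable_const
      (measurableSet_predictable_Ioc_prod e.a e.b e.measurable_A)).add ih

lemma elemGamma_append (L L' : List (ElemTerm U V 𝓕)) :
    elemGamma (L ++ L') = elemGamma L + elemGamma L' := by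
  funext z
  simp [elemGamma]

lemma elemIntegral_append (W : ℝ≥0 → U → Ω → ℝ) (t : ℝ≥0) (L L' : List (ElemTerm U V 𝓕)) :
    elemIntegral W t (L ++ L') = elemIntegral W t L + elemIntegral W t L' := by
  funext ω
  simp [elemIntegral]

/-- The elementary term with the opposite sign. -/
def ElemTerm.neg (e : ElemTerm U V 𝓕) : ElemTerm U V 𝓕 := { e with x := -e.x }

lemma elemGamma_map_neg (L : List (ElemTerm U V 𝓕)) :
    elemGamma (L.map ElemTerm.neg) = -elemGamma L := by
  funext z
  rw [Pi.neg_apply, elemGamma, elemGamma, List.map_map, List.sum_neg, List.map_map]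
  congr 1
  refine List.map_congr_left fun e _ => ?_
  have h : GammaRad.rankOne e.h (-e.x) = -GammaRad.rankOne e.h e.x := by
    refine GammaRad.toCLM_injective ?_
    ext u
    exact smul_neg _ _
  simp only [Function.comp_apply, ElemTerm.neg, h]
  by_cases hz : z ∈ Set.Ioc e.a e.b ×ˢ e.A <;> simp [hz]

lemma elemIntegral_map_neg (W : ℝ≥0 → U → Ω → ℝ) (t : ℝ≥0) (L : List (ElemTerm U V 𝓕)) :
    elemIntegral W t (L.map ElemTerm.neg) = -elemIntegral W t L := by
  funext ω
  rw [Pi.neg_apply, elemIntegral, elemIntegral, List.map_map, List.sum_neg, List.map_map]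
  congr 1
  refine List.map_congr_left fun e _ => ?_
  simp only [Function.comp_apply, ElemTerm.neg, ElemTerm.integral, smul_neg]
  by_cases hz : ω ∈ e.A <;> simp [hz]

end ElemGamma

/-! ### Density of elementary processes -/

/-- Density in `L^q` of an additive group of functions, from the approximability of the indicators of
a generating π-system. -/
lemma exists_mem_addSubgroup_eLpNorm_sub_le {α G : Type*} {m : MeasurableSpace α}
    [NormedAddCommGroup G] {ν : Measure α} [IsFiniteMeasure ν] {q : ℝ≥0∞} (hq1 : 1 ≤ q)
    (hq : q ≠ ⊤) (E : AddSubgroup (α → G)) (hE : ∀ f ∈ E, AEStronglyMeasurable f ν)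
    {𝒞 : Set (Set α)} (h𝒞 : m = MeasurableSpace.generateFrom 𝒞) (hpi : IsPiSystem 𝒞)
    (happ : ∀ s, s ∈ 𝒞 ∨ s = Set.univ → ∀ (c : G) (ε : ℝ≥0∞), ε ≠ 0 →
      ∃ g ∈ E, eLpNorm (g - s.indicator fun _ => c) q ν ≤ ε)
    {f : α → G} (hf : MemLp f q ν) {ε : ℝ≥0∞} (hε : ε ≠ 0) :
    ∃ g ∈ E, eLpNorm (f - g) q ν ≤ ε := by
  suffices h : ∀ (c : G) ⦃s : Set α⦄, MeasurableSet s → ν s < ⊤ → ∀ {ε : ℝ≥0∞}, ε ≠ 0 →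
      ∃ g, eLpNorm (g - s.indicator fun _ => c) q ν ≤ ε ∧ g ∈ E by
    obtain ⟨g, h1, h2⟩ := MemLp.induction_dense hq (· ∈ E) h (fun f g => E.add_mem) hE hf hε
    exact ⟨g, h2, h1⟩
  intro c s hs hfin ε hε
  clear hfin
  suffices h : ∃ g ∈ E, eLpNorm (g - s.indicator fun _ => c) q ν ≤ ε by
    obtain ⟨g, h1, h2⟩ := h
    exact ⟨g, h2, h1⟩
  have hind (s : Set α) (hs : MeasurableSet s) :
      AEStronglyMeasurable (s.indicator fun _ => c) ν :=
    aestronglyMeasurable_const.indicator hs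
  have hhalf (ε : ℝ≥0∞) (hε : ε ≠ 0) : ε / 2 ≠ 0 := (ENNReal.half_pos hε).ne'
  revert ε
  induction s, hs using MeasurableSpace.induction_on_inter h𝒞 hpi with
  | empty => exact fun {ε} _ => ⟨0, E.zero_mem, by simp⟩
  | basic s hs => exact fun {ε} hε => happ s (Or.inl hs) c ε hε
  | compl s hs ih =>
    intro ε hε
    obtain ⟨g₁, h₁, h₁'⟩ := happ _ (Or.inr rfl) c _ (hhalf ε hε)
    obtain ⟨g₂, h₂, h₂'⟩ := ih (hhalf ε hε)
    refine ⟨g₁ - g₂, E.sub_mem h₁ h₂, ?_⟩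
    have e : g₁ - g₂ - sᶜ.indicator (fun _ => c)
        = (g₁ - Set.univ.indicator fun _ => c) - (g₂ - s.indicator fun _ => c) := by
      funext a
      by_cases ha : a ∈ s <;> simp [ha]
      abel
    rw [e]
    refine (eLpNorm_sub_le ((hE _ h₁).sub (hind _ MeasurableSet.univ))
      ((hE _ h₂).sub (hind _ hs)) hq1).trans ?_
    exact (add_le_add h₁' h₂').trans_eq (ENNReal.add_halves ε)
  | iUnion F hd hF ih =>
    have hfin (n : ℕ) (ε : ℝ≥0∞) (hε : ε ≠ 0) : ∃ g ∈ E,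
        eLpNorm (g - (⋃ i < n, F i).indicator fun _ => c) q ν ≤ ε := by
      induction n generalizing ε with
      | zero => exact ⟨0, E.zero_mem, by simp⟩
      | succ n ihn =>
        obtain ⟨g₁, h₁, h₁'⟩ := ihn _ (hhalf ε hε)
        obtain ⟨g₂, h₂, h₂'⟩ := ih n (hhalf ε hε)
        refine ⟨g₁ + g₂, E.add_mem h₁ h₂, ?_⟩
        have hdisj : Disjoint (⋃ i < n, F i) (F n) := by
          rw [Set.disjoint_iUnion₂_left]
          exact fun i hi => hd hi.ne
        have e : g₁ + g₂ - (⋃ i < n + 1, F i).indicator (fun _ => c)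
            = (g₁ - (⋃ i < n, F i).indicator fun _ => c) + (g₂ - (F n).indicator fun _ => c) := by
          rw [Set.biUnion_lt_succ, Set.indicator_union_of_disjoint hdisj]
          funext a
          simp only [Pi.add_apply, Pi.sub_apply]
          abel
        rw [e]
        refine (eLpNorm_add_le ((hE _ h₁).sub (hind _ ?_))
          ((hE _ h₂).sub (hind _ (hF n))) hq1).trans ?_
        · exact MeasurableSet.biUnion (Set.to_countable _) fun i _ => hF i
        · exact (add_le_add h₁' h₂').trans_eq (ENNReal.add_halves ε)
    intro ε hε
    have hUm (n : ℕ) : MeasurableSet (⋃ i < n, F i) :=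
      MeasurableSet.biUnion (Set.to_countable _) fun i _ => hF i
    -- the part of the union beyond the first `n` sets is small in `L^q`
    have htail : Tendsto (fun n => ν ((⋃ i, F i) \ ⋃ i < n, F i)) atTop (𝓝 0) := by
      have h1 := tendsto_measure_iInter_atTop (μ := ν) (s := fun n => (⋃ i, F i) \ ⋃ i < n, F i)
        (fun n => ((MeasurableSet.iUnion hF).diff (hUm n)).nullMeasurableSet)
        (fun a b hab => Set.sdiff_subset_sdiff_right
          (Set.biUnion_subset_biUnion_left fun i (hi : i < a) => hi.trans_le hab))
        ⟨0, measure_ne_top _ _⟩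
      have h2 : ⋂ n, ((⋃ i, F i) \ ⋃ i < n, F i) = ∅ := by
        refine Set.eq_empty_of_forall_notMem fun a ha => ?_
        rw [Set.mem_iInter] at ha
        obtain ⟨i, hi⟩ := Set.mem_iUnion.1 (ha 0).1
        exact (ha (i + 1)).2 (Set.mem_biUnion (Nat.lt_succ_self i) hi)
      rwa [h2, measure_empty] at h1
    have htail' : Tendsto (fun n => ‖c‖ₑ * ν ((⋃ i, F i) \ ⋃ i < n, F i) ^ (1 / q.toReal)) atTop
        (𝓝 0) := by
      have hq0 : 0 < 1 / q.toReal :=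
        one_div_pos.2 (ENNReal.toReal_pos (zero_lt_one.trans_le hq1).ne' hq)
      have h1 := (ENNReal.continuous_rpow_const (y := 1 / q.toReal)).tendsto 0 |>.comp htail
      rw [ENNReal.zero_rpow_of_pos hq0] at h1
      simpa using ENNReal.Tendsto.const_mul h1 (Or.inr (by finiteness : ‖c‖ₑ ≠ ⊤))
    obtain ⟨n, hn⟩ := ((tendsto_order.1 htail').2 _ (ENNReal.half_pos hε)).exists
    obtain ⟨g, hg, hg'⟩ := hfin n _ (hhalf ε hε)
    refine ⟨g, hg, ?_⟩
    have e : g - (⋃ i, F i).indicator (fun _ => c) = (g - (⋃ i < n, F i).indicator fun _ => c)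
        - ((⋃ i, F i) \ ⋃ i < n, F i).indicator fun _ => c := by
      have hsub : (⋃ i < n, F i) ⊆ ⋃ i, F i := Set.iUnion₂_subset_iUnion _ _
      rw [Set.indicator_sdiff hsub]
      abel
    have hm := (MeasurableSet.iUnion hF).diff (hUm n)
    rw [e]
    refine (eLpNorm_sub_le ((hE _ hg).sub (hind _ (hUm n))) (hind _ hm) hq1).trans ?_
    refine (add_le_add hg' ?_).trans_eq (ENNReal.add_halves ε)
    exact (eLpNorm_indicator_const_le c q).trans hn.le

section Density

variable {Ω : Type*} {mΩ : MeasurableSpace Ω} {𝓕 : Filtration ℝ≥0 mΩ} {P : Measure Ω}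
  {U : Type*} [NormedAddCommGroup U] [InnerProductSpace ℝ U]
  {V : Type*} [NormedAddCommGroup V] [NormedSpace ℝ V]

lemma predictable_le_prod (𝓕 : Filtration ℝ≥0 mΩ) :
    𝓕.predictable ≤ (inferInstance : MeasurableSpace (ℝ≥0 × Ω)) :=
  measurableSpace_le_predictable_of_measurableSet
    (fun _ hA => (measurableSet_singleton _).prod (𝓕.le _ _ hA))
    (fun _ _ hA => measurableSet_Ioi.prod (𝓕.le _ _ hA))

lemma isPiSystem_predictable (𝓕 : Filtration ℝ≥0 mΩ) :
    IsPiSystem ({s : Set (ℝ≥0 × Ω) | ∃ A, MeasurableSet[𝓕 ⊥] A ∧ s = {⊥} ×ˢ A} ∪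
      {s | ∃ i A, MeasurableSet[𝓕 i] A ∧ s = Set.Ioi i ×ˢ A}) := by
  rintro s (⟨A, hA, rfl⟩ | ⟨i, A, hA, rfl⟩) s' (⟨B, hB, rfl⟩ | ⟨j, B, hB, rfl⟩) hne
  · exact Or.inl ⟨A ∩ B, hA.inter hB, by rw [Set.prod_inter_prod, Set.inter_self]⟩
  · obtain ⟨z, ⟨h1, -⟩, h2, -⟩ := hne
    rw [Set.mem_singleton_iff.1 h1] at h2
    exact absurd (Set.mem_Ioi.1 h2) not_lt_bot
  · obtain ⟨z, ⟨h2, -⟩, h1, -⟩ := hne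
    rw [Set.mem_singleton_iff.1 h1] at h2
    exact absurd (Set.mem_Ioi.1 h2) not_lt_bot
  · refine Or.inr ⟨max i j, A ∩ B, ?_, by rw [Set.prod_inter_prod, Set.Ioi_inter_Ioi]⟩
    exact (𝓕.mono (le_max_left i j) _ hA).inter (𝓕.mono (le_max_right i j) _ hB)

lemma elemGamma_map_rankOne (l : List (U × V)) {i j : ℝ≥0} (hij : i ≤ j) {A : Set Ω}
    (hA : MeasurableSet[𝓕 i] A) (z : ℝ≥0 × Ω) :
    elemGamma (l.map fun q => (⟨i, j, hij, A, hA, q.1, q.2⟩ : ElemTerm U V 𝓕)) z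
      = (Set.Ioc i j ×ˢ A).indicator
        (fun _ => (l.map fun q => GammaRad.rankOne q.1 q.2).sum) z := by
  rw [elemGamma, List.map_map]
  by_cases hz : z ∈ Set.Ioc i j ×ˢ A
  · rw [Set.indicator_of_mem hz]
    congr 1
    refine List.map_congr_left fun q _ => ?_
    simp only [Function.comp_apply, Set.indicator_of_mem hz]
  · rw [Set.indicator_of_notMem hz]
    refine List.sum_eq_zero fun y hy => ?_
    obtain ⟨q, -, rfl⟩ := List.mem_map.1 hy
    simp only [Function.comp_apply, Set.indicator_of_notMem hz]

variable (U V) in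
/-- The elementary processes, as an additive group of functions on `[0, ∞) × Ω`. -/
noncomputable def elemGammaSubgroup (𝓕 : Filtration ℝ≥0 mΩ) :
    AddSubgroup (ℝ≥0 × Ω → GammaRad U V) where
  carrier := {f | ∃ L : List (ElemTerm U V 𝓕), f = elemGamma L}
  zero_mem' := ⟨[], rfl⟩
  add_mem' := by
    rintro _ _ ⟨L, rfl⟩ ⟨L', rfl⟩
    exact ⟨L ++ L', (elemGamma_append L L').symm⟩
  neg_mem' := by
    rintro _ ⟨L, rfl⟩
    exact ⟨L.map ElemTerm.neg, (elemGamma_map_neg L).symm⟩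

/-- Elementary processes are dense in the predictable `L^q`-processes with values in `γ(U, V)`. -/
lemma exists_elemGamma_eLpNorm_sub_le [CompleteSpace U] [IsProbabilityMeasure P] {q : ℝ≥0∞}
    (hq1 : 1 ≤ q) (hq : q ≠ ⊤) (t : ℝ≥0) {f : ℝ≥0 × Ω → GammaRad U V}
    (hf : StronglyMeasurable[𝓕.predictable] f)
    (hfq : eLpNorm f q ((lebUpTo t).prod P) < ⊤) {ε : ℝ≥0∞} (hε : ε ≠ 0) :
    ∃ L : List (ElemTerm U V 𝓕), eLpNorm (f - elemGamma L) q ((lebUpTo t).prod P) ≤ ε := by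
  set ν := (lebUpTo t).prod P with hν
  have hle := predictable_le_prod 𝓕
  have htime : ∀ᵐ z ∂ν, z.1 ∈ Set.Ioc 0 t :=
    Measure.quasiMeasurePreserving_fst.ae (ae_lebUpTo fun s h1 h2 => ⟨h1, h2.le⟩)
  -- approximation of `1_s c` for a set `s` that is a.e. a predictable rectangle
  have happ (s : Set (ℝ≥0 × Ω)) (hs : MeasurableSet[𝓕.predictable] s) (i j : ℝ≥0) (hij : i ≤ j)
      (A : Set Ω) (hA : MeasurableSet[𝓕 i] A) (hsA : ∀ᵐ z ∂ν, z ∈ s ↔ z ∈ Set.Ioc i j ×ˢ A)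
      (c : GammaRad U V) (ε : ℝ≥0∞) (hε : ε ≠ 0) : ∃ g ∈ elemGammaSubgroup U V 𝓕,
        eLpNorm (g - s.indicator fun _ => c) q (ν.trim hle) ≤ ε := by
    set M := ν Set.univ ^ (q.toReal)⁻¹ with hM
    have hMtop : M ≠ ⊤ := by finiteness
    have hδ : 0 < ε / (M + 1) := ENNReal.div_pos hε (by finiteness)
    obtain ⟨l, hl⟩ := c.exists_rankOne_sum_near hδ
    refine ⟨_, ⟨l.map fun q => (⟨i, j, hij, A, hA, q.1, q.2⟩ : ElemTerm U V 𝓕), rfl⟩, ?_⟩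
    rw [eLpNorm_trim hle ((stronglyMeasurable_elemGamma _).sub
      (StronglyMeasurable.indicator stronglyMeasurable_const hs))]
    set σ := (l.map fun q => GammaRad.rankOne q.1 q.2).sum with hσ
    have hbound : ∀ᵐ z ∂ν, ‖(elemGamma (l.map fun q =>
        (⟨i, j, hij, A, hA, q.1, q.2⟩ : ElemTerm U V 𝓕)) - s.indicator fun _ => c) z‖
          ≤ ‖σ - c‖ := by
      filter_upwards [hsA] with z hz
      rw [Pi.sub_apply, elemGamma_map_rankOne]
      by_cases h : z ∈ Set.Ioc i j ×ˢ A
      · rw [Set.indicator_of_mem h, Set.indicator_of_mem (hz.2 h)]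
      · rw [Set.indicator_of_notMem h, Set.indicator_of_notMem (fun h' => h (hz.1 h'))]
        simp
    refine (eLpNorm_le_of_ae_bound hbound).trans ?_
    rw [ofReal_norm, ← hM]
    calc M * ‖σ - c‖ₑ ≤ (M + 1) * (ε / (M + 1)) := by
          gcongr
          · exact le_self_add
      _ ≤ ε := ENNReal.mul_div_le
  have hempty (s : Set (ℝ≥0 × Ω)) (hs : MeasurableSet[𝓕.predictable] s)
      (h0 : ∀ᵐ z ∂ν, z ∉ s) (c : GammaRad U V) (ε : ℝ≥0∞) (hε : ε ≠ 0) :=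
    happ s hs 0 0 le_rfl ∅ (@MeasurableSet.empty _ (𝓕 0))
      (h0.mono fun z hz => by simpa using hz) c ε hε
  have hfm : MemLp f q (ν.trim hle) := ⟨hf.aestronglyMeasurable, by rwa [eLpNorm_trim hle hf]⟩
  obtain ⟨g, ⟨L, rfl⟩, hg⟩ := exists_mem_addSubgroup_eLpNorm_sub_le (m := 𝓕.predictable)
    (ν := ν.trim hle) hq1 hq (elemGammaSubgroup U V 𝓕)
    (by rintro _ ⟨L, rfl⟩; exact (stronglyMeasurable_elemGamma L).aestronglyMeasurable)
    rfl (isPiSystem_predictable 𝓕) (by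
      rintro s ((⟨A, hA, rfl⟩ | ⟨i, A, hA, rfl⟩) | rfl) c ε hε
      · refine hempty _ (measurableSet_predictable_singleton_bot_prod hA) ?_ c ε hε
        filter_upwards [htime] with z hz h
        exact hz.1.ne' h.1
      · by_cases hit : i ≤ t
        · refine happ _ (measurableSet_predictable_Ioi_prod hA) i t hit A hA ?_ c ε hε
          filter_upwards [htime] with z hz
          exact ⟨fun h => ⟨⟨h.1, hz.2⟩, h.2⟩, fun h => ⟨h.1.1, h.2⟩⟩
        · refine hempty _ (measurableSet_predictable_Ioi_prod hA) ?_ c ε hε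
          filter_upwards [htime] with z hz h
          exact hit ((le_of_lt h.1).trans hz.2)
      · refine happ _ MeasurableSet.univ 0 t bot_le Set.univ MeasurableSet.univ ?_ c ε hε
        filter_upwards [htime] with z hz
        exact ⟨fun _ => ⟨hz, trivial⟩, fun _ => trivial⟩) hfm hε
  refine ⟨L, ?_⟩
  rwa [eLpNorm_trim hle (hf.sub (stronglyMeasurable_elemGamma L))] at hg

end Density

/-! ### Existence, uniqueness and linearity of the stochastic integral -/

lemma tendsto_measure_ge_of_le_two_mul_add {Ω : Type*} {mΩ : MeasurableSpace Ω} {P : Measure Ω}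
    {f g h : ℕ → Ω → ℝ≥0∞} (hle : ∀ n ω, f n ω ≤ 2 * (g n ω + h n ω))
    (hg : ∀ ε : ℝ≥0∞, 0 < ε → Tendsto (fun n => P {ω | ε ≤ g n ω}) atTop (𝓝 0))
    (hh : ∀ ε : ℝ≥0∞, 0 < ε → Tendsto (fun n => P {ω | ε ≤ h n ω}) atTop (𝓝 0))
    {ε : ℝ≥0∞} (hε : 0 < ε) : Tendsto (fun n => P {ω | ε ≤ f n ω}) atTop (𝓝 0) := by
  have hε4 : 0 < ε / 2 / 2 := ENNReal.half_pos (ENNReal.half_pos hε.ne').ne'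
  have hlim := (hg _ hε4).add (hh _ hε4)
  rw [add_zero] at hlim
  refine tendsto_of_tendsto_of_tendsto_of_le_of_le tendsto_const_nhds hlim (fun _ => zero_le)
    fun n => (measure_mono ?_).trans (measure_union_le _ _)
  intro ω hω
  by_contra hcon
  simp only [Set.mem_union, Set.mem_ofPred_eq, not_or, not_le] at hcon hω
  refine absurd (hω.trans (hle n ω)) (not_le.2 ?_)
  have h1 := ENNReal.add_lt_add hcon.1 hcon.2
  rw [ENNReal.add_halves] at h1
  calc 2 * (g n ω + h n ω) < 2 * (ε / 2) := by
        exact (ENNReal.mul_lt_mul_iff_right (by simp) (by simp)).2 h1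
    _ = ε := ENNReal.mul_div_cancel (by simp) (by simp)

lemma enorm_sub_sq_le {E : Type*} [NormedAddCommGroup E] (a b : E) :
    ‖a - b‖ₑ ^ 2 ≤ 2 * (‖a‖ₑ ^ 2 + ‖b‖ₑ ^ 2) := by
  have h := ENNReal.rpow_add_le_mul_rpow_add_rpow ‖a‖ₑ ‖b‖ₑ (show (1 : ℝ) ≤ 2 by norm_num)
  norm_num at h
  exact (pow_le_pow_left' (enorm_sub_le (a := a) (b := b)) 2).trans h

section StochInt

variable {Ω : Type*} {mΩ : MeasurableSpace Ω} {𝓕 : Filtration ℝ≥0 mΩ} {P : Measure Ω}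
  {U : Type*} [NormedAddCommGroup U] [InnerProductSpace ℝ U]
  {V : Type*} [NormedAddCommGroup V] [NormedSpace ℝ V] {W : ℝ≥0 → U → Ω → ℝ} {T : ℝ≥0}

lemma stronglyMeasurable_elemGamma_section (L : List (ElemTerm U V 𝓕)) (ω : Ω) :
    StronglyMeasurable fun s => elemGamma L (s, ω) :=
  ((stronglyMeasurable_elemGamma L).mono (predictable_le_prod 𝓕)).comp_measurable
    measurable_prodMk_right

lemma indicator_ae_eq_lebUpTo {E : Type*} [Zero E] (t : ℝ≥0) (Z : ℝ≥0 → E) :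
    (Set.Iic t).indicator Z =ᵐ[lebUpTo t] Z :=
  (ae_lebUpTo (p := (· ∈ Set.Iic t)) fun _ _ h2 => h2.le).mono fun _ hs =>
    Set.indicator_of_mem hs _

lemma uncurry_indicator_apply {E : Type*} [Zero E] (t s : ℝ≥0) (Z : ℝ≥0 → Ω → E) (ω : Ω) :
    Function.uncurry ((Set.Iic t).indicator Z) (s, ω)
      = (Set.Iic t).indicator (fun s => Z s ω) s := by
  by_cases hs : s ∈ Set.Iic t <;> simp [Function.uncurry, hs]

lemma uncurry_indicator_ae_eq {E : Type*} [Zero E] (t : ℝ≥0) (Z : ℝ≥0 → Ω → E) (ω : Ω) :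
    (fun s => Function.uncurry ((Set.Iic t).indicator Z) (s, ω)) =ᵐ[lebUpTo t] fun s => Z s ω := by
  simp_rw [uncurry_indicator_apply]
  exact indicator_ae_eq_lebUpTo t _

lemma IsPredictableUpTo.stronglyMeasurable_uncurry {E : Type*} [NormedAddCommGroup E] {t : ℝ≥0}
    {Z : ℝ≥0 → Ω → E} (hZ : IsPredictableUpTo 𝓕 t Z) :
    StronglyMeasurable (Function.uncurry ((Set.Iic t).indicator Z)) :=
  StronglyMeasurable.mono hZ (predictable_le_prod 𝓕)

lemma IsPredictableUpTo.aestronglyMeasurable_section {E : Type*} [NormedAddCommGroup E] {t : ℝ≥0}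
    {Z : ℝ≥0 → Ω → E} (hZ : IsPredictableUpTo 𝓕 t Z) (ω : Ω) :
    AEStronglyMeasurable (fun s => Z s ω) (lebUpTo t) :=
  (hZ.stronglyMeasurable_uncurry.comp_measurable
    measurable_prodMk_right).aestronglyMeasurable.congr (uncurry_indicator_ae_eq t Z ω)

/-- The square function `∫₀ᵗ ‖Z_s - Φ_s‖² ds` of the difference of `Z` and an elementary `Φ`. -/
noncomputable def sqDist (t : ℝ≥0) (Z : ℝ≥0 → Ω → GammaRad U V) (L : List (ElemTerm U V 𝓕))
    (ω : Ω) : ℝ≥0∞ :=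
  ∫⁻ s, ‖Z s ω - elemGamma L (s, ω)‖ₑ ^ 2 ∂lebUpTo t

lemma lintegral_gammaNorm_sub_eq_sqDist (t : ℝ≥0) (Z : ℝ≥0 → Ω → GammaRad U V)
    (L : List (ElemTerm U V 𝓕)) (ω : Ω) :
    ∫⁻ s, gammaNorm ((Z s ω).toCLM - elemProcess L s ω) ^ 2 ∂lebUpTo t = sqDist t Z L ω := by
  simp_rw [gammaNorm_sub_elemProcess]; rfl

lemma lintegral_gammaNorm_diff_le {t : ℝ≥0} {Z : ℝ≥0 → Ω → GammaRad U V} {ω : Ω}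
    (hZ : AEStronglyMeasurable (fun s => Z s ω) (lebUpTo t)) (L L' : List (ElemTerm U V 𝓕)) :
    ∫⁻ s, gammaNorm (elemProcess (L ++ L'.map ElemTerm.neg) s ω) ^ 2 ∂lebUpTo t
      ≤ 2 * (sqDist t Z L' ω + sqDist t Z L ω) := by
  have hm : AEMeasurable (fun s => ‖Z s ω - elemGamma L' (s, ω)‖ₑ ^ 2) (lebUpTo t) :=
    (hZ.sub (stronglyMeasurable_elemGamma_section L' ω).aestronglyMeasurable).enorm.pow_const 2
  rw [sqDist, sqDist, ← lintegral_add_left' hm, ← lintegral_const_mul' _ _ (by simp)]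
  refine lintegral_mono fun s => ?_
  rw [gammaNorm_elemProcess, elemGamma_append, elemGamma_map_neg, Pi.add_apply, Pi.neg_apply]
  have e : elemGamma L (s, ω) + -elemGamma L' (s, ω)
      = (Z s ω - elemGamma L' (s, ω)) - (Z s ω - elemGamma L (s, ω)) := by abel
  rw [e]
  exact enorm_sub_sq_le _ _

lemma IsStochIntegral.sub {t : ℝ≥0} {Z Z' : ℝ≥0 → Ω → GammaRad U V}
    (hZ : ∀ ω, AEStronglyMeasurable (fun s => Z s ω) (lebUpTo t)) {I I' : Ω → V}
    (hI : IsStochIntegral P 𝓕 W t Z I) (hI' : IsStochIntegral P 𝓕 W t Z' I') :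
    IsStochIntegral P 𝓕 W t (Z - Z') (I - I') := by
  obtain ⟨L, hL, hLI⟩ := hI
  obtain ⟨L', hL', hLI'⟩ := hI'
  simp_rw [lintegral_gammaNorm_sub_eq_sqDist] at hL hL'
  refine ⟨fun n => L n ++ (L' n).map ElemTerm.neg, fun ε hε => ?_, ?_⟩
  · simp_rw [lintegral_gammaNorm_sub_eq_sqDist]
    refine tendsto_measure_ge_of_le_two_mul_add (fun n ω => ?_) hL hL' hε
    have hm : AEMeasurable (fun s => ‖Z s ω - elemGamma (L n) (s, ω)‖ₑ ^ 2) (lebUpTo t) :=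
      ((hZ ω).sub
        (stronglyMeasurable_elemGamma_section (L n) ω).aestronglyMeasurable).enorm.pow_const 2
    rw [sqDist, sqDist, sqDist, ← lintegral_add_left' hm, ← lintegral_const_mul' _ _ (by simp)]
    refine lintegral_mono fun s => ?_
    rw [elemGamma_append, elemGamma_map_neg]
    have e : (Z - Z') s ω - (elemGamma (L n) + -elemGamma (L' n)) (s, ω)
        = (Z s ω - elemGamma (L n) (s, ω)) - (Z' s ω - elemGamma (L' n) (s, ω)) := by
      simp only [Pi.sub_apply, Pi.add_apply, Pi.neg_apply]
      abel
    rw [e]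
    exact enorm_sub_sq_le _ _
  · rw [tendstoInMeasure_iff_enorm] at hLI hLI' ⊢
    intro ε hε hεtop
    have hε2 : 0 < ε / 2 := ENNReal.half_pos hε.ne'
    have hlim := (hLI (ε / 2) hε2 (by finiteness)).add (hLI' (ε / 2) hε2 (by finiteness))
    rw [add_zero] at hlim
    refine tendsto_of_tendsto_of_tendsto_of_le_of_le tendsto_const_nhds hlim (fun _ => zero_le)
      fun n => (measure_mono ?_).trans (measure_union_le _ _)
    intro ω hω
    by_contra hcon
    simp only [Set.mem_union, Set.mem_ofPred_eq, not_or, not_le] at hcon hω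
    refine absurd hω (not_le.2 ?_)
    have h1 := ENNReal.add_lt_add hcon.1 hcon.2
    rw [ENNReal.add_halves] at h1
    refine lt_of_le_of_lt ?_ h1
    refine le_trans (le_of_eq ?_) (enorm_sub_le (a := elemIntegral W t (L n) ω - I ω)
      (b := elemIntegral W t (L' n) ω - I' ω))
    congr 1
    simp only [elemIntegral_append, elemIntegral_map_neg, Pi.add_apply, Pi.neg_apply,
      Pi.sub_apply]
    abel

lemma IsCylindricalWiener.aestronglyMeasurable_elemIntegral (hW : IsCylindricalWiener P T 𝓕 W)
    {t : ℝ≥0} (ht : t ≤ T) (L : List (ElemTerm U V 𝓕)) :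
    AEStronglyMeasurable (elemIntegral W t L) P := by
  obtain ⟨N, m, τ, A, h, x, hmono, -, -, hle, hA, hint, -⟩ := exists_grid_representation L t
  rw [hint W]
  refine Finset.aestronglyMeasurable_sum _ fun k _ => ?_
  exact ((hW.stronglyMeasurable_stepInc _ (hmono k.le_succ) ((hle _).trans ht)
    (hA k) h x).mono (𝓕.le _)).aestronglyMeasurable

end StochInt

section Lenglart

variable {Ω : Type w} {mΩ : MeasurableSpace Ω} {P : Measure Ω} [IsProbabilityMeasure P] {T : ℝ≥0}
  {𝓕 : Filtration ℝ≥0 mΩ} {U : Type v} [NormedAddCommGroup U] [InnerProductSpace ℝ U]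
  {V : Type u} [NormedAddCommGroup V] [NormedSpace ℝ V] [CompleteSpace V]
  [TopologicalSpace.SeparableSpace V] {W : ℝ≥0 → U → Ω → ℝ}

/-- By Lenglart's inequality, elementary integrals tend to zero in probability as soon as the square
functions of their integrands do. -/
lemma IsCylindricalWiener.tendstoInMeasure_elemIntegral_zero (hUMD : IsUMD.{w, u} V)
    (hType : HasTypeTwo V) (hW : IsCylindricalWiener P T 𝓕 W) {t : ℝ≥0} (ht : t ≤ T)
    (L : ℕ → List (ElemTerm U V 𝓕))
    (hL : ∀ ε : ℝ≥0∞, 0 < ε → Tendsto (fun n => P {ω | ε ≤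
      ∫⁻ s, gammaNorm (elemProcess (L n) s ω) ^ 2 ∂lebUpTo t}) atTop (𝓝 0)) :
    TendstoInMeasure P (fun n => elemIntegral W t (L n)) atTop 0 := by
  obtain ⟨C, hC⟩ := hW.exists_measure_elemIntegral_ge_le hUMD hType
  rw [tendstoInMeasure_iff_enorm]
  intro ε hε hεtop
  simp only [Pi.zero_apply, sub_zero]
  rw [ENNReal.tendsto_nhds_zero]
  intro η hη
  -- the level `δ` at which the second term of Lenglart's inequality is at most `η / 2`
  set δ : ℝ≥0∞ := η / 2 * ε ^ 2 / (C + 1) with hδ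
  have hδ0 : 0 < δ := ENNReal.div_pos (mul_ne_zero (ENNReal.half_pos hη.ne').ne'
    (pow_ne_zero _ hε.ne')) (by finiteness)
  have hsecond : C * δ / ε ^ 2 ≤ η / 2 := by
    refine ENNReal.div_le_of_le_mul ?_
    calc (C : ℝ≥0∞) * δ ≤ (C + 1) * δ := by gcongr; exact le_self_add
      _ ≤ η / 2 * ε ^ 2 := ENNReal.mul_div_le
  filter_upwards [(ENNReal.tendsto_nhds_zero.1 (hL δ hδ0)) (η / 2) (ENNReal.half_pos hη.ne')]
    with n hn
  calc P {ω | ε ≤ ‖elemIntegral W t (L n) ω‖ₑ}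
      ≤ P {ω | δ < ∫⁻ s, gammaNorm (elemProcess (L n) s ω) ^ 2 ∂lebUpTo t} + C * δ / ε ^ 2 :=
        hC t (L n) ε δ ht hε.ne' hεtop
    _ ≤ η / 2 + η / 2 := by
        refine add_le_add (le_trans (measure_mono fun ω hω => ?_) hn) hsecond
        exact (show δ < _ from hω).le
    _ = η := ENNReal.add_halves η

/-- Every sequence of elementary processes approximating `Z` computes the stochastic integral. -/
lemma IsStochIntegral.tendstoInMeasure (hUMD : IsUMD.{w, u} V)
    (hType : HasTypeTwo V) (hW : IsCylindricalWiener P T 𝓕 W) {t : ℝ≥0} (ht : t ≤ T)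
    {Z : ℝ≥0 → Ω → GammaRad U V} (hZ : ∀ ω, AEStronglyMeasurable (fun s => Z s ω) (lebUpTo t))
    {I : Ω → V} (hI : IsStochIntegral P 𝓕 W t Z I) {L : ℕ → List (ElemTerm U V 𝓕)}
    (hL : ∀ ε : ℝ≥0∞, 0 < ε → Tendsto (fun n => P {ω | ε ≤ sqDist t Z (L n) ω}) atTop (𝓝 0)) :
    TendstoInMeasure P (fun n => elemIntegral W t (L n)) atTop I := by
  obtain ⟨L', hL', hI'⟩ := hI
  simp_rw [lintegral_gammaNorm_sub_eq_sqDist] at hL'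
  have h0 := hW.tendstoInMeasure_elemIntegral_zero hUMD hType ht
    (fun n => L n ++ (L' n).map ElemTerm.neg) fun ε hε =>
      tendsto_measure_ge_of_le_two_mul_add
        (fun n ω => lintegral_gammaNorm_diff_le (hZ ω) (L n) (L' n)) hL' hL hε
  rw [tendstoInMeasure_iff_enorm] at h0 hI' ⊢
  intro ε hε hεtop
  have hε2 : 0 < ε / 2 := ENNReal.half_pos hε.ne'
  have hlim := (h0 (ε / 2) hε2 (by finiteness)).add (hI' (ε / 2) hε2 (by finiteness))
  rw [add_zero] at hlim
  refine tendsto_of_tendsto_of_tendsto_of_le_of_le tendsto_const_nhds hlim (fun _ => zero_le)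
    fun n => (measure_mono ?_).trans (measure_union_le _ _)
  intro ω hω
  by_contra hcon
  simp only [Set.mem_union, Set.mem_ofPred_eq, not_or, not_le] at hcon hω
  refine absurd hω (not_le.2 ?_)
  have h1 := ENNReal.add_lt_add hcon.1 hcon.2
  rw [ENNReal.add_halves] at h1
  refine lt_of_le_of_lt ?_ h1
  refine le_trans (le_of_eq ?_) (enorm_add_le _ _)
  congr 1
  simp only [elemIntegral_append, elemIntegral_map_neg, Pi.add_apply, Pi.neg_apply, Pi.zero_apply]
  abel

lemma IsStochIntegral.ae_eq (hUMD : IsUMD.{w, u} V)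
    (hType : HasTypeTwo V) (hW : IsCylindricalWiener P T 𝓕 W) {t : ℝ≥0} (ht : t ≤ T)
    {Z : ℝ≥0 → Ω → GammaRad U V} (hZ : ∀ ω, AEStronglyMeasurable (fun s => Z s ω) (lebUpTo t))
    {I I' : Ω → V} (hI : IsStochIntegral P 𝓕 W t Z I) (hI' : IsStochIntegral P 𝓕 W t Z I') :
    I =ᵐ[P] I' := by
  obtain ⟨L, hL, hLI⟩ := hI'
  simp_rw [lintegral_gammaNorm_sub_eq_sqDist] at hL
  exact tendstoInMeasure_ae_unique (hI.tendstoInMeasure hUMD hType hW ht hZ hL) hLI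

/-- If `Z` can be approximated by elementary processes in probability then its stochastic integral
exists: by Lenglart's inequality and the Borel–Cantelli lemma the integrals of a fast approximating
sequence converge almost surely. -/
lemma IsCylindricalWiener.exists_isStochIntegral (hUMD : IsUMD.{w, u} V)
    (hType : HasTypeTwo V) (hW : IsCylindricalWiener P T 𝓕 W) {t : ℝ≥0} (ht : t ≤ T)
    {Z : ℝ≥0 → Ω → GammaRad U V} (hZ : ∀ ω, AEStronglyMeasurable (fun s => Z s ω) (lebUpTo t))
    (happ : ∀ η : ℝ≥0∞, 0 < η → ∃ L : List (ElemTerm U V 𝓕), P {ω | η ≤ sqDist t Z L ω} ≤ η) :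
    ∃ I, IsStochIntegral P 𝓕 W t Z I := by
  obtain ⟨C, hC⟩ := hW.exists_measure_elemIntegral_ge_le hUMD hType
  set η : ℕ → ℝ≥0∞ := fun k => (8⁻¹ : ℝ≥0∞) ^ k with hη
  have hη0 (k : ℕ) : 0 < η k := ENNReal.pow_pos (by simp) k
  have hηanti (k : ℕ) : η (k + 1) ≤ η k := by
    simp only [hη, pow_succ]
    exact mul_le_of_le_one_right' (by simp)
  choose L hL using fun k => happ (η k) (hη0 k)
  have hηlim : Tendsto η atTop (𝓝 0) := by
    refine ENNReal.tendsto_pow_atTop_nhds_zero_of_lt_one ?_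
    rw [ENNReal.inv_lt_one]; norm_num
  have happrox (ε : ℝ≥0∞) (hε : 0 < ε) :
      Tendsto (fun n => P {ω | ε ≤ sqDist t Z (L n) ω}) atTop (𝓝 0) := by
    refine tendsto_of_tendsto_of_tendsto_of_le_of_le' tendsto_const_nhds hηlim
      (Eventually.of_forall fun _ => zero_le) ?_
    filter_upwards [hηlim.eventually_lt_const hε] with n hn
    exact (measure_mono fun ω hω => hn.le.trans hω).trans (hL n)
  set J : ℕ → Ω → V := fun k => elemIntegral W t (L k) with hJ
  have hstep (k : ℕ) : P {ω | (2⁻¹ : ℝ≥0∞) ^ k ≤ ‖J (k + 1) ω - J k ω‖ₑ}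
      ≤ (2 + 4 * C) * (2⁻¹ : ℝ≥0∞) ^ k := by
    have h1 := hC t (L (k + 1) ++ (L k).map ElemTerm.neg) ((2⁻¹ : ℝ≥0∞) ^ k) (4 * η k) ht
      (pow_ne_zero _ (by simp)) (by finiteness)
    have h2 : P {ω | 4 * η k < ∫⁻ s, gammaNorm
        (elemProcess (L (k + 1) ++ (L k).map ElemTerm.neg) s ω) ^ 2 ∂lebUpTo t}
        ≤ η k + η k := by
      refine (measure_mono (t := {ω | η k ≤ sqDist t Z (L k) ω}
        ∪ {ω | η (k + 1) ≤ sqDist t Z (L (k + 1)) ω}) ?_).trans ((measure_union_le _ _).trans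
          (add_le_add (hL k) ((hL (k + 1)).trans (hηanti k))))
      intro ω hω
      by_contra hcon
      simp only [Set.mem_union, Set.mem_ofPred_eq, not_or, not_le] at hcon hω
      refine absurd hω (not_lt.2 ((lintegral_gammaNorm_diff_le (hZ ω) _ _).trans ?_))
      calc 2 * (sqDist t Z (L k) ω + sqDist t Z (L (k + 1)) ω)
          ≤ 2 * (η k + η k) := by
            gcongr
            · exact hcon.1.le
            · exact hcon.2.le.trans (hηanti k)
        _ = 4 * η k := by ring
    have h48 : (8⁻¹ : ℝ≥0∞) ^ k = (2⁻¹) ^ k * ((2⁻¹) ^ k) ^ 2 := by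
      have h8 : (8⁻¹ : ℝ≥0∞) = 2⁻¹ ^ 3 := by rw [← ENNReal.inv_pow]; norm_num
      rw [h8, ← pow_mul, ← pow_mul, ← pow_add]
      congr 1
      ring
    have hx0 : ((2⁻¹ : ℝ≥0∞) ^ k) ^ 2 ≠ 0 := pow_ne_zero _ (pow_ne_zero _ (by simp))
    have h3 : (C : ℝ≥0∞) * (4 * η k) / ((2⁻¹ : ℝ≥0∞) ^ k) ^ 2 = 4 * C * (2⁻¹) ^ k := by
      simp only [hη]
      rw [h48, show (C : ℝ≥0∞) * (4 * ((2⁻¹) ^ k * ((2⁻¹) ^ k) ^ 2))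
        = 4 * C * (2⁻¹) ^ k * ((2⁻¹) ^ k) ^ 2 by ring]
      exact ENNReal.mul_div_cancel_right hx0 (by finiteness)
    have h4 : η k ≤ (2⁻¹ : ℝ≥0∞) ^ k := by
      simp only [hη]
      exact pow_le_pow_left' (ENNReal.inv_le_inv.2 (by norm_num)) k
    have h5 : ∀ ω, elemIntegral W t (L (k + 1) ++ (L k).map ElemTerm.neg) ω
        = J (k + 1) ω - J k ω := by
      intro ω
      rw [elemIntegral_append, elemIntegral_map_neg, Pi.add_apply, Pi.neg_apply, sub_eq_add_neg]
    simp_rw [h5] at h1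
    rw [h3] at h1
    refine h1.trans ?_
    calc _ ≤ (η k + η k) + 4 * C * (2⁻¹ : ℝ≥0∞) ^ k := by gcongr
      _ ≤ ((2⁻¹) ^ k + (2⁻¹) ^ k) + 4 * C * (2⁻¹ : ℝ≥0∞) ^ k := by gcongr
      _ = _ := by ring
  have hsum : ∑' k, P {ω | (2⁻¹ : ℝ≥0∞) ^ k ≤ ‖J (k + 1) ω - J k ω‖ₑ} ≠ ⊤ := by
    refine ne_top_of_le_ne_top ?_ (ENNReal.tsum_le_tsum hstep)
    rw [ENNReal.tsum_mul_left, ENNReal.tsum_geometric_two]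
    finiteness
  have hconv : ∀ᵐ ω ∂P, ∃ l, Tendsto (fun k => J k ω) atTop (𝓝 l) := by
    filter_upwards [ae_eventually_notMem hsum] with ω hω
    refine cauchySeq_tendsto_of_complete ?_
    obtain ⟨n, hn⟩ := eventually_atTop.1 hω
    refine (cauchySeq_shift (u := fun k => J k ω) n).1 ?_
    refine cauchySeq_of_le_geometric (1 / 2) 1 (by norm_num) fun k => ?_
    have h1 := hn (k + n) (Nat.le_add_left n k)
    simp only [not_le] at h1
    have h2 : (2⁻¹ : ℝ≥0∞) ^ (k + n) ≤ ENNReal.ofReal (1 * (1 / 2) ^ k) := by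
      rw [one_mul, ENNReal.ofReal_pow (by norm_num), one_div,
        ENNReal.ofReal_inv_of_pos (by norm_num), pow_add]
      simp only [ENNReal.ofReal_ofNat]
      refine mul_le_of_le_one_right' (pow_le_one' (by simp) n)
    rw [dist_comm, dist_eq_norm, show k + 1 + n = k + n + 1 by ring]
    have h3 := h1.le.trans h2
    rwa [← ofReal_norm, ENNReal.ofReal_le_ofReal_iff (by positivity)] at h3
  have hJm (k : ℕ) : AEStronglyMeasurable (J k) P := hW.aestronglyMeasurable_elemIntegral ht _
  obtain ⟨I, -, hI⟩ := exists_stronglyMeasurable_limit_of_tendsto_ae hJm hconv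
  refine ⟨I, L, fun ε hε => ?_, tendstoInMeasure_of_tendsto_ae hJm hI⟩
  simp_rw [lintegral_gammaNorm_sub_eq_sqDist]
  exact happrox ε hε

end Lenglart

/-! ### Truncation -/

section Trunc

variable {α E : Type*} [NormedAddCommGroup E]

/-- The function `f` cut off to `0` where its norm exceeds `n`. -/
noncomputable def normTrunc (n : ℕ) (f : α → E) : α → E := {x | ‖f x‖ ≤ n}.indicator f

lemma norm_normTrunc_le (n : ℕ) (f : α → E) (x : α) : ‖normTrunc n f x‖ ≤ n := by
  rw [normTrunc, Set.indicator_apply]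
  split_ifs with h
  · exact h
  · simp

lemma enorm_sub_normTrunc_le (n : ℕ) (f : α → E) (x : α) :
    ‖f x - normTrunc n f x‖ₑ ≤ ‖f x‖ₑ := by
  rw [normTrunc, Set.indicator_apply]
  split_ifs <;> simp

lemma eventually_normTrunc_eq (f : α → E) (x : α) : ∀ᶠ n in atTop, normTrunc n f x = f x := by
  obtain ⟨N, hN⟩ := exists_nat_ge ‖f x‖
  filter_upwards [eventually_ge_atTop N] with n hn
  exact Set.indicator_of_mem (s := {x | ‖f x‖ ≤ n}) (hN.trans (Nat.cast_le.2 hn)) f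

lemma MeasureTheory.StronglyMeasurable.normTrunc {m : MeasurableSpace α} {f : α → E}
    (hf : StronglyMeasurable f) (n : ℕ) : StronglyMeasurable (normTrunc n f) :=
  hf.indicator (hf.norm.measurable measurableSet_Iic)

lemma tendsto_lintegral_sub_normTrunc_rpow {m : MeasurableSpace α} {μ : Measure α} {f : α → E}
    (hf : StronglyMeasurable f) {r : ℝ} (hr : 0 < r) (hfin : ∫⁻ x, ‖f x‖ₑ ^ r ∂μ ≠ ⊤) :
    Tendsto (fun n => ∫⁻ x, ‖f x - normTrunc n f x‖ₑ ^ r ∂μ) atTop (𝓝 0) := by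
  have h := tendsto_lintegral_of_dominated_convergence (μ := μ) (f := fun _ => 0)
    (F := fun n x => ‖f x - normTrunc n f x‖ₑ ^ r) (fun x => ‖f x‖ₑ ^ r)
    (fun n => (hf.sub (hf.normTrunc n)).enorm.pow_const r)
    (fun n => Eventually.of_forall fun x => by
      have := enorm_sub_normTrunc_le n f x
      dsimp only
      gcongr) hfin
    (Eventually.of_forall fun x => by
      refine tendsto_const_nhds.congr' ?_
      filter_upwards [eventually_normTrunc_eq f x] with n hn
      rw [hn, sub_self, enorm_zero, ENNReal.zero_rpow_of_pos hr])
  simpa using h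

end Trunc

/-! ### Existence of the stochastic integral -/

section Existence

variable {Ω : Type*} {mΩ : MeasurableSpace Ω} {𝓕 : Filtration ℝ≥0 mΩ} {P : Measure Ω}
  [IsProbabilityMeasure P]
  {U : Type*} [NormedAddCommGroup U] [InnerProductSpace ℝ U]
  {V : Type*} [NormedAddCommGroup V] [NormedSpace ℝ V]

/-- The truncation of a predictable process is bounded, hence close in `L^q` to an elementary
process. -/
lemma exists_elemGamma_eLpNorm_normTrunc_sub_le [CompleteSpace U] {q : ℝ≥0∞}
    (hq1 : 1 ≤ q) (hq : q ≠ ⊤) (t : ℝ≥0)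
    {f : ℝ≥0 × Ω → GammaRad U V} (hf : StronglyMeasurable[𝓕.predictable] f) (n : ℕ) {ε : ℝ≥0∞}
    (hε : ε ≠ 0) : ∃ L : List (ElemTerm U V 𝓕),
      eLpNorm (normTrunc n f - elemGamma L) q ((lebUpTo t).prod P) ≤ ε := by
  refine exists_elemGamma_eLpNorm_sub_le hq1 hq t (hf.normTrunc n) ?_ hε
  refine lt_of_le_of_lt (eLpNorm_le_of_ae_bound
    (Eventually.of_forall (norm_normTrunc_le n f))) ?_
  finiteness

lemma sqDist_eq_uncurry (t : ℝ≥0) (Z : ℝ≥0 → Ω → GammaRad U V) (L : List (ElemTerm U V 𝓕))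
    (ω : Ω) : sqDist t Z L ω
      = ∫⁻ s, ‖Function.uncurry ((Set.Iic t).indicator Z) (s, ω) - elemGamma L (s, ω)‖ₑ ^ 2
          ∂lebUpTo t := by
  refine lintegral_congr_ae ?_
  filter_upwards [uncurry_indicator_ae_eq t Z ω] with s hs
  rw [hs]

lemma stronglyMeasurable_sub_elemGamma {f : ℝ≥0 × Ω → GammaRad U V}
    (hf : StronglyMeasurable f) (L : List (ElemTerm U V 𝓕)) :
    StronglyMeasurable fun z => f z - elemGamma L z :=
  hf.sub ((stronglyMeasurable_elemGamma L).mono (predictable_le_prod 𝓕))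

/-- A predictable process with almost surely square integrable paths is approximated in probability
by elementary processes: it is first truncated, then approximated in mean square. -/
lemma IsPredictableUpTo.exists_measure_sqDist_le [CompleteSpace U] {t : ℝ≥0}
    {Z : ℝ≥0 → Ω → GammaRad U V} (hZ : IsPredictableUpTo 𝓕 t Z)
    (hfin : ∀ᵐ ω ∂P, ∫⁻ s, ‖Z s ω‖ₑ ^ 2 ∂lebUpTo t < ⊤) {η : ℝ≥0∞} (hη : 0 < η) :
    ∃ L : List (ElemTerm U V 𝓕), P {ω | η ≤ sqDist t Z L ω} ≤ η := by
  by_cases hηtop : η = ⊤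
  · exact ⟨[], hηtop ▸ le_top⟩
  set f := Function.uncurry ((Set.Iic t).indicator Z) with hf
  have hfm : StronglyMeasurable f := hZ.stronglyMeasurable_uncurry
  have hη2 : 0 < η / 2 := ENNReal.half_pos hη.ne'
  have hη4 : 0 < η / 2 / 2 := ENNReal.half_pos hη2.ne'
  -- the tail of the square function is small in probability
  set tail : ℕ → Ω → ℝ≥0∞ := fun n ω => ∫⁻ s, ‖f (s, ω) - normTrunc n f (s, ω)‖ₑ ^ 2 ∂lebUpTo t
  have htailm (n : ℕ) : Measurable (tail n) :=
    ((hfm.sub (hfm.normTrunc n)).enorm.pow_const 2).lintegral_prod_left'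
  have htail : Tendsto (fun n => P {ω | η / 2 / 2 ≤ tail n ω}) atTop (𝓝 (P ∅)) := by
    refine tendsto_measure_of_ae_tendsto_indicator atTop MeasurableSet.empty
      (fun n => measurableSet_le measurable_const (htailm n)) MeasurableSet.univ (by finiteness)
      (Eventually.of_forall fun _ => Set.subset_univ _) ?_
    filter_upwards [hfin] with ω hω
    have hω' : ∫⁻ s, ‖f (s, ω)‖ₑ ^ (2 : ℝ) ∂lebUpTo t ≠ ⊤ := by
      refine ne_of_eq_of_ne (lintegral_congr_ae ?_) hω.ne
      filter_upwards [uncurry_indicator_ae_eq t Z ω] with s hs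
      rw [← hs, ENNReal.rpow_two]
    have hlim := tendsto_lintegral_sub_normTrunc_rpow
      (hfm.comp_measurable (measurable_prodMk_right (y := ω))) two_pos hω'
    filter_upwards [hlim.eventually_lt_const hη4] with n hn
    simp only [ENNReal.rpow_two] at hn
    have hn' : tail n ω < η / 2 / 2 := hn
    simpa using hn'
  rw [measure_empty] at htail
  obtain ⟨n, hn⟩ := (htail.eventually_lt_const hη2).exists
  -- an elementary process close in mean square to the truncated process
  set δ : ℝ≥0∞ := η / 2 * (η / 2 / 2) with hδ
  have hδ0 : δ ≠ 0 := mul_ne_zero hη2.ne' hη4.ne'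
  obtain ⟨L, hL⟩ := exists_elemGamma_eLpNorm_normTrunc_sub_le (q := ENNReal.ofReal 2) (P := P)
    (by simp) (by simp) t hZ n (ε := δ ^ (1 / 2 : ℝ))
    (ENNReal.rpow_pos (pos_iff_ne_zero.2 hδ0) (by finiteness)).ne'
  refine ⟨L, ?_⟩
  have hgm := stronglyMeasurable_sub_elemGamma (hfm.normTrunc n) L
  set near : Ω → ℝ≥0∞ := fun ω => ∫⁻ s, ‖normTrunc n f (s, ω) - elemGamma L (s, ω)‖ₑ ^ 2 ∂lebUpTo t
  have hnear : P {ω | η / 2 / 2 ≤ near ω} ≤ η / 2 := by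
    refine (meas_ge_le_lintegral_div (hgm.enorm.pow_const 2).lintegral_prod_left'.aemeasurable
      hη4.ne' (by finiteness)).trans (ENNReal.div_le_of_le_mul ?_)
    rw [lintegral_lintegral_swap (f := fun ω s =>
      ‖normTrunc n f (s, ω) - elemGamma L (s, ω)‖ₑ ^ 2)
      (((hgm.enorm.pow_const 2).comp measurable_swap).aemeasurable),
      ← lintegral_prod _ (hgm.enorm.pow_const 2).aemeasurable]
    have h := ENNReal.rpow_le_rpow hL (show (0 : ℝ) ≤ 2 by norm_num)
    rw [eLpNorm_ofReal_rpow two_pos, ← ENNReal.rpow_mul] at h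
    norm_num at h
    exact h
  have hle (ω : Ω) : sqDist t Z L ω ≤ 2 * (tail n ω + near ω) := by
    have hm : Measurable fun s => ‖f (s, ω) - normTrunc n f (s, ω)‖ₑ ^ 2 :=
      ((hfm.sub (hfm.normTrunc n)).comp_measurable
        (measurable_prodMk_right (y := ω))).enorm.pow_const 2
    rw [sqDist_eq_uncurry, ← lintegral_add_left hm, ← lintegral_const_mul' _ _ (by simp)]
    refine lintegral_mono fun s => ?_
    have h := enorm_sub_sq_le (f (s, ω) - normTrunc n f (s, ω))
      (-(normTrunc n f (s, ω) - elemGamma L (s, ω)))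
    rw [enorm_neg] at h
    refine le_trans (le_of_eq ?_) h
    congr 2
    abel
  have hsub : {ω | η ≤ sqDist t Z L ω}
      ⊆ {ω | η / 2 / 2 ≤ tail n ω} ∪ {ω | η / 2 / 2 ≤ near ω} := by
    intro ω hω
    by_contra hcon
    simp only [Set.mem_union, Set.mem_ofPred_eq, not_or, not_le] at hcon hω
    refine absurd (hω.trans (hle ω)) (not_le.2 ?_)
    have h1 := ENNReal.add_lt_add hcon.1 hcon.2
    rw [ENNReal.add_halves] at h1
    calc 2 * (tail n ω + near ω) < 2 * (η / 2) :=
          (ENNReal.mul_lt_mul_iff_right (by simp) (by simp)).2 h1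
      _ = η := ENNReal.mul_div_cancel (by simp) (by simp)
  calc _ ≤ _ := (measure_mono hsub).trans (measure_union_le _ _)
    _ ≤ η / 2 + η / 2 := add_le_add hn.le hnear
    _ = η := ENNReal.add_halves η

end Existence

section ExistenceInt

variable {Ω : Type w} {mΩ : MeasurableSpace Ω} {P : Measure Ω} [IsProbabilityMeasure P] {T : ℝ≥0}
  {𝓕 : Filtration ℝ≥0 mΩ} {U : Type v} [NormedAddCommGroup U] [InnerProductSpace ℝ U]
  [CompleteSpace U] {V : Type u} [NormedAddCommGroup V] [NormedSpace ℝ V] [CompleteSpace V]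
  [TopologicalSpace.SeparableSpace V] {W : ℝ≥0 → U → Ω → ℝ}

/-- The stochastic integral of a predictable process exists as soon as the process is almost surely
square integrable in time. -/
lemma IsCylindricalWiener.isStochIntegral_stochIntegral (hUMD : IsUMD.{w, u} V)
    (hType : HasTypeTwo V) (hW : IsCylindricalWiener P T 𝓕 W) {t : ℝ≥0} (ht : t ≤ T)
    {Z : ℝ≥0 → Ω → GammaRad U V} (hZ : IsPredictableUpTo 𝓕 t Z)
    (hfin : ∀ᵐ ω ∂P, ∫⁻ s, ‖Z s ω‖ₑ ^ 2 ∂lebUpTo t < ⊤) :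
    IsStochIntegral P 𝓕 W t Z (stochIntegral P 𝓕 W t Z) := by
  have h := hW.exists_isStochIntegral hUMD hType ht hZ.aestronglyMeasurable_section
    fun η hη => hZ.exists_measure_sqDist_le hfin hη
  rw [stochIntegral, dif_pos h]
  exact h.choose_spec

end ExistenceInt

/-! ### The moment bound for stochastic integrals -/

section Moment

variable {Ω : Type*} {mΩ : MeasurableSpace Ω} {𝓕 : Filtration ℝ≥0 mΩ} {P : Measure Ω}
  [IsProbabilityMeasure P] {E : Type*} [NormedAddCommGroup E]

lemma measurable_eLpNorm_section {p : ℝ} (hp : 0 < p) {f : ℝ≥0 × Ω → E}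
    (hf : StronglyMeasurable f) :
    Measurable fun s => eLpNorm (fun ω => f (s, ω)) (ENNReal.ofReal p) P := by
  simp_rw [eLpNorm_ofReal_eq hp]
  exact (hf.enorm.pow_const p).lintegral_prod_right'.pow_const _

/-- By Hölder's inequality in time, the norm of `L²([0, t]; L^p)` is dominated by that of
`L^p([0, t] × Ω)`. -/
lemma lintegral_eLpNorm_sq_le {p : ℝ} (hp : 2 ≤ p) (t : ℝ≥0) {f : ℝ≥0 × Ω → E}
    (hf : StronglyMeasurable f) :
    ∫⁻ s, eLpNorm (fun ω => f (s, ω)) (ENNReal.ofReal p) P ^ 2 ∂lebUpTo t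
      ≤ (eLpNorm f (ENNReal.ofReal p) ((lebUpTo t).prod P)
          * (t : ℝ≥0∞) ^ (1 / 2 - 1 / p)) ^ 2 := by
  have hp0 : 0 < p := by linarith
  have h := eLpNorm_le_eLpNorm_mul_rpow_measure_univ (μ := lebUpTo t)
    (ENNReal.ofReal_le_ofReal hp)
    (measurable_eLpNorm_section (P := P) hp0 hf).aestronglyMeasurable
  have e : eLpNorm (fun s => eLpNorm (fun ω => f (s, ω)) (ENNReal.ofReal p) P) (ENNReal.ofReal p)
      (lebUpTo t) = eLpNorm f (ENNReal.ofReal p) ((lebUpTo t).prod P) := by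
    rw [eLpNorm_ofReal_eq hp0, eLpNorm_ofReal_eq hp0,
      lintegral_prod _ (hf.enorm.pow_const p).aemeasurable]
    simp_rw [enorm_eq_self, eLpNorm_ofReal_rpow hp0]
  rw [e, ENNReal.toReal_ofReal two_pos.le, ENNReal.toReal_ofReal hp0.le, lebUpTo_univ] at h
  have h2 := ENNReal.rpow_le_rpow h two_pos.le
  rw [eLpNorm_ofReal_rpow two_pos] at h2
  simpa only [ENNReal.rpow_two, enorm_eq_self] using h2

/-- Truncations converge in `L²([0, t]; L^p)`. -/
lemma tendsto_lintegral_eLpNorm_sub_normTrunc {p : ℝ} (hp : 2 ≤ p) (t : ℝ≥0) {f : ℝ≥0 × Ω → E}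
    (hf : StronglyMeasurable f)
    (hfin : ∫⁻ s, eLpNorm (fun ω => f (s, ω)) (ENNReal.ofReal p) P ^ 2 ∂lebUpTo t < ⊤) :
    Tendsto (fun n => ∫⁻ s, eLpNorm (fun ω => f (s, ω) - normTrunc n f (s, ω))
      (ENNReal.ofReal p) P ^ 2 ∂lebUpTo t) atTop (𝓝 0) := by
  have hp0 : 0 < p := by linarith
  have hm := measurable_eLpNorm_section (P := P) hp0 hf
  have h := tendsto_lintegral_of_dominated_convergence (μ := lebUpTo t) (f := fun _ => 0)
    (F := fun n s => eLpNorm (fun ω => f (s, ω) - normTrunc n f (s, ω)) (ENNReal.ofReal p) P ^ 2)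
    (fun s => eLpNorm (fun ω => f (s, ω)) (ENNReal.ofReal p) P ^ 2)
    (fun n => (measurable_eLpNorm_section hp0 (hf.sub (hf.normTrunc n))).pow_const 2)
    (fun n => Eventually.of_forall fun s => by
      dsimp only
      gcongr ?_ ^ 2
      exact eLpNorm_mono_enorm fun ω => enorm_sub_normTrunc_le n f (s, ω)) hfin.ne ?_
  · simpa using h
  filter_upwards [ae_lt_top (hm.pow_const 2) hfin.ne] with s hs
  have hs' : ∫⁻ ω, ‖f (s, ω)‖ₑ ^ p ∂P ≠ ⊤ := by
    rw [← eLpNorm_ofReal_rpow hp0]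
    have : eLpNorm (fun ω => f (s, ω)) (ENNReal.ofReal p) P ≠ ⊤ := by
      intro h
      simp [h] at hs
    finiteness
  have hlim := tendsto_lintegral_sub_normTrunc_rpow
      (hf.comp_measurable (measurable_prodMk_left (x := s))) hp0 hs'
  have h1 := ((ENNReal.continuous_rpow_const (y := 1 / p)).tendsto 0).comp hlim
  have h2 := ((ENNReal.continuous_pow 2).tendsto _).comp h1
  rw [ENNReal.zero_rpow_of_pos (by positivity), zero_pow two_ne_zero] at h2
  refine h2.congr fun n => ?_
  simp only [Function.comp_apply]
  rw [eLpNorm_ofReal_eq hp0]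
  rfl

/-- Elementary processes are dense in the predictable part of `L²([0, t]; L^p(P; γ(U, V)))`. -/
lemma exists_lintegral_eLpNorm_sub_elemGamma_le {U : Type*} [NormedAddCommGroup U]
    [InnerProductSpace ℝ U] [CompleteSpace U] {V : Type*} [NormedAddCommGroup V] [NormedSpace ℝ V]
    {p : ℝ} (hp : 2 ≤ p) (t : ℝ≥0) {f : ℝ≥0 × Ω → GammaRad U V}
    (hf : StronglyMeasurable[𝓕.predictable] f)
    (hfin : ∫⁻ s, eLpNorm (fun ω => f (s, ω)) (ENNReal.ofReal p) P ^ 2 ∂lebUpTo t < ⊤)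
    {η : ℝ≥0∞} (hη : η ≠ 0) : ∃ L : List (ElemTerm U V 𝓕),
      ∫⁻ s, eLpNorm (fun ω => f (s, ω) - elemGamma L (s, ω)) (ENNReal.ofReal p) P ^ 2 ∂lebUpTo t
        ≤ η := by
  by_cases hηtop : η = ⊤
  · exact ⟨[], hηtop ▸ le_top⟩
  have hp0 : 0 < p := by linarith
  have hp1 : 1 ≤ ENNReal.ofReal p := by
    rw [← ENNReal.ofReal_one]; exact ENNReal.ofReal_le_ofReal (by linarith)
  have hfm : StronglyMeasurable f := hf.mono (predictable_le_prod 𝓕)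
  have hη4 : 0 < η / 2 / 2 := ENNReal.half_pos (ENNReal.half_pos hη).ne'
  obtain ⟨n, hn⟩ := ((tendsto_lintegral_eLpNorm_sub_normTrunc hp t hfm hfin).eventually_lt_const
    hη4).exists
  have hexp : (0 : ℝ) ≤ 1 / 2 - 1 / p := by
    rw [sub_nonneg]; exact one_div_le_one_div_of_le two_pos hp
  set K : ℝ≥0∞ := (t : ℝ≥0∞) ^ (1 / 2 - 1 / p) with hK
  have hKtop : K ≠ ⊤ := ENNReal.rpow_ne_top_of_nonneg hexp (by simp)
  set δ : ℝ≥0∞ := (η / 2 / 2) ^ (1 / 2 : ℝ) with hδ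
  have hδ0 : δ ≠ 0 := by
    rw [hδ]
    exact (ENNReal.rpow_pos hη4 (by finiteness)).ne'
  obtain ⟨L, hL⟩ := exists_elemGamma_eLpNorm_normTrunc_sub_le (P := P) hp1 (by simp) t hf n
    (ε := δ / (K + 1)) (ENNReal.div_pos hδ0 (by finiteness)).ne'
  refine ⟨L, ?_⟩
  have hgm := stronglyMeasurable_sub_elemGamma (hfm.normTrunc n) L
  have h2 : ∫⁻ s, eLpNorm (fun ω => normTrunc n f (s, ω) - elemGamma L (s, ω)) (ENNReal.ofReal p) P
      ^ 2 ∂lebUpTo t ≤ η / 2 / 2 := by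
    refine (lintegral_eLpNorm_sq_le hp t hgm).trans ?_
    calc _ ≤ (δ / (K + 1) * (K + 1)) ^ 2 := by
          gcongr
          · exact hL
          · exact le_self_add
      _ ≤ δ ^ 2 := by gcongr; rw [mul_comm]; exact ENNReal.mul_div_le
      _ = η / 2 / 2 := by
          rw [hδ, ← ENNReal.rpow_two, ← ENNReal.rpow_mul]; norm_num
  have hm : Measurable fun s =>
      eLpNorm (fun ω => f (s, ω) - normTrunc n f (s, ω)) (ENNReal.ofReal p) P ^ 2 :=
    (measurable_eLpNorm_section (P := P) hp0 (hfm.sub (hfm.normTrunc n))).pow_const 2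
  calc _ ≤ ∫⁻ s, 2 * (eLpNorm (fun ω => f (s, ω) - normTrunc n f (s, ω)) (ENNReal.ofReal p) P ^ 2
        + eLpNorm (fun ω => normTrunc n f (s, ω) - elemGamma L (s, ω)) (ENNReal.ofReal p) P ^ 2)
          ∂lebUpTo t := by
        refine lintegral_mono fun s => ?_
        have h3 := eLpNorm_add_le (μ := P)
          ((hfm.sub (hfm.normTrunc n)).comp_measurable
            (measurable_prodMk_left (x := s))).aestronglyMeasurable
          (hgm.comp_measurable (measurable_prodMk_left (x := s))).aestronglyMeasurable hp1
        have e : ((f - normTrunc n f) ∘ Prod.mk s)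
            + ((fun z => normTrunc n f z - elemGamma L z) ∘ Prod.mk s)
            = fun ω => f (s, ω) - elemGamma L (s, ω) := by
          funext ω
          simp
        rw [e] at h3
        have h4 := ENNReal.rpow_add_le_mul_rpow_add_rpow
          (eLpNorm ((f - normTrunc n f) ∘ Prod.mk s) (ENNReal.ofReal p) P)
          (eLpNorm ((fun z => normTrunc n f z - elemGamma L z) ∘ Prod.mk s) (ENNReal.ofReal p) P)
          (show (1 : ℝ) ≤ 2 by norm_num)
        norm_num at h4
        exact (pow_le_pow_left' h3 2).trans h4
    _ ≤ 2 * (η / 2 / 2 + η / 2 / 2) := by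
        rw [lintegral_const_mul' _ _ (by simp), lintegral_add_left hm]
        gcongr
    _ = η := by
        rw [ENNReal.add_halves]
        exact ENNReal.mul_div_cancel (by simp) (by simp)

end Moment

section MomentInt

variable {Ω : Type w} {mΩ : MeasurableSpace Ω} {P : Measure Ω} {T : ℝ≥0}
  {𝓕 : Filtration ℝ≥0 mΩ}

/-- For `p ≥ 2` the norm of `L²([0, t]; L^p)` dominates that of `L²([0, t] × Ω)`. -/
lemma lintegral_lintegral_sq_le [IsProbabilityMeasure P] {E : Type*} [NormedAddCommGroup E]
    {p : ℝ} (hp : 2 ≤ p) (t : ℝ≥0) {f : ℝ≥0 × Ω → E} (hf : StronglyMeasurable f) :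
    ∫⁻ ω, ∫⁻ s, ‖f (s, ω)‖ₑ ^ 2 ∂lebUpTo t ∂P
      ≤ ∫⁻ s, eLpNorm (fun ω => f (s, ω)) (ENNReal.ofReal p) P ^ 2 ∂lebUpTo t := by
  rw [lintegral_lintegral_swap (f := fun ω s => ‖f (s, ω)‖ₑ ^ 2)
    (((hf.enorm.pow_const 2).comp measurable_swap).aemeasurable)]
  refine lintegral_mono fun s => ?_
  have h := eLpNorm_le_eLpNorm_of_exponent_le (μ := P) (ENNReal.ofReal_le_ofReal hp)
    (hf.comp_measurable (measurable_prodMk_left (x := s))).aestronglyMeasurable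
  have h2 := ENNReal.rpow_le_rpow h two_pos.le
  rw [eLpNorm_ofReal_rpow two_pos] at h2
  simp only [ENNReal.rpow_two] at h2
  exact h2

lemma IsPredictableUpTo.lintegral_eLpNorm_uncurry {E : Type*} [NormedAddCommGroup E] {t : ℝ≥0}
    (Z : ℝ≥0 → Ω → E) (q : ℝ≥0∞) :
    ∫⁻ s, eLpNorm (fun ω => Function.uncurry ((Set.Iic t).indicator Z) (s, ω)) q P ^ 2 ∂lebUpTo t
      = ∫⁻ s, eLpNorm (Z s) q P ^ 2 ∂lebUpTo t := by
  refine lintegral_congr_ae ?_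
  filter_upwards [indicator_ae_eq_lebUpTo t Z] with s hs
  simp only [Function.uncurry_apply_pair]
  rw [hs]

/-- A predictable process in `L²([0, t]; L^p)` is almost surely square integrable in time. -/
lemma IsPredictableUpTo.ae_lintegral_sq_lt_top [IsProbabilityMeasure P] {E : Type*}
    [NormedAddCommGroup E] {p : ℝ} (hp : 2 ≤ p) {t : ℝ≥0} {Z : ℝ≥0 → Ω → E} (hZ : IsPredictableUpTo 𝓕 t Z)
    (hfin : ∫⁻ s, eLpNorm (Z s) (ENNReal.ofReal p) P ^ 2 ∂lebUpTo t < ⊤) :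
    ∀ᵐ ω ∂P, ∫⁻ s, ‖Z s ω‖ₑ ^ 2 ∂lebUpTo t < ⊤ := by
  have hm := hZ.stronglyMeasurable_uncurry
  have h := lintegral_lintegral_sq_le (P := P) hp t hm
  rw [IsPredictableUpTo.lintegral_eLpNorm_uncurry] at h
  filter_upwards [ae_lt_top (hm.enorm.pow_const 2).lintegral_prod_left' (h.trans_lt hfin).ne]
    with ω hω
  refine lt_of_eq_of_lt (lintegral_congr_ae ?_) hω
  filter_upwards [uncurry_indicator_ae_eq t Z ω] with s hs
  rw [hs]

variable {U : Type v} [NormedAddCommGroup U] [InnerProductSpace ℝ U]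
  {V : Type u} [NormedAddCommGroup V] [NormedSpace ℝ V] {W : ℝ≥0 → U → Ω → ℝ}

/-- The elementary integrand cut off at time `t`. -/
noncomputable def ElemTerm.restrictTime (t : ℝ≥0) (e : ElemTerm U V 𝓕) : ElemTerm U V 𝓕 where
  a := e.a
  b := max e.a (min e.b t)
  a_le_b := le_max_left _ _
  A := e.A
  measurable_A := e.measurable_A
  h := e.h
  x := e.x

lemma ElemTerm.eval_restrictTime (t : ℝ≥0) (e : ElemTerm U V 𝓕) (s : ℝ≥0) (ω : Ω) :
    (e.restrictTime t).eval s ω = (Set.Iic t).indicator (fun s => e.eval s ω) s := by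
  by_cases hs : s ≤ t
  · rw [Set.indicator_of_mem (s := Set.Iic t) hs]
    simp only [ElemTerm.eval, ElemTerm.restrictTime]
    classical
    rw [Set.indicator_apply, Set.indicator_apply]
    congr 1
    simp only [Set.mem_prod, Set.mem_Ioc, le_max_iff, le_min_iff, hs, and_true, eq_iff_iff]
    exact ⟨fun h => ⟨⟨h.1.1, h.1.2.resolve_left (not_le.2 h.1.1)⟩, h.2⟩,
      fun h => ⟨⟨h.1.1, Or.inr h.1.2⟩, h.2⟩⟩
  · rw [Set.indicator_of_notMem (s := Set.Iic t) hs]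
    simp only [ElemTerm.eval, ElemTerm.restrictTime]
    refine Set.indicator_of_notMem ?_ _
    simp only [Set.mem_prod, Set.mem_Ioc, le_max_iff, le_min_iff, hs, and_false, or_false]
    exact fun h => absurd h.1.2 (not_le.2 h.1.1)

lemma elemProcess_map_restrictTime (t : ℝ≥0) (L : List (ElemTerm U V 𝓕)) (s : ℝ≥0) (ω : Ω) :
    elemProcess (L.map (ElemTerm.restrictTime t)) s ω
      = (Set.Iic t).indicator (fun s => elemProcess L s ω) s := by
  simp only [elemProcess, List.map_map, Function.comp_def, ElemTerm.eval_restrictTime]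
  by_cases hs : s ∈ Set.Iic t <;> simp [hs]

lemma ElemTerm.integral_restrictTime {t T : ℝ≥0} (htT : t ≤ T) (e : ElemTerm U V 𝓕) (ω : Ω) :
    (e.restrictTime t).integral W T ω = e.integral W t ω := by
  simp only [ElemTerm.integral, ElemTerm.restrictTime]
  congr 1
  rcases le_or_gt e.a t with h | h
  · rw [max_eq_right (le_min e.a_le_b h), min_eq_left ((min_le_right _ _).trans htT),
      min_eq_left (h.trans htT), min_eq_left h]
  · rw [max_eq_left ((min_le_right _ _).trans h.le), min_eq_right (h.le.trans e.a_le_b),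
      min_eq_right h.le]
    simp

lemma elemIntegral_map_restrictTime {t T : ℝ≥0} (htT : t ≤ T) (L : List (ElemTerm U V 𝓕)) :
    elemIntegral W T (L.map (ElemTerm.restrictTime t)) = elemIntegral W t L := by
  funext ω
  simp only [elemIntegral, List.map_map, Function.comp_def, ElemTerm.integral_restrictTime htT]

/-- An integral over `[0, t]` is an integral over `[0, T]` of the integrand cut off at `t`. -/
lemma IsStochIntegral.indicator {t T : ℝ≥0} (htT : t ≤ T) {Z : ℝ≥0 → Ω → GammaRad U V} {I : Ω → V}
    (hI : IsStochIntegral P 𝓕 W t Z I) :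
    IsStochIntegral P 𝓕 W T ((Set.Iic t).indicator Z) I := by
  obtain ⟨L, hL, hLI⟩ := hI
  refine ⟨fun n => (L n).map (ElemTerm.restrictTime t), fun ε hε => ?_, ?_⟩
  · refine (hL ε hε).congr fun n => ?_
    congr 1
    ext ω
    simp only [Set.mem_ofPred_eq]
    rw [lebUpTo_eq_restrict htT, ← lintegral_indicator measurableSet_Iic]
    refine iff_of_eq (congrArg _ (lintegral_congr fun s => ?_))
    rw [elemProcess_map_restrictTime]
    by_cases hs : s ∈ Set.Iic t
    · simp [hs]
    · simp [hs, GammaRad.toCLM_zero, gammaNorm_zero]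
  · simpa only [elemIntegral_map_restrictTime htT] using hLI

lemma IsPredictableUpTo.indicator {E : Type*} [NormedAddCommGroup E] {t T : ℝ≥0} (htT : t ≤ T)
    {Z : ℝ≥0 → Ω → E} (hZ : IsPredictableUpTo 𝓕 t Z) :
    IsPredictableUpTo 𝓕 T ((Set.Iic t).indicator Z) := by
  rw [IsPredictableUpTo, Set.indicator_indicator, Set.inter_eq_right.2 (Set.Iic_subset_Iic.2 htT)]
  exact hZ

lemma lintegral_eLpNorm_sq_indicator {E : Type*} [NormedAddCommGroup E] {t T : ℝ≥0} (htT : t ≤ T)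
    (Z : ℝ≥0 → Ω → E) (q : ℝ≥0∞) :
    ∫⁻ s, eLpNorm ((Set.Iic t).indicator Z s) q P ^ 2 ∂lebUpTo T
      = ∫⁻ s, eLpNorm (Z s) q P ^ 2 ∂lebUpTo t := by
  rw [lebUpTo_eq_restrict htT, ← lintegral_indicator measurableSet_Iic]
  refine lintegral_congr fun s => ?_
  by_cases hs : s ∈ Set.Iic t <;> simp [hs]

variable [IsProbabilityMeasure P] [CompleteSpace U] [CompleteSpace V] [TopologicalSpace.SeparableSpace V]

/-- The moment bound for elementary integrals extends to all integrands in `L²([0, t]; L^p)` by density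
and Fatou's lemma. -/
lemma IsCylindricalWiener.exists_eLpNorm_le (hUMD : IsUMD.{w, u} V)
    (hType : HasTypeTwo V) (hW : IsCylindricalWiener P T 𝓕 W) {p : ℝ} (hp : 2 ≤ p) :
    ∃ C : ℝ≥0, ∀ (t : ℝ≥0) (Z : ℝ≥0 → Ω → GammaRad U V) (I : Ω → V), t ≤ T →
      IsPredictableUpTo 𝓕 t Z → IsStochIntegral P 𝓕 W t Z I →
      ∫⁻ s, eLpNorm (Z s) (ENNReal.ofReal p) P ^ 2 ∂lebUpTo t < ⊤ →
      eLpNorm I (ENNReal.ofReal p) P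
        ≤ C * (∫⁻ s, eLpNorm (Z s) (ENNReal.ofReal p) P ^ 2 ∂lebUpTo t) ^ (1 / 2 : ℝ) := by
  obtain ⟨C, hC⟩ := hW.exists_eLpNorm_elemIntegral_le hUMD hType hp
  have hp0 : 0 < p := by linarith
  have hp1 : 1 ≤ ENNReal.ofReal p := by
    rw [← ENNReal.ofReal_one]; exact ENNReal.ofReal_le_ofReal (by linarith)
  refine ⟨C, fun t Z I ht hZ hI hfin => ?_⟩
  set f := Function.uncurry ((Set.Iic t).indicator Z) with hf
  have hfm : StronglyMeasurable f := hZ.stronglyMeasurable_uncurry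
  have hfint := IsPredictableUpTo.lintegral_eLpNorm_uncurry (P := P) (t := t) Z (ENNReal.ofReal p)
  rw [← hfint] at hfin ⊢
  -- elementary processes approximating `Z` in the mixed norm
  have hex (n : ℕ) := exists_lintegral_eLpNorm_sub_elemGamma_le (P := P) hp t hZ hfin
    (η := ((n : ℝ≥0∞) + 1)⁻¹) (by simp)
  choose L hL using hex
  set D : ℕ → ℝ≥0∞ := fun n =>
    ∫⁻ s, eLpNorm (fun ω => f (s, ω) - elemGamma (L n) (s, ω)) (ENNReal.ofReal p) P ^ 2 ∂lebUpTo t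
  have hDlim : Tendsto D atTop (𝓝 0) := by
    refine tendsto_of_tendsto_of_tendsto_of_le_of_le tendsto_const_nhds
      ((tendsto_add_atTop_iff_nat 1).2 ENNReal.tendsto_inv_nat_nhds_zero) (fun _ => zero_le)
      fun n => ?_
    exact (hL n).trans_eq (by rw [Nat.cast_add, Nat.cast_one])
  have hsq (ε : ℝ≥0∞) (hε : 0 < ε) :
      Tendsto (fun n => P {ω | ε ≤ sqDist t Z (L n) ω}) atTop (𝓝 0) := by
    have hε1 : min ε 1 ≠ 0 := (lt_min hε one_pos).ne'
    have hlim := ENNReal.Tendsto.div_const hDlim (Or.inr hε1)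
    rw [ENNReal.zero_div] at hlim
    refine tendsto_of_tendsto_of_tendsto_of_le_of_le tendsto_const_nhds hlim (fun _ => zero_le)
      fun n => ?_
    have hgm := stronglyMeasurable_sub_elemGamma hfm (L n)
    simp_rw [sqDist_eq_uncurry]
    refine (measure_mono fun ω hω => (min_le_left ε 1).trans hω).trans <|
      (meas_ge_le_lintegral_div (hgm.enorm.pow_const 2).lintegral_prod_left'.aemeasurable
        hε1 (min_lt_of_right_lt ENNReal.one_lt_top).ne).trans ?_
    exact ENNReal.div_le_div_right (lintegral_lintegral_sq_le hp t hgm) _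
  have hconv := hI.tendstoInMeasure hUMD hType hW ht hZ.aestronglyMeasurable_section hsq
  set A := (∫⁻ s, eLpNorm (fun ω => f (s, ω)) (ENNReal.ofReal p) P ^ 2 ∂lebUpTo t) ^ (1 / 2 : ℝ)
  have hbound (n : ℕ) : eLpNorm (elemIntegral W t (L n)) (ENNReal.ofReal p) P
      ≤ C * (A + D n ^ (1 / 2 : ℝ)) := by
    have hgm := stronglyMeasurable_sub_elemGamma hfm (L n)
    refine (hC t (L n) ht).trans ?_
    gcongr
    have h1 := ENNReal.lintegral_Lp_add_le (μ := lebUpTo t) (p := 2)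
      (measurable_eLpNorm_section (P := P) hp0 hfm).aemeasurable
      (measurable_eLpNorm_section (P := P) hp0 hgm).aemeasurable (by norm_num)
    simp only [ENNReal.rpow_two] at h1
    refine le_trans ?_ h1
    gcongr with s
    have e1 : (∫⁻ ω, gammaNorm (elemProcess (L n) s ω) ^ p ∂P) ^ (2 / p)
        = eLpNorm (fun ω => elemGamma (L n) (s, ω)) (ENNReal.ofReal p) P ^ 2 := by
      rw [eLpNorm_ofReal_eq hp0, ← ENNReal.rpow_two, ← ENNReal.rpow_mul]
      simp_rw [gammaNorm_elemProcess]
      congr 1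
      ring
    rw [e1]
    gcongr
    have h2 := eLpNorm_sub_le (μ := P)
      (hfm.comp_measurable (measurable_prodMk_left (x := s))).aestronglyMeasurable
      (hgm.comp_measurable (measurable_prodMk_left (x := s))).aestronglyMeasurable hp1
    refine le_trans (le_of_eq ?_) h2
    congr 1
    funext ω
    simp
  have hlim : Tendsto (fun n => (C : ℝ≥0∞) * (A + D n ^ (1 / 2 : ℝ))) atTop (𝓝 (C * A)) := by
    have h1 := ((ENNReal.continuous_rpow_const (y := 1 / 2)).tendsto 0).comp hDlim
    rw [ENNReal.zero_rpow_of_pos (by norm_num)] at h1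
    have h2 := ENNReal.Tendsto.const_mul (a := (C : ℝ≥0∞)) (h1.const_add A) (Or.inr (by simp))
    simpa using h2
  refine le_of_forall_gt_imp_ge_of_dense fun c hc => ?_
  refine eLpNorm_le_of_tendstoInMeasure ?_ hconv
    fun n => hW.aestronglyMeasurable_elemIntegral ht (L n)
  filter_upwards [hlim.eventually_lt_const hc] with n hn
  exact (hbound n).trans hn.le

/-- Finiteness of the Burkholder–Davis–Gundy type constant. -/
lemma IsCylindricalWiener.bdgConst_lt_top (hUMD : IsUMD.{w, u} V)
    (hType : HasTypeTwo V) (hW : IsCylindricalWiener P T 𝓕 W) {p : ℝ} (hp : 2 ≤ p) :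
    bdgConst V P T 𝓕 W p < ⊤ := by
  obtain ⟨C, hC⟩ := hW.exists_eLpNorm_le hUMD hType hp
  refine lt_of_le_of_lt (b := (C : ℝ≥0∞)) ?_ ENNReal.coe_lt_top
  refine iSup_le fun Z => iSup_le fun hZ => iSup_le fun h0 => iSup_le fun hfin => ?_
  refine ENNReal.div_le_of_le_mul ?_
  exact hC T Z _ le_rfl hZ (hW.isStochIntegral_stochIntegral hUMD hType le_rfl hZ
    (hZ.ae_lintegral_sq_lt_top hp hfin)) hfin

/-- The constant `bdgConst`, a supremum over integrands on `[0, T]`, also bounds integrals over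
`[0, t]`: extend the integrand by zero. Integrands of norm zero, which the supremum leaves out, have
integral zero. -/
lemma IsStochIntegral.eLpNorm_le_bdgConst (hUMD : IsUMD.{w, u} V)
    (hType : HasTypeTwo V) (hW : IsCylindricalWiener P T 𝓕 W) {p : ℝ} (hp : 2 ≤ p) {t : ℝ≥0}
    (ht : t ≤ T) {Z : ℝ≥0 → Ω → GammaRad U V} (hZ : IsPredictableUpTo 𝓕 t Z) {I : Ω → V}
    (hI : IsStochIntegral P 𝓕 W t Z I)
    (hfin : ∫⁻ s, eLpNorm (Z s) (ENNReal.ofReal p) P ^ 2 ∂lebUpTo t < ⊤) :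
    eLpNorm I (ENNReal.ofReal p) P ≤ bdgConst V P T 𝓕 W p
      * (∫⁻ s, eLpNorm (Z s) (ENNReal.ofReal p) P ^ 2 ∂lebUpTo t) ^ (1 / 2 : ℝ) := by
  rcases eq_zero_or_pos (a := ∫⁻ s, eLpNorm (Z s) (ENNReal.ofReal p) P ^ 2 ∂lebUpTo t) with h0 | h0
  · obtain ⟨C, hC⟩ := hW.exists_eLpNorm_le hUMD hType hp
    have h := hC t Z I ht hZ hI hfin
    rw [h0, ENNReal.zero_rpow_of_pos (by norm_num), mul_zero] at h
    exact h.trans zero_le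
  have hZT := hZ.indicator ht
  have hIT := hI.indicator ht
  have hIT' : IsStochIntegral P 𝓕 W T ((Set.Iic t).indicator Z)
      (stochIntegral P 𝓕 W T ((Set.Iic t).indicator Z)) := by
    rw [stochIntegral, dif_pos ⟨I, hIT⟩]
    exact Exists.choose_spec (⟨I, hIT⟩ : ∃ J, IsStochIntegral P 𝓕 W T ((Set.Iic t).indicator Z) J)
  rw [eLpNorm_congr_ae (hIT.ae_eq hUMD hType hW le_rfl hZT.aestronglyMeasurable_section hIT')]
  rw [← lintegral_eLpNorm_sq_indicator ht Z] at h0 hfin ⊢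
  refine (ENNReal.div_le_iff_le_mul (Or.inl ?_) (Or.inl ?_)).1 ?_
  · exact (ENNReal.rpow_pos h0 hfin.ne).ne'
  · exact (ENNReal.rpow_lt_top_of_nonneg (by norm_num) hfin.ne).ne
  · exact le_iSup_of_le _ (le_iSup_of_le hZT (le_iSup_of_le h0 (le_iSup_of_le hfin le_rfl)))

end MomentInt

/-! ### Minkowski's integral inequality -/

/-- Minkowski's integral inequality `‖∫ f_s ds‖_{L^p} ≤ ∫ ‖f_s‖_{L^p} ds`. Hölder's inequality gives
`∫ J_n^p ≤ N (∫ J_n^p)^{1-1/p}` for `J = ∫ f_s ds`, `J_n = min J n` and `N` the right-hand side; the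
truncation makes it possible to divide. -/
lemma lintegral_rpow_lintegral_le {α β : Type*} {mα : MeasurableSpace α} {mβ : MeasurableSpace β}
    {μ : Measure α} [SFinite μ] {ν : Measure β} [IsFiniteMeasure ν] {f : α × β → ℝ≥0∞}
    (hf : Measurable f) {p : ℝ} (hp : 1 < p) :
    (∫⁻ y, (∫⁻ x, f (x, y) ∂μ) ^ p ∂ν) ^ (1 / p)
      ≤ ∫⁻ x, (∫⁻ y, f (x, y) ^ p ∂ν) ^ (1 / p) ∂μ := by
  have hp0 : 0 < p := by linarith
  have hpq := Real.HolderConjugate.conjExponent hp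
  set q := p.conjExponent with hq
  set J : β → ℝ≥0∞ := fun y => ∫⁻ x, f (x, y) ∂μ with hJ
  have hJm : Measurable J := hf.lintegral_prod_left'
  set N := ∫⁻ x, (∫⁻ y, f (x, y) ^ p ∂ν) ^ (1 / p) ∂μ with hN
  have htrunc (n : ℕ) : ∫⁻ y, (min (J y) n) ^ p ∂ν ≤ N ^ p := by
    set x := ∫⁻ y, (min (J y) n) ^ p ∂ν with hx
    have hxtop : x ≠ ⊤ := by
      refine ne_top_of_le_ne_top (b := ∫⁻ _, (n : ℝ≥0∞) ^ p ∂ν) ?_ (lintegral_mono fun y => ?_)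
      · rw [lintegral_const]; finiteness
      · gcongr; exact min_le_right _ _
    have hgm : Measurable fun y => (min (J y) n) ^ (p - 1) :=
      (hJm.min measurable_const).pow_const _
    have hmain : x ≤ N * x ^ (1 / q) := by
      calc x ≤ ∫⁻ y, J y * (min (J y) n) ^ (p - 1) ∂ν := by
            refine lintegral_mono fun y => ?_
            dsimp only
            conv_lhs => rw [show p = 1 + (p - 1) by ring,
              ENNReal.rpow_add_of_nonneg _ _ zero_le_one (by linarith), ENNReal.rpow_one]
            gcongr
            exact min_le_left _ _
        _ = ∫⁻ y, ∫⁻ x, f (x, y) * (min (J y) n) ^ (p - 1) ∂μ ∂ν := by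
            refine lintegral_congr fun y => ?_
            exact (lintegral_mul_const _ (hf.comp measurable_prodMk_right)).symm
        _ = ∫⁻ x, ∫⁻ y, f (x, y) * (min (J y) n) ^ (p - 1) ∂ν ∂μ :=
            lintegral_lintegral_swap
              (((hf.comp measurable_swap).mul (hgm.comp measurable_fst)).aemeasurable)
        _ ≤ ∫⁻ z, (∫⁻ y, f (z, y) ^ p ∂ν) ^ (1 / p) * x ^ (1 / q) ∂μ := by
            refine lintegral_mono fun z => ?_
            refine (ENNReal.lintegral_mul_le_Lp_mul_Lq ν hpq
              (hf.comp measurable_prodMk_left).aemeasurable hgm.aemeasurable).trans_eq ?_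
            congr 2
            refine lintegral_congr fun y => ?_
            rw [← ENNReal.rpow_mul, hpq.sub_one_mul_conj]
        _ = N * x ^ (1 / q) := lintegral_mul_const _ <| by
            exact ((hf.pow_const p).lintegral_prod_right').pow_const _
    rcases eq_or_ne x 0 with h0 | h0
    · simp [h0]
    have hsplit : x = x ^ (1 / p) * x ^ (1 / q) := by
      rw [← ENNReal.rpow_add _ _ h0 hxtop, one_div, one_div, hpq.inv_add_inv_eq_one,
        ENNReal.rpow_one]
    have hle : x ^ (1 / p) ≤ N := by
      have h1 : x ^ (1 / p) * x ^ (1 / q) ≤ N * x ^ (1 / q) := hsplit ▸ hmain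
      have hne : x ^ (1 / q) ≠ ⊤ :=
        ENNReal.rpow_ne_top_of_nonneg (by have := hpq.symm.pos; positivity) hxtop
      exact (ENNReal.mul_le_mul_iff_left
        (ENNReal.rpow_pos (pos_iff_ne_zero.2 h0) hxtop).ne' hne).1 h1
    calc x = (x ^ (1 / p)) ^ p := by
          rw [← ENNReal.rpow_mul, one_div, inv_mul_cancel₀ hp0.ne', ENNReal.rpow_one]
      _ ≤ N ^ p := by gcongr
  have hsup : ∫⁻ y, J y ^ p ∂ν ≤ N ^ p := by
    have e (y : β) : J y ^ p = ⨆ n : ℕ, (min (J y) n) ^ p := by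
      refine le_antisymm ?_ (iSup_le fun n => by gcongr; exact min_le_left _ _)
      have h1 : Tendsto (fun n : ℕ => (min (J y) (n : ℝ≥0∞)) ^ p) atTop (𝓝 (J y ^ p)) := by
        refine ((ENNReal.continuous_rpow_const (y := p)).tendsto _).comp ?_
        have := (tendsto_const_nhds (x := J y)).min ENNReal.tendsto_nat_nhds_top
        simpa using this
      exact le_of_tendsto' h1 fun n => le_iSup (fun n : ℕ => (min (J y) (n : ℝ≥0∞)) ^ p) n
    simp_rw [e]
    rw [lintegral_iSup (fun n => (hJm.min measurable_const).pow_const _)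
      (fun m n hmn y => by dsimp only; gcongr)]
    exact iSup_le htrunc
  calc _ ≤ (N ^ p) ^ (1 / p) := by gcongr
    _ = N := by rw [← ENNReal.rpow_mul, mul_one_div_cancel hp0.ne', ENNReal.rpow_one]

/-! ### The Gronwall inequality with a weakly singular kernel -/

/-- The beta integral, rescaled to `[0, t]`. -/
lemma lintegral_beta_lebUpTo {a b : ℝ} (ha : 0 < a) (hb : 0 < b) {t : ℝ≥0} (ht : 0 < t) :
    ∫⁻ s, ENNReal.ofReal (((t : ℝ) - s) ^ (a - 1)) * ENNReal.ofReal ((s : ℝ) ^ (b - 1)) ∂lebUpTo t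
      = ENNReal.ofReal (Real.Gamma b * Real.Gamma a / Real.Gamma (b + a) * (t : ℝ) ^ (a + b - 1)) := by
  have ht' : (0 : ℝ) < t := ht
  have himg : (fun x : ℝ => (t : ℝ) * x) '' Set.Ioo 0 1 = Set.Ioo 0 (t : ℝ) := by
    rw [Set.image_mul_left_Ioo ht']
    simp
  have hB := beta_pos hb ha
  rw [lintegral_lebUpTo, ← himg, lintegral_image_eq_lintegral_abs_deriv_mul (f' := fun _ => (t : ℝ))
    measurableSet_Ioo (fun x _ => by
      simpa using ((hasDerivAt_id x).const_mul (t : ℝ)).hasDerivWithinAt)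
    (fun x _ y _ h => mul_left_cancel₀ ht'.ne' h)]
  calc _ = ∫⁻ x in Set.Ioo (0 : ℝ) 1, ENNReal.ofReal (beta b a * (t : ℝ) ^ (a + b - 1))
        * ENNReal.ofReal (1 / beta b a * x ^ (b - 1) * (1 - x) ^ (a - 1)) := by
        refine setLIntegral_congr_fun measurableSet_Ioo fun x hx => ?_
        have h0 : 0 < (t : ℝ) * x := mul_pos ht' hx.1
        have h1 : 0 < 1 - x := by linarith [hx.2]
        rw [Real.coe_toNNReal _ h0.le, ← ENNReal.ofReal_mul (by
            rw [show (t : ℝ) - t * x = t * (1 - x) by ring]; positivity),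
          ← ENNReal.ofReal_mul (abs_nonneg _), ← ENNReal.ofReal_mul (by positivity),
          abs_of_pos ht', show (t : ℝ) - t * x = t * (1 - x) by ring,
          Real.mul_rpow ht'.le h1.le, Real.mul_rpow ht'.le hx.1.le,
          show a + b - 1 = 1 + (a - 1) + (b - 1) by ring, Real.rpow_add ht', Real.rpow_add ht',
          Real.rpow_one]
        congr 1
        field_simp
    _ = ENNReal.ofReal (beta b a * (t : ℝ) ^ (a + b - 1)) * 1 := by
        rw [lintegral_const_mul' _ _ (by simp), ← lintegral_betaPDF, lintegral_betaPDF_eq_one hb ha]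
    _ = _ := by rw [mul_one]; rfl

/-- The weakly singular kernel has total mass `t^r / r`. -/
lemma lintegral_rpow_sub_lebUpTo {r : ℝ} (hr : 0 < r) (t : ℝ≥0) :
    ∫⁻ s, ENNReal.ofReal (((t : ℝ) - s) ^ (r - 1)) ∂lebUpTo t
      = ENNReal.ofReal ((t : ℝ) ^ r / r) := by
  rcases eq_zero_or_pos t with rfl | ht
  · have h : lebUpTo 0 = 0 := by
      rw [← Measure.measure_univ_eq_zero, lebUpTo_univ]; simp
    rw [h]
    simp [Real.zero_rpow hr.ne']
  have h := lintegral_beta_lebUpTo hr one_pos ht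
  simp only [sub_self, Real.rpow_zero, ENNReal.ofReal_one, mul_one, Real.Gamma_one, one_mul,
    add_sub_cancel_right] at h
  rw [h, add_comm, Real.Gamma_add_one hr.ne']
  have := (Real.Gamma_pos_of_pos hr).ne'
  congr 1
  field_simp

/-- Log-convexity of the Gamma function bounds `Γ(a) / Γ(a + r)`. -/
lemma Gamma_le_mul_Gamma_add {a r : ℝ} (ha : 1 ≤ a) (hr : 0 < r) (hr1 : r ≤ 1) :
    Real.Gamma a ≤ 2 * a ^ (-r) * Real.Gamma (a + r) := by
  have ha0 : 0 < a := by linarith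
  have hG := Real.Gamma_pos_of_pos (show 0 < a + r by linarith)
  have hkey : Real.Gamma (a + 1) ≤ Real.Gamma (a + r) * (a + r) ^ (1 - r) := by
    rcases hr1.eq_or_lt with rfl | hr1
    · simp
    have h := Real.Gamma_mul_add_mul_le_rpow_Gamma_mul_rpow_Gamma (s := a + r) (t := a + r + 1)
      (a := r) (b := 1 - r) (by linarith) (by linarith) hr (by linarith) (by ring)
    rw [show r * (a + r) + (1 - r) * (a + r + 1) = a + 1 by ring,
      Real.Gamma_add_one (by linarith : a + r ≠ 0), Real.mul_rpow (by linarith) hG.le,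
      mul_left_comm, ← Real.rpow_add hG, show r + (1 - r) = 1 by ring, Real.rpow_one, mul_comm] at h
    exact h
  rw [Real.Gamma_add_one ha0.ne'] at hkey
  have h2 : (a + r) ^ (1 - r) ≤ 2 * a ^ (1 - r) := by
    calc (a + r) ^ (1 - r) ≤ (2 * a) ^ (1 - r) :=
          Real.rpow_le_rpow (by linarith) (by linarith) (by linarith)
      _ = 2 ^ (1 - r) * a ^ (1 - r) := Real.mul_rpow two_pos.le ha0.le
      _ ≤ 2 ^ (1 : ℝ) * a ^ (1 - r) := by
          gcongr
          · norm_num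
          · linarith
      _ = _ := by rw [Real.rpow_one]
  have h3 : a * Real.Gamma a ≤ a * (2 * a ^ (-r) * Real.Gamma (a + r)) := by
    calc a * Real.Gamma a ≤ Real.Gamma (a + r) * (2 * a ^ (1 - r)) := hkey.trans (by gcongr)
      _ = _ := by
        rw [show 1 - r = 1 + -r by ring, Real.rpow_add ha0, Real.rpow_one]; ring
  exact le_of_mul_le_mul_left h3 ha0

/-- The series defining the generalized exponential function converges. -/
lemma summable_pow_div_Gamma {r : ℝ} (hr : 0 < r) (hr1 : r ≤ 1) (x : ℝ) :
    Summable fun n : ℕ => x ^ n / Real.Gamma (n * r + 1) := by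
  refine summable_of_ratio_norm_eventually_le (r := 1 / 2) (by norm_num) ?_
  have hlim : Tendsto (fun n : ℕ => |x| * (2 * ((n : ℝ) * r + 1) ^ (-r))) atTop (𝓝 (|x| * (2 * 0))) := by
    refine ((((tendsto_rpow_neg_atTop hr).comp ?_).const_mul 2).const_mul |x|)
    exact tendsto_atTop_add_const_right _ _
      (tendsto_natCast_atTop_atTop.atTop_mul_const hr)
  rw [mul_zero, mul_zero] at hlim
  filter_upwards [hlim.eventually_lt_const (show (0 : ℝ) < 1 / 2 by norm_num)] with n hn
  have ha : (1 : ℝ) ≤ n * r + 1 := by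
    have : (0 : ℝ) ≤ n * r := by positivity
    linarith
  have h := Gamma_le_mul_Gamma_add ha hr hr1
  have e : ((n + 1 : ℕ) : ℝ) * r + 1 = n * r + 1 + r := by push_cast; ring
  have hG1 := Real.Gamma_pos_of_pos (show (0 : ℝ) < n * r + 1 by linarith)
  have hG2 := Real.Gamma_pos_of_pos (show (0 : ℝ) < n * r + 1 + r by linarith)
  rw [e, norm_div, norm_div, Real.norm_of_nonneg hG1.le, Real.norm_of_nonneg hG2.le, norm_pow,
    norm_pow, Real.norm_eq_abs, ← mul_div_assoc, div_le_div_iff₀ hG2 hG1, pow_succ]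
  calc |x| ^ n * |x| * Real.Gamma (n * r + 1)
      ≤ |x| ^ n * |x| * (2 * ((n : ℝ) * r + 1) ^ (-r) * Real.Gamma (n * r + 1 + r)) := by gcongr
    _ = |x| ^ n * (|x| * (2 * ((n : ℝ) * r + 1) ^ (-r))) * Real.Gamma (n * r + 1 + r) := by ring
    _ ≤ |x| ^ n * (1 / 2) * Real.Gamma (n * r + 1 + r) := by gcongr
    _ = _ := by ring

/-- A Gronwall inequality for running suprema and the kernel `(t - s)^{r-1}`: iterating the
hypothesis `n` times produces the first `n` terms of the Mittag-Leffler series and a remainder that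
is the `n`-th term. -/
lemma sq_le_of_le_add_lintegral_rpow {r b : ℝ} (hr : 0 < r) (hr1 : r ≤ 1) (hb : 0 ≤ b) {T : ℝ≥0}
    {a M : ℝ≥0∞} (hM : M ≠ ⊤) {e : ℝ≥0 → ℝ≥0∞} (heM : ∀ t ≤ T, e t ^ 2 ≤ M)
    (he : ∀ t ≤ T, e t ^ 2 ≤ a + ENNReal.ofReal b *
      ∫⁻ s, ENNReal.ofReal (((t : ℝ) - s) ^ (r - 1)) * (⨆ u ≤ s, e u) ^ 2 ∂lebUpTo t) :
    ∀ t ≤ T, e t ^ 2 ≤ a * ENNReal.ofReal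
      (∑' n : ℕ, (b * T ^ r * Real.Gamma r) ^ n / Real.Gamma (n * r + 1)) := by
  have hGr := Real.Gamma_pos_of_pos hr
  have hGn (n : ℕ) : 0 < Real.Gamma (n * r + 1) := Real.Gamma_pos_of_pos (by positivity)
  set c : ℕ → ℝ := fun n => (b * Real.Gamma r) ^ n / Real.Gamma (n * r + 1) with hc
  have hc0 (n : ℕ) : 0 ≤ c n := by have := hGn n; positivity
  set g : ℕ → ℝ≥0 → ℝ≥0∞ := fun n t => ENNReal.ofReal (c n * (t : ℝ) ^ (n * r)) with hg
  have hgmono (n : ℕ) {s t : ℝ≥0} (h : s ≤ t) : g n s ≤ g n t := by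
    refine ENNReal.ofReal_le_ofReal ?_
    have := hc0 n
    have h' : (s : ℝ) ≤ t := h
    gcongr
  -- one application of the integral operator raises the index by one
  have hstep (n : ℕ) (t : ℝ≥0) : ENNReal.ofReal b *
      ∫⁻ s, ENNReal.ofReal (((t : ℝ) - s) ^ (r - 1)) * g n s ∂lebUpTo t ≤ g (n + 1) t := by
    rcases eq_zero_or_pos t with rfl | ht
    · have h : lebUpTo 0 = 0 := by
        rw [← Measure.measure_univ_eq_zero, lebUpTo_univ]; simp
      simp [h]
    have h := lintegral_beta_lebUpTo hr (show (0 : ℝ) < n * r + 1 by positivity) ht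
    simp only [add_sub_cancel_right] at h
    have e1 : ∫⁻ s, ENNReal.ofReal (((t : ℝ) - s) ^ (r - 1)) * g n s ∂lebUpTo t
        = ENNReal.ofReal (c n) * ∫⁻ s, ENNReal.ofReal (((t : ℝ) - s) ^ (r - 1)) *
          ENNReal.ofReal ((s : ℝ) ^ (n * r)) ∂lebUpTo t := by
      rw [← lintegral_const_mul' _ _ (by simp)]
      refine lintegral_congr fun s => ?_
      simp only [hg]
      rw [ENNReal.ofReal_mul (hc0 n)]
      ring
    rw [e1, h, ← ENNReal.ofReal_mul (hc0 n), ← ENNReal.ofReal_mul hb]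
    refine le_of_eq (congrArg _ ?_)
    simp only [hc]
    rw [show ((n + 1 : ℕ) : ℝ) * r + 1 = n * r + 1 + r by push_cast; ring,
      show r + (n * r + 1) - 1 = ((n + 1 : ℕ) : ℝ) * r by push_cast; ring, pow_succ]
    have := (hGn n).ne'
    field_simp
  have hiter (n : ℕ) : ∀ t ≤ T, e t ^ 2 ≤ a * ∑ k ∈ Finset.range n, g k t + M * g n t := by
    induction n with
    | zero =>
      intro t ht
      simpa [hg, hc] using heM t ht
    | succ n ih =>
      intro t ht
      refine (he t ht).trans ?_
      have hsup : ∀ s ≤ T, (⨆ u ≤ s, e u) ^ 2 ≤ a * ∑ k ∈ Finset.range n, g k s + M * g n s := by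
        intro s hs
        rw [← ENNReal.rpow_two, ← ENNReal.le_rpow_inv_iff two_pos]
        refine iSup₂_le fun u hu => ?_
        rw [ENNReal.le_rpow_inv_iff two_pos, ENNReal.rpow_two]
        refine (ih u (hu.trans hs)).trans ?_
        gcongr with k
        · exact hgmono k hu
        · exact hgmono n hu
      have hgm (k : ℕ) : Measurable (g k) := by
        simp only [hg]; fun_prop
      have hkm : Measurable fun s : ℝ≥0 => ENNReal.ofReal (((t : ℝ) - s) ^ (r - 1)) := by fun_prop
      have hkg (k : ℕ) : Measurable fun s : ℝ≥0 =>
        ENNReal.ofReal (((t : ℝ) - s) ^ (r - 1)) * g k s := hkm.mul (hgm k)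
      have hint : ENNReal.ofReal b * ∫⁻ s, ENNReal.ofReal (((t : ℝ) - s) ^ (r - 1)) *
          (⨆ u ≤ s, e u) ^ 2 ∂lebUpTo t
          ≤ a * ∑ k ∈ Finset.range n, g (k + 1) t + M * g (n + 1) t := by
        calc _ ≤ ENNReal.ofReal b * ∫⁻ s, (∑ k ∈ Finset.range n,
              a * (ENNReal.ofReal (((t : ℝ) - s) ^ (r - 1)) * g k s))
              + M * (ENNReal.ofReal (((t : ℝ) - s) ^ (r - 1)) * g n s) ∂lebUpTo t := by
              refine mul_le_mul_right ?_ _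
              refine lintegral_mono_ae (ae_lebUpTo fun s _ hs => ?_)
              refine (mul_le_mul_right (hsup s (hs.le.trans ht)) _).trans_eq ?_
              rw [mul_add, ← Finset.mul_sum, ← Finset.mul_sum]
              ring
          _ = a * ∑ k ∈ Finset.range n, ENNReal.ofReal b *
                ∫⁻ s, ENNReal.ofReal (((t : ℝ) - s) ^ (r - 1)) * g k s ∂lebUpTo t
              + M * (ENNReal.ofReal b *
                ∫⁻ s, ENNReal.ofReal (((t : ℝ) - s) ^ (r - 1)) * g n s ∂lebUpTo t) := by
              rw [lintegral_add_right _ ((hkg n).const_mul M),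
                lintegral_finsetSum _ fun k _ => (hkg k).const_mul a,
                lintegral_const_mul _ (hkg n)]
              simp_rw [lintegral_const_mul a (hkg _)]
              rw [mul_add, ← Finset.mul_sum, ← Finset.mul_sum]
              ring
          _ ≤ _ := by
              gcongr with k
              · exact hstep k t
              · exact hstep n t
      calc _ ≤ a + (a * ∑ k ∈ Finset.range n, g (k + 1) t + M * g (n + 1) t) := by gcongr
        _ = _ := by
          rw [Finset.sum_range_succ' (fun k => g k t)]
          have h0 : g 0 t = 1 := by simp [hg, hc]
          rw [h0]
          ring
  have hsum := summable_pow_div_Gamma hr hr1 (b * T ^ r * Real.Gamma r)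
  have hterm (n : ℕ) : g n T = ENNReal.ofReal
      ((b * T ^ r * Real.Gamma r) ^ n / Real.Gamma (n * r + 1)) := by
    simp only [hg, hc]
    rw [mul_comm (n : ℝ) r, Real.rpow_mul (by positivity), Real.rpow_natCast]
    congr 1
    rw [mul_pow, mul_pow, mul_pow]
    ring
  have hnonneg (n : ℕ) : 0 ≤ (b * T ^ r * Real.Gamma r) ^ n / Real.Gamma (n * r + 1) := by
    have := hGn n; positivity
  intro t ht
  have hlim : Tendsto (fun n => a * ENNReal.ofReal (∑' n : ℕ,
      (b * T ^ r * Real.Gamma r) ^ n / Real.Gamma (n * r + 1)) + M * g n T) atTop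
      (𝓝 (a * ENNReal.ofReal (∑' n : ℕ,
        (b * T ^ r * Real.Gamma r) ^ n / Real.Gamma (n * r + 1)) + M * ENNReal.ofReal 0)) := by
    simp_rw [hterm]
    refine (ENNReal.Tendsto.const_mul ?_ (Or.inr hM)).const_add _
    exact (ENNReal.continuous_ofReal.tendsto 0).comp hsum.tendsto_atTop_zero
  rw [ENNReal.ofReal_zero, mul_zero, add_zero] at hlim
  refine ge_of_tendsto' hlim fun n => (hiter n t ht).trans ?_
  gcongr
  · calc ∑ k ∈ Finset.range n, g k t ≤ ∑ k ∈ Finset.range n, g k T :=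
          Finset.sum_le_sum fun k _ => hgmono k ht
      _ = ENNReal.ofReal (∑ k ∈ Finset.range n,
          (b * T ^ r * Real.Gamma r) ^ k / Real.Gamma (k * r + 1)) := by
          rw [ENNReal.ofReal_sum_of_nonneg fun k _ => hnonneg k]
          exact Finset.sum_congr rfl fun k _ => hterm k
      _ ≤ _ := ENNReal.ofReal_le_ofReal (hsum.sum_le_tsum _ fun k _ => hnonneg k)
  · exact hgmono n ht

/-! ### From integral inequalities to the constants of the estimates -/

section Constants

variable {r : ℝ} {S : ℝ≥0 → ℝ≥0∞}

lemma ofReal_mul_div_rpow (y : ℝ) (c : ℝ≥0∞) (ϑ : ℝ) {s t : ℝ≥0} (hst : s < t) :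
    ENNReal.ofReal y * c / ENNReal.ofReal (((t : ℝ) - s) ^ ϑ)
      = ENNReal.ofReal y * (ENNReal.ofReal (((t : ℝ) - s) ^ (-ϑ)) * c) := by
  have h : (0 : ℝ) < t - s := sub_pos.2 (by exact_mod_cast hst)
  rw [Real.rpow_neg h.le, ENNReal.ofReal_inv_of_pos (Real.rpow_pos_of_pos h _), div_eq_mul_inv]
  ring

lemma ofReal_mul_div_rpow_half_sq (z : ℝ) (c : ℝ≥0∞) (ϑ : ℝ) {s t : ℝ≥0} (hst : s < t) :
    (ENNReal.ofReal z * c / ENNReal.ofReal (((t : ℝ) - s) ^ (ϑ / 2))) ^ 2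
      = ENNReal.ofReal z ^ 2 * (ENNReal.ofReal (((t : ℝ) - s) ^ (-ϑ)) * c ^ 2) := by
  have h : (0 : ℝ) < t - s := sub_pos.2 (by exact_mod_cast hst)
  rw [ofReal_mul_div_rpow z c _ hst, mul_pow, mul_pow,
    ← ENNReal.ofReal_pow (Real.rpow_nonneg h.le (-(ϑ / 2))), ← Real.rpow_natCast (_ ^ _),
    ← Real.rpow_mul h.le]
  congr 4
  push_cast
  ring

/-- Cauchy–Schwarz with respect to the singular kernel. -/
lemma lintegral_kernel_mul_le (hr : 0 < r) (hS : Measurable S) (t : ℝ≥0) :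
    ∫⁻ s, ENNReal.ofReal (((t : ℝ) - s) ^ (r - 1)) * S s ∂lebUpTo t
      ≤ ENNReal.ofReal (√((t : ℝ) ^ r / r)) *
        (∫⁻ s, ENNReal.ofReal (((t : ℝ) - s) ^ (r - 1)) * S s ^ 2 ∂lebUpTo t) ^ (1 / 2 : ℝ) := by
  have hkm : Measurable fun s : ℝ≥0 => ENNReal.ofReal (((t : ℝ) - s) ^ (r - 1)) := by fun_prop
  have h := ENNReal.lintegral_mul_le_Lp_mul_Lq (lebUpTo t) Real.HolderConjugate.two_two
    (hkm.pow_const (1 / 2 : ℝ)).aemeasurable ((hkm.pow_const (1 / 2 : ℝ)).mul hS).aemeasurable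
  have hhalf (c : ℝ≥0∞) : (c ^ (1 / 2 : ℝ)) ^ (2 : ℝ) = c := by
    rw [← ENNReal.rpow_mul]; norm_num
  simp only [Pi.mul_apply, ENNReal.mul_rpow_of_nonneg _ _ two_pos.le, hhalf] at h
  have hsq (c : ℝ≥0∞) : c ^ (1 / 2 : ℝ) * c ^ (1 / 2 : ℝ) = c := by
    rw [← sq, ← ENNReal.rpow_two, hhalf]
  simp only [← mul_assoc, hsq, ENNReal.rpow_two] at h
  refine h.trans_eq ?_
  rw [lintegral_rpow_sub_lebUpTo hr, ENNReal.ofReal_rpow_of_nonneg (by positivity) (by norm_num),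
    Real.sqrt_eq_rpow]

lemma lintegral_kernel_mul_const_le (hr : 0 < r) {t : ℝ≥0} {T : ℝ≥0} (ht : t ≤ T) {m : ℝ≥0∞}
    (hSm : ∀ s ≤ T, S s ≤ m) :
    ∫⁻ s, ENNReal.ofReal (((t : ℝ) - s) ^ (r - 1)) * S s ∂lebUpTo t
      ≤ ENNReal.ofReal ((T : ℝ) ^ r / r) * m := by
  have hkm : Measurable fun s : ℝ≥0 => ENNReal.ofReal (((t : ℝ) - s) ^ (r - 1)) := by fun_prop
  calc _ ≤ ∫⁻ s, ENNReal.ofReal (((t : ℝ) - s) ^ (r - 1)) * m ∂lebUpTo t :=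
        lintegral_mono_ae (ae_lebUpTo fun s _ hs =>
          mul_le_mul_right (hSm s (hs.le.trans ht)) _)
    _ = ENNReal.ofReal ((t : ℝ) ^ r / r) * m := by
        rw [lintegral_mul_const _ hkm, lintegral_rpow_sub_lebUpTo hr]
    _ ≤ _ := by
        have ht' : (t : ℝ) ≤ T := ht
        gcongr

/-- The square of the a priori constant as a series in the form which the Gronwall inequality
produces. -/
lemma sq_aprioriConst {T ϑ y z Υ : ℝ} (hT : 0 ≤ T) (hϑ : ϑ < 1) :
    aprioriConst T ϑ y z Υ ^ 2 = 2 * ∑' n : ℕ,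
      (2 * (y * √(T ^ (1 - ϑ) / (1 - ϑ)) + z * Υ) ^ 2 * T ^ (1 - ϑ) * Real.Gamma (1 - ϑ)) ^ n
        / Real.Gamma (n * (1 - ϑ) + 1) := by
  have hr : 0 < 1 - ϑ := by linarith
  have hτ : 0 ≤ T ^ (1 - ϑ) := by positivity
  have hx : (y * √2 * T ^ (1 - ϑ) / √(1 - ϑ) + z * Υ * √(2 * T ^ (1 - ϑ))) ^ 2
      = 2 * (y * √(T ^ (1 - ϑ) / (1 - ϑ)) + z * Υ) ^ 2 * T ^ (1 - ϑ) := by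
    have e : y * √2 * T ^ (1 - ϑ) / √(1 - ϑ) + z * Υ * √(2 * T ^ (1 - ϑ))
        = √2 * √(T ^ (1 - ϑ)) * (y * √(T ^ (1 - ϑ) / (1 - ϑ)) + z * Υ) := by
      rw [Real.sqrt_mul two_pos.le, Real.sqrt_div hτ]
      nth_rewrite 1 [← Real.mul_self_sqrt hτ]
      ring
    rw [e, mul_pow, mul_pow, Real.sq_sqrt two_pos.le, Real.sq_sqrt hτ]
    ring
  rw [aprioriConst, henryE, mul_pow, Real.sq_sqrt two_pos.le, Real.sq_sqrt]
  · congr 1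
    refine tsum_congr fun n => ?_
    rw [pow_mul, hx, ← mul_pow]
  · refine tsum_nonneg fun n => ?_
    rw [pow_mul, hx]
    have := Real.Gamma_pos_of_pos hr
    have := Real.Gamma_pos_of_pos (show 0 < n * (1 - ϑ) + 1 by positivity)
    positivity

variable {T : ℝ≥0} {ϑ y z Υ : ℝ} {e ρ : ℝ≥0 → ℝ≥0∞} {dY dZ : ℝ≥0 → ℝ≥0 → ℝ≥0∞}

lemma lintegral_le_of_le_kernel {t : ℝ≥0} {g : ℝ≥0 → ℝ≥0∞}
    (hY : ∀ s, 0 < s → s < t →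
      g s ≤ ENNReal.ofReal y * S s / ENNReal.ofReal (((t : ℝ) - s) ^ ϑ)) :
    ∫⁻ s, g s ∂lebUpTo t ≤ ENNReal.ofReal y *
      ∫⁻ s, ENNReal.ofReal (((t : ℝ) - s) ^ ((1 - ϑ) - 1)) * S s ∂lebUpTo t := by
  rw [← lintegral_const_mul' _ _ (by simp)]
  refine lintegral_mono_ae (ae_lebUpTo fun s hs0 hst => ?_)
  refine (hY s hs0 hst).trans_eq ?_
  rw [ofReal_mul_div_rpow _ _ _ hst, show (1 - ϑ) - 1 = -ϑ by ring]

lemma lintegral_sq_le_of_le_kernel {t : ℝ≥0} {g : ℝ≥0 → ℝ≥0∞}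
    (hZ : ∀ s, 0 < s → s < t →
      g s ≤ ENNReal.ofReal z * S s / ENNReal.ofReal (((t : ℝ) - s) ^ (ϑ / 2))) :
    ∫⁻ s, g s ^ 2 ∂lebUpTo t ≤ ENNReal.ofReal z ^ 2 *
      ∫⁻ s, ENNReal.ofReal (((t : ℝ) - s) ^ ((1 - ϑ) - 1)) * S s ^ 2 ∂lebUpTo t := by
  rw [← lintegral_const_mul' _ _ (by finiteness)]
  refine lintegral_mono_ae (ae_lebUpTo fun s hs0 hst => ?_)
  refine (pow_le_pow_left' (hZ s hs0 hst) 2).trans_eq ?_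
  rw [ofReal_mul_div_rpow_half_sq _ _ _ hst, show (1 - ϑ) - 1 = -ϑ by ring]

/-- The square root of a quadratic kernel bound. -/
lemma rpow_half_le_of_le_sq_mul {a J : ℝ≥0∞} {c : ℝ} (h : a ≤ ENNReal.ofReal c ^ 2 * J) :
    a ^ (1 / 2 : ℝ) ≤ ENNReal.ofReal c * J ^ (1 / 2 : ℝ) := by
  refine (ENNReal.rpow_le_rpow h (by norm_num)).trans_eq ?_
  rw [ENNReal.mul_rpow_of_nonneg _ _ (by norm_num), ← ENNReal.rpow_two, ← ENNReal.rpow_mul]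
  norm_num

/-- The upper estimate: Cauchy–Schwarz turns the drift term into the same quadratic form as the
diffusion term, and the Gronwall inequality applies to the squared running supremum. -/
lemma iSup_le_aprioriConst_mul (hϑ0 : 0 ≤ ϑ) (hϑ : ϑ < 1) (hy : 0 ≤ y) (hz : 0 ≤ z) (hΥ : 0 ≤ Υ)
    (hfin : (⨆ t ≤ T, e t) < ⊤)
    (hY : ∀ t ≤ T, ∀ s, 0 < s → s < t →
      dY t s ≤ ENNReal.ofReal y * (⨆ u ≤ s, e u) / ENNReal.ofReal (((t : ℝ) - s) ^ ϑ))
    (hZ : ∀ t ≤ T, ∀ s, 0 < s → s < t →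
      dZ t s ≤ ENNReal.ofReal z * (⨆ u ≤ s, e u) / ENNReal.ofReal (((t : ℝ) - s) ^ (ϑ / 2)))
    (he : ∀ t ≤ T, e t ≤ ρ t + (∫⁻ s, dY t s ∂lebUpTo t
      + ENNReal.ofReal Υ * (∫⁻ s, dZ t s ^ 2 ∂lebUpTo t) ^ (1 / 2 : ℝ))) :
    (⨆ t ≤ T, e t) ≤ ENNReal.ofReal (aprioriConst T ϑ y z Υ) * ⨆ t ≤ T, ρ t := by
  have hr : 0 < 1 - ϑ := by linarith
  set D := ⨆ t ≤ T, ρ t with hD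
  set S : ℝ≥0 → ℝ≥0∞ := fun s => ⨆ u ≤ s, e u with hS
  have hSmono : Monotone S := fun s s' h => biSup_mono fun u hu => hu.trans h
  set β := y * √((T : ℝ) ^ (1 - ϑ) / (1 - ϑ)) + z * Υ with hβ
  have hβ0 : 0 ≤ β := by positivity
  have hmain (t : ℝ≥0) (ht : t ≤ T) : e t ^ 2 ≤ 2 * D ^ 2 + ENNReal.ofReal (2 * β ^ 2) *
      ∫⁻ s, ENNReal.ofReal (((t : ℝ) - s) ^ ((1 - ϑ) - 1)) * S s ^ 2 ∂lebUpTo t := by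
    set J := ∫⁻ s, ENNReal.ofReal (((t : ℝ) - s) ^ ((1 - ϑ) - 1)) * S s ^ 2 ∂lebUpTo t with hJ
    have h1 : ∫⁻ s, dY t s ∂lebUpTo t
        ≤ ENNReal.ofReal (y * √((T : ℝ) ^ (1 - ϑ) / (1 - ϑ))) * J ^ (1 / 2 : ℝ) := by
      refine (lintegral_le_of_le_kernel (S := S) (hY t ht)).trans ?_
      rw [ENNReal.ofReal_mul hy, mul_assoc]
      gcongr
      refine (lintegral_kernel_mul_le hr hSmono.measurable t).trans ?_
      have ht' : (t : ℝ) ≤ T := ht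
      gcongr
    have h2 : ENNReal.ofReal Υ * (∫⁻ s, dZ t s ^ 2 ∂lebUpTo t) ^ (1 / 2 : ℝ)
        ≤ ENNReal.ofReal (z * Υ) * J ^ (1 / 2 : ℝ) := by
      rw [mul_comm z, ENNReal.ofReal_mul hΥ, mul_assoc]
      gcongr
      exact rpow_half_le_of_le_sq_mul (lintegral_sq_le_of_le_kernel (S := S) (hZ t ht))
    have h3 : e t ≤ D + ENNReal.ofReal β * J ^ (1 / 2 : ℝ) := by
      refine (he t ht).trans (add_le_add (le_iSup₂_of_le t ht le_rfl) ((add_le_add h1 h2).trans_eq ?_))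
      rw [← add_mul, ← ENNReal.ofReal_add (by positivity) (by positivity)]
    have h4 := ENNReal.rpow_add_le_mul_rpow_add_rpow D (ENNReal.ofReal β * J ^ (1 / 2 : ℝ))
      (show (1 : ℝ) ≤ 2 by norm_num)
    norm_num at h4
    refine (pow_le_pow_left' h3 2).trans ?_
    have hJ2 : (J ^ (1 / 2 : ℝ)) ^ 2 = J := by
      rw [← ENNReal.rpow_two, ← ENNReal.rpow_mul]; norm_num
    norm_num at hJ2 ⊢
    refine h4.trans_eq ?_
    rw [mul_pow, mul_add, hJ2, ENNReal.ofReal_pow hβ0]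
    ring
  have hG := sq_le_of_le_add_lintegral_rpow hr (by linarith) (by positivity)
    (M := (⨆ t ≤ T, e t) ^ 2) (by finiteness)
    (fun t ht => pow_le_pow_left' (le_iSup₂ (f := fun t (_ : t ≤ T) => e t) t ht) 2) hmain
  refine iSup₂_le fun t ht => ?_
  rw [← (ENNReal.pow_right_strictMono two_ne_zero).le_iff_le]
  refine (hG t ht).trans_eq ?_
  have hC : 0 ≤ aprioriConst T ϑ y z Υ := mul_nonneg (Real.sqrt_nonneg _) (Real.sqrt_nonneg _)
  rw [mul_pow, ← ENNReal.ofReal_pow hC, sq_aprioriConst T.coe_nonneg hϑ, ENNReal.ofReal_mul two_pos.le,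
    ENNReal.ofReal_ofNat]
  ring

/-- The lower estimate, by the triangle inequality. -/
lemma iSup_le_reverseConst_mul (hϑ : ϑ < 1) (hy : 0 ≤ y) (hz : 0 ≤ z) (hΥ : 0 ≤ Υ)
    (hY : ∀ t ≤ T, ∀ s, 0 < s → s < t →
      dY t s ≤ ENNReal.ofReal y * (⨆ u ≤ s, e u) / ENNReal.ofReal (((t : ℝ) - s) ^ ϑ))
    (hZ : ∀ t ≤ T, ∀ s, 0 < s → s < t →
      dZ t s ≤ ENNReal.ofReal z * (⨆ u ≤ s, e u) / ENNReal.ofReal (((t : ℝ) - s) ^ (ϑ / 2)))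
    (he : ∀ t ≤ T, ρ t ≤ e t + (∫⁻ s, dY t s ∂lebUpTo t
      + ENNReal.ofReal Υ * (∫⁻ s, dZ t s ^ 2 ∂lebUpTo t) ^ (1 / 2 : ℝ))) :
    (⨆ t ≤ T, ρ t) ≤ ENNReal.ofReal (reverseConst T ϑ y z Υ) * ⨆ t ≤ T, e t := by
  have hr : 0 < 1 - ϑ := by linarith
  set m := ⨆ t ≤ T, e t with hm
  set τ := (T : ℝ) ^ (1 - ϑ) with hτ
  have hτ0 : 0 ≤ τ := by positivity
  have hSm (s : ℝ≥0) (hs : s ≤ T) : (⨆ u ≤ s, e u) ≤ m := biSup_mono fun u hu => hu.trans hs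
  refine iSup₂_le fun t ht => ?_
  have h1 : ∫⁻ s, dY t s ∂lebUpTo t ≤ ENNReal.ofReal (y * τ / (1 - ϑ)) * m := by
    refine (lintegral_le_of_le_kernel (hY t ht)).trans ?_
    rw [mul_div_assoc, ENNReal.ofReal_mul hy, mul_assoc]
    gcongr
    exact lintegral_kernel_mul_const_le hr ht hSm
  have h2 : ENNReal.ofReal Υ * (∫⁻ s, dZ t s ^ 2 ∂lebUpTo t) ^ (1 / 2 : ℝ)
      ≤ ENNReal.ofReal (z * Υ * √τ / √(1 - ϑ)) * m := by
    have h3 := rpow_half_le_of_le_sq_mul (lintegral_sq_le_of_le_kernel (hZ t ht))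
    have h4 : (∫⁻ s, ENNReal.ofReal (((t : ℝ) - s) ^ ((1 - ϑ) - 1)) * (⨆ u ≤ s, e u) ^ 2
        ∂lebUpTo t) ^ (1 / 2 : ℝ) ≤ ENNReal.ofReal (√τ / √(1 - ϑ)) * m := by
      refine (ENNReal.rpow_le_rpow (lintegral_kernel_mul_const_le hr ht
        fun s hs => pow_le_pow_left' (hSm s hs) 2) (by norm_num)).trans_eq ?_
      rw [ENNReal.mul_rpow_of_nonneg _ _ (by norm_num),
        ENNReal.ofReal_rpow_of_nonneg (by positivity) (by norm_num), ← Real.sqrt_eq_rpow,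
        Real.sqrt_div hτ0, ← ENNReal.rpow_two, ← ENNReal.rpow_mul]
      norm_num
    calc _ ≤ ENNReal.ofReal Υ * (ENNReal.ofReal z * (ENNReal.ofReal (√τ / √(1 - ϑ)) * m)) := by
          gcongr
          exact h3.trans (by gcongr)
      _ = _ := by
          rw [mul_div_assoc, ENNReal.ofReal_mul (by positivity), ENNReal.ofReal_mul hz]
          ring
  calc ρ t ≤ m + (ENNReal.ofReal (y * τ / (1 - ϑ)) * m
        + ENNReal.ofReal (z * Υ * √τ / √(1 - ϑ)) * m) :=
        (he t ht).trans (add_le_add (le_iSup₂_of_le t ht le_rfl) (add_le_add h1 h2))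
    _ = _ := by
        rw [reverseConst, ENNReal.ofReal_add (by positivity) (by positivity),
          ENNReal.ofReal_add (by positivity) (by positivity), ENNReal.ofReal_one]
        ring

end Constants

/-! ### The perturbation estimate at a fixed time -/

section FixedTime

variable {Ω : Type w} {mΩ : MeasurableSpace Ω} {P : Measure Ω} {𝓕 : Filtration ℝ≥0 mΩ} {t : ℝ≥0}

lemma lebUpTo_zero : lebUpTo 0 = 0 := by
  rw [← Measure.measure_univ_eq_zero, lebUpTo_univ]; simp

lemma IsPredictableUpTo.sub {E : Type*} [NormedAddCommGroup E] {Z Z' : ℝ≥0 → Ω → E}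
    (hZ : IsPredictableUpTo 𝓕 t Z) (hZ' : IsPredictableUpTo 𝓕 t Z') :
    IsPredictableUpTo 𝓕 t (Z - Z') := by
  rw [IsPredictableUpTo, Set.indicator_sub']
  exact StronglyMeasurable.sub hZ hZ'

lemma isPredictableUpTo_zero {E : Type*} [NormedAddCommGroup E] :
    IsPredictableUpTo 𝓕 t (0 : ℝ≥0 → Ω → E) := by
  rw [IsPredictableUpTo, Set.indicator_zero']
  exact stronglyMeasurable_zero

section Drift

variable {V : Type u} [NormedAddCommGroup V]

/-- Minkowski's integral inequality for the pathwise `L¹`-norm of a predictable process. -/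
lemma IsPredictableUpTo.eLpNorm_lintegral_enorm_le [IsProbabilityMeasure P] {Y : ℝ≥0 → Ω → V}
    (hY : IsPredictableUpTo 𝓕 t Y) {p : ℝ} (hp : 1 < p) :
    eLpNorm (fun ω => ∫⁻ s, ‖Y s ω‖ₑ ∂lebUpTo t) (ENNReal.ofReal p) P
      ≤ ∫⁻ s, eLpNorm (Y s) (ENNReal.ofReal p) P ∂lebUpTo t := by
  have hp0 : 0 < p := by linarith
  have h := lintegral_rpow_lintegral_le (μ := lebUpTo t) (ν := P)
    hY.stronglyMeasurable_uncurry.enorm hp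
  rw [eLpNorm_ofReal_eq hp0]
  refine le_trans (le_of_eq ?_) (h.trans_eq ?_)
  · congr 1
    refine lintegral_congr fun ω => ?_
    rw [enorm_eq_self]
    congr 1
    refine lintegral_congr_ae ?_
    filter_upwards [uncurry_indicator_ae_eq t Y ω] with s hs
    rw [hs]
  · refine lintegral_congr_ae ?_
    filter_upwards [indicator_ae_eq_lebUpTo t Y] with s hs
    rw [eLpNorm_ofReal_eq hp0]
    simp only [Function.uncurry_apply_pair]
    rw [hs]

lemma IsPredictableUpTo.ae_lintegral_enorm_lt_top [IsProbabilityMeasure P] {Y : ℝ≥0 → Ω → V}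
    (hY : IsPredictableUpTo 𝓕 t Y) {p : ℝ} (hp : 1 < p)
    (hfin : ∫⁻ s, eLpNorm (Y s) (ENNReal.ofReal p) P ∂lebUpTo t < ⊤) :
    ∀ᵐ ω ∂P, ∫⁻ s, ‖Y s ω‖ₑ ∂lebUpTo t < ⊤ := by
  have hp0 : 0 < p := by linarith
  have hm : Measurable fun ω => ∫⁻ s, ‖Y s ω‖ₑ ∂lebUpTo t := by
    have h := hY.stronglyMeasurable_uncurry.enorm.lintegral_prod_left' (μ := lebUpTo t)
    convert h using 1
    funext ω
    refine lintegral_congr_ae ?_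
    filter_upwards [uncurry_indicator_ae_eq t Y ω] with s hs
    rw [hs]
  have h := (hY.eLpNorm_lintegral_enorm_le (P := P) hp).trans_lt hfin
  have h2 := ENNReal.rpow_lt_top_of_nonneg hp0.le h.ne
  rw [eLpNorm_ofReal_rpow hp0] at h2
  filter_upwards [ae_lt_top (hm.enorm.pow_const p) h2.ne] with ω hω
  rwa [enorm_eq_self, ENNReal.rpow_lt_top_iff_of_pos hp0] at hω

variable [NormedSpace ℝ V]

lemma IsPredictableUpTo.aestronglyMeasurable_integral {Y : ℝ≥0 → Ω → V}
    (hY : IsPredictableUpTo 𝓕 t Y) :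
    AEStronglyMeasurable (fun ω => ∫ s, Y s ω ∂lebUpTo t) P := by
  have h := hY.stronglyMeasurable_uncurry.integral_prod_left' (μ := lebUpTo t)
  refine h.aestronglyMeasurable.congr (Eventually.of_forall fun ω => ?_)
  exact integral_congr_ae (uncurry_indicator_ae_eq t Y ω)

lemma IsPredictableUpTo.eLpNorm_integral_le [IsProbabilityMeasure P] {Y : ℝ≥0 → Ω → V}
    (hY : IsPredictableUpTo 𝓕 t Y) {p : ℝ} (hp : 1 < p) :
    eLpNorm (fun ω => ∫ s, Y s ω ∂lebUpTo t) (ENNReal.ofReal p) P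
      ≤ ∫⁻ s, eLpNorm (Y s) (ENNReal.ofReal p) P ∂lebUpTo t := by
  refine (eLpNorm_mono_enorm fun ω => ?_).trans (hY.eLpNorm_lintegral_enorm_le hp)
  rw [enorm_eq_self]
  exact enorm_integral_le_lintegral_enorm _

end Drift

variable {U : Type v} [NormedAddCommGroup U] [InnerProductSpace ℝ U] {V : Type u}
  [NormedAddCommGroup V] [NormedSpace ℝ V] {W : ℝ≥0 → U → Ω → ℝ} {T : ℝ≥0}

lemma IsStochIntegral.aestronglyMeasurable (hW : IsCylindricalWiener P T 𝓕 W) (ht : t ≤ T)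
    {Z : ℝ≥0 → Ω → GammaRad U V} {I : Ω → V} (hI : IsStochIntegral P 𝓕 W t Z I) :
    AEStronglyMeasurable I P := by
  obtain ⟨L, -, hL⟩ := hI
  obtain ⟨ns, -, hns⟩ := hL.exists_seq_tendsto_ae
  exact aestronglyMeasurable_of_tendsto_ae atTop
    (fun n => hW.aestronglyMeasurable_elemIntegral ht (L (ns n))) hns

lemma isStochIntegral_of_ae_zero {Z : ℝ≥0 → Ω → GammaRad U V}
    (hZ : ∀ ω, (fun s => Z s ω) =ᵐ[lebUpTo t] 0) : IsStochIntegral P 𝓕 W t Z (0 : Ω → V) := by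
  refine ⟨fun _ => [], fun ε hε => ?_, ?_⟩
  · have h (ω : Ω) : ∫⁻ s, gammaNorm ((Z s ω).toCLM -
        elemProcess ([] : List (ElemTerm U V 𝓕)) s ω) ^ 2 ∂lebUpTo t = 0 := by
      rw [lintegral_congr_ae (g := 0)]
      · simp
      filter_upwards [hZ ω] with s hs
      simp [hs, GammaRad.toCLM_zero, elemProcess, gammaNorm_zero]
    simp [h, hε.ne']
  · have h : elemIntegral W t ([] : List (ElemTerm U V 𝓕)) = (0 : Ω → V) := by
      funext ω; simp [elemIntegral]
    simp only [h]
    intro ε hε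
    simp [hε.ne']

lemma IsStochIntegral.stochIntegral {Z : ℝ≥0 → Ω → GammaRad U V} {I : Ω → V}
    (hI : IsStochIntegral P 𝓕 W t Z I) :
    IsStochIntegral P 𝓕 W t Z (stochIntegral P 𝓕 W t Z) := by
  have h : ∃ I, IsStochIntegral P 𝓕 W t Z I := ⟨I, hI⟩
  rw [_root_.stochIntegral, dif_pos h]
  exact h.choose_spec

variable [IsProbabilityMeasure P] [CompleteSpace V] [TopologicalSpace.SeparableSpace V]

lemma IsCylindricalWiener.stochIntegral_ae_eq_zero (hUMD : IsUMD.{w, u} V)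
    (hType : HasTypeTwo V) (hW : IsCylindricalWiener P T 𝓕 W) (ht : t ≤ T)
    {Z : ℝ≥0 → Ω → GammaRad U V} (hZ : ∀ ω, (fun s => Z s ω) =ᵐ[lebUpTo t] 0) :
    stochIntegral P 𝓕 W t Z =ᵐ[P] 0 :=
  (isStochIntegral_of_ae_zero hZ).stochIntegral.ae_eq hUMD hType hW ht
    (fun ω => aestronglyMeasurable_zero.congr (hZ ω).symm) (isStochIntegral_of_ae_zero hZ)

/-- The difference of two mild processes at a fixed time: its drift part is controlled by Minkowski's
integral inequality and its diffusion part by the constant `bdgConst`. -/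
lemma IsCylindricalWiener.eLpNorm_mild_sub_le [CompleteSpace U] (hUMD : IsUMD.{w, u} V)
    (hType : HasTypeTwo V) (hW : IsCylindricalWiener P T 𝓕 W) {p : ℝ} (hp : 2 ≤ p) (ht : t ≤ T)
    {Y Y' : ℝ≥0 → Ω → V} {Z Z' : ℝ≥0 → Ω → GammaRad U V}
    (hY : IsPredictableUpTo 𝓕 t Y) (hY' : IsPredictableUpTo 𝓕 t Y')
    (hZ : IsPredictableUpTo 𝓕 t Z) (hZ' : IsPredictableUpTo 𝓕 t Z')
    (hYfin : ∀ᵐ ω ∂P, ∫⁻ s, ‖Y s ω‖ₑ ∂lebUpTo t < ⊤)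
    (hYfin' : ∀ᵐ ω ∂P, ∫⁻ s, ‖Y' s ω‖ₑ ∂lebUpTo t < ⊤)
    {I I' : Ω → V} (hI : IsStochIntegral P 𝓕 W t Z I) (hI' : IsStochIntegral P 𝓕 W t Z' I')
    (hfin : ∫⁻ s, eLpNorm (Z s - Z' s) (ENNReal.ofReal p) P ^ 2 ∂lebUpTo t < ⊤) :
    eLpNorm (fun ω => ((∫ s, Y s ω ∂lebUpTo t) + I ω) - ((∫ s, Y' s ω ∂lebUpTo t) + I' ω))
        (ENNReal.ofReal p) P
      ≤ ∫⁻ s, eLpNorm (Y s - Y' s) (ENNReal.ofReal p) P ∂lebUpTo t + bdgConst V P T 𝓕 W p *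
        (∫⁻ s, eLpNorm (Z s - Z' s) (ENNReal.ofReal p) P ^ 2 ∂lebUpTo t) ^ (1 / 2 : ℝ) := by
  have hp1 : 1 ≤ ENNReal.ofReal p := by
    rw [← ENNReal.ofReal_one]; exact ENNReal.ofReal_le_ofReal (by linarith)
  have e : (fun ω => ((∫ s, Y s ω ∂lebUpTo t) + I ω) - ((∫ s, Y' s ω ∂lebUpTo t) + I' ω))
      =ᵐ[P] (fun ω => ∫ s, (Y - Y') s ω ∂lebUpTo t) + (I - I') := by
    filter_upwards [hYfin, hYfin'] with ω h1 h2
    have i1 : Integrable (fun s => Y s ω) (lebUpTo t) := ⟨hY.aestronglyMeasurable_section ω, h1⟩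
    have i2 : Integrable (fun s => Y' s ω) (lebUpTo t) := ⟨hY'.aestronglyMeasurable_section ω, h2⟩
    simp only [Pi.add_apply, Pi.sub_apply]
    rw [integral_sub i1 i2]
    abel
  have hII := hI.sub hZ.aestronglyMeasurable_section hI'
  rw [eLpNorm_congr_ae e]
  refine (eLpNorm_add_le (hY.sub hY').aestronglyMeasurable_integral
    (hII.aestronglyMeasurable hW ht) hp1).trans (add_le_add ?_ ?_)
  · exact (hY.sub hY').eLpNorm_integral_le (by linarith)
  · exact hII.eLpNorm_le_bdgConst hUMD hType hW hp ht (hZ.sub hZ') hfin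

end FixedTime

/-! ### The perturbation and the a priori estimate -/

section Estimates

variable {V : Type u} [NormedAddCommGroup V] [NormedSpace ℝ V] {U : Type v}
  [NormedAddCommGroup U] [InnerProductSpace ℝ U] {Ω : Type w} {mΩ : MeasurableSpace Ω}
  {P : Measure Ω} [IsProbabilityMeasure P] {T : ℝ≥0} {𝓕 : Filtration ℝ≥0 mΩ}
  {W : ℝ≥0 → U → Ω → ℝ} {p ϑ y z : ℝ}

/-- Under the growth conditions of the a priori estimate, drift and diffusion are integrable. -/
lemma ae_lintegral_lt_top_of_le_kernel (hp : 2 ≤ p) (hϑ1 : ϑ < 1) {X : ℝ≥0 → Ω → V}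
    {Y : ℝ≥0 → Ω → V} {Z : ℝ≥0 → Ω → GammaRad U V} {t : ℝ≥0} (ht : t ≤ T)
    (hXfin : (⨆ s ≤ T, eLpNorm (X s) (ENNReal.ofReal p) P) < ⊤)
    (hY : IsPredictableUpTo 𝓕 t Y) (hZ : IsPredictableUpTo 𝓕 t Z)
    (hbound : ∀ s, 0 < s → s < t →
      eLpNorm (Y s) (ENNReal.ofReal p) P ≤
        ENNReal.ofReal y * (⨆ u ≤ s, eLpNorm (X u) (ENNReal.ofReal p) P) /
          ENNReal.ofReal (((t : ℝ) - s) ^ ϑ) ∧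
      eLpNorm (Z s) (ENNReal.ofReal p) P ≤
        ENNReal.ofReal z * (⨆ u ≤ s, eLpNorm (X u) (ENNReal.ofReal p) P) /
          ENNReal.ofReal (((t : ℝ) - s) ^ (ϑ / 2))) :
    ∀ᵐ ω ∂P, ∫⁻ s, (‖Y s ω‖ₑ + ‖Z s ω‖ₑ ^ 2) ∂lebUpTo t < ⊤ := by
  have hr : 0 < 1 - ϑ := by linarith
  set m := ⨆ s ≤ T, eLpNorm (X s) (ENNReal.ofReal p) P with hm
  have hSm (s : ℝ≥0) (hs : s ≤ T) : (⨆ u ≤ s, eLpNorm (X u) (ENNReal.ofReal p) P) ≤ m :=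
    biSup_mono fun u hu => hu.trans hs
  have h1 : ∫⁻ s, eLpNorm (Y s) (ENNReal.ofReal p) P ∂lebUpTo t < ⊤ := by
    refine lt_of_le_of_lt (lintegral_le_of_le_kernel fun s h1 h2 => (hbound s h1 h2).1) ?_
    refine ENNReal.mul_lt_top (by finiteness)
      ((lintegral_kernel_mul_const_le hr ht hSm).trans_lt ?_)
    finiteness
  have h2 : ∫⁻ s, eLpNorm (Z s) (ENNReal.ofReal p) P ^ 2 ∂lebUpTo t < ⊤ := by
    refine lt_of_le_of_lt (lintegral_sq_le_of_le_kernel fun s h1 h2 => (hbound s h1 h2).2) ?_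
    refine ENNReal.mul_lt_top (by finiteness) ((lintegral_kernel_mul_const_le hr ht
      (fun s hs => pow_le_pow_left' (hSm s hs) 2)).trans_lt ?_)
    finiteness
  filter_upwards [hY.ae_lintegral_enorm_lt_top (by linarith) h1, hZ.ae_lintegral_sq_lt_top hp h2]
    with ω hω1 hω2
  rw [lintegral_add_left' (hY.aestronglyMeasurable_section ω).enorm]
  exact ENNReal.add_lt_top.2 ⟨hω1, hω2⟩

variable [CompleteSpace V] [TopologicalSpace.SeparableSpace V] [CompleteSpace U]

/-- The estimates for a fixed time, applied at every `t`, supply the hypotheses of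
`iSup_le_aprioriConst_mul` and `iSup_le_reverseConst_mul`. -/
lemma perturbation_estimate (hUMD : IsUMD.{w, u} V) (hType : HasTypeTwo V)
    (hW : IsCylindricalWiener P T 𝓕 W) (hp : 2 ≤ p) (hϑ0 : 0 ≤ ϑ) (hϑ1 : ϑ < 1)
    (hy : 0 ≤ y) (hz : 0 ≤ z) (X X' : ℝ≥0 → Ω → V) (Y Y' : ℝ≥0 → ℝ≥0 → Ω → V)
    (Z Z' : ℝ≥0 → ℝ≥0 → Ω → GammaRad U V)
    (hX : ∀ t ≤ T, StronglyMeasurable (X t) ∧ StronglyMeasurable (X' t))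
    (hXfin : (⨆ s ≤ T, eLpNorm (X s - X' s) (ENNReal.ofReal p) P) < ⊤)
    (hpred : ∀ t, 0 < t → t ≤ T →
      IsPredictableUpTo 𝓕 t (Y t) ∧ IsPredictableUpTo 𝓕 t (Y' t) ∧
      IsPredictableUpTo 𝓕 t (Z t) ∧ IsPredictableUpTo 𝓕 t (Z' t))
    (hfin : ∀ t, 0 < t → t ≤ T → ∀ᵐ ω ∂P, ∫⁻ r,
      (‖Y t r ω‖ₑ + ‖Y' t r ω‖ₑ + ‖Z t r ω‖ₑ ^ 2 + ‖Z' t r ω‖ₑ ^ 2) ∂lebUpTo t < ⊤)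
    (hbound : ∀ t ≤ T, ∀ s, 0 < s → s < t →
      eLpNorm (Y t s - Y' t s) (ENNReal.ofReal p) P ≤
        ENNReal.ofReal y * (⨆ u ≤ s, eLpNorm (X u - X' u) (ENNReal.ofReal p) P) /
          ENNReal.ofReal (((t : ℝ) - s) ^ ϑ) ∧
      eLpNorm (Z t s - Z' t s) (ENNReal.ofReal p) P ≤
        ENNReal.ofReal z * (⨆ u ≤ s, eLpNorm (X u - X' u) (ENNReal.ofReal p) P) /
          ENNReal.ofReal (((t : ℝ) - s) ^ (ϑ / 2))) :
    (∀ t ≤ T, IsStochIntegral P 𝓕 W t (Z t) (stochIntegral P 𝓕 W t (Z t)) ∧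
      IsStochIntegral P 𝓕 W t (Z' t) (stochIntegral P 𝓕 W t (Z' t))) ∧
    (⨆ t ≤ T, eLpNorm (X t - X' t) (ENNReal.ofReal p) P) ≤
      ENNReal.ofReal (aprioriConst T ϑ y z (bdgConst V P T 𝓕 W p).toReal) *
        (⨆ t ≤ T, eLpNorm (fun ω => X t ω -
            ((∫ s, Y t s ω ∂lebUpTo t) + stochIntegral P 𝓕 W t (Z t) ω) +
            ((∫ s, Y' t s ω ∂lebUpTo t) + stochIntegral P 𝓕 W t (Z' t) ω) - X' t ω)
          (ENNReal.ofReal p) P) ∧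
    (⨆ t ≤ T, eLpNorm (fun ω => X t ω -
        ((∫ s, Y t s ω ∂lebUpTo t) + stochIntegral P 𝓕 W t (Z t) ω) +
        ((∫ s, Y' t s ω ∂lebUpTo t) + stochIntegral P 𝓕 W t (Z' t) ω) - X' t ω)
          (ENNReal.ofReal p) P) ≤
      ENNReal.ofReal (reverseConst T ϑ y z (bdgConst V P T 𝓕 W p).toReal) *
        (⨆ t ≤ T, eLpNorm (X t - X' t) (ENNReal.ofReal p) P) := by
  have hr : 0 < 1 - ϑ := by linarith
  have hp1 : 1 ≤ ENNReal.ofReal p := by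
    rw [← ENNReal.ofReal_one]; exact ENNReal.ofReal_le_ofReal (by linarith)
  have hΥ := hW.bdgConst_lt_top (V := V) hUMD hType hp
  set Υ := (bdgConst V P T 𝓕 W p).toReal with hΥdef
  have hΥ0 : 0 ≤ Υ := ENNReal.toReal_nonneg
  have hint : ∀ t ≤ T, IsStochIntegral P 𝓕 W t (Z t) (stochIntegral P 𝓕 W t (Z t)) ∧
      IsStochIntegral P 𝓕 W t (Z' t) (stochIntegral P 𝓕 W t (Z' t)) := by
    intro t ht
    rcases eq_zero_or_pos t with rfl | ht0
    · -- at time zero all integrals vanish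
      exact ⟨(isStochIntegral_of_ae_zero fun ω => by rw [lebUpTo_zero]; rfl).stochIntegral,
        (isStochIntegral_of_ae_zero fun ω => by rw [lebUpTo_zero]; rfl).stochIntegral⟩
    obtain ⟨-, -, h3, h4⟩ := hpred t ht0 ht
    refine ⟨hW.isStochIntegral_stochIntegral hUMD hType ht h3 ?_,
      hW.isStochIntegral_stochIntegral hUMD hType ht h4 ?_⟩
    · filter_upwards [hfin t ht0 ht] with ω hω
      exact lt_of_le_of_lt (lintegral_mono fun s => le_add_right le_add_self) hω
    · filter_upwards [hfin t ht0 ht] with ω hω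
      exact lt_of_le_of_lt (lintegral_mono fun s => le_add_self) hω
  set R : ℝ≥0 → Ω → V := fun t ω => X t ω -
    ((∫ s, Y t s ω ∂lebUpTo t) + stochIntegral P 𝓕 W t (Z t) ω) +
    ((∫ s, Y' t s ω ∂lebUpTo t) + stochIntegral P 𝓕 W t (Z' t) ω) - X' t ω with hR
  set A : ℝ≥0 → Ω → V := fun t ω =>
    ((∫ s, Y t s ω ∂lebUpTo t) + stochIntegral P 𝓕 W t (Z t) ω) -
    ((∫ s, Y' t s ω ∂lebUpTo t) + stochIntegral P 𝓕 W t (Z' t) ω) with hA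
  have hXRA (t : ℝ≥0) : X t - X' t = R t + A t := by
    funext ω; simp only [hR, hA, Pi.add_apply, Pi.sub_apply]; abel
  have hRXA (t : ℝ≥0) : R t = (X t - X' t) - A t := by
    rw [hXRA]; abel
  have hXm (t : ℝ≥0) (ht : t ≤ T) : AEStronglyMeasurable (X t - X' t) P :=
    ((hX t ht).1.sub (hX t ht).2).aestronglyMeasurable
  have hAm (t : ℝ≥0) (ht : t ≤ T) : AEStronglyMeasurable (A t) P := by
    have h1 := (hint t ht).1.aestronglyMeasurable hW ht
    have h2 := (hint t ht).2.aestronglyMeasurable hW ht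
    rcases eq_zero_or_pos t with rfl | ht0
    · simp only [hA, lebUpTo_zero, integral_zero_measure, zero_add]
      exact h1.sub h2
    obtain ⟨h3, h4, -, -⟩ := hpred t ht0 ht
    exact (h3.aestronglyMeasurable_integral.add h1).sub (h4.aestronglyMeasurable_integral.add h2)
  have hbd (t : ℝ≥0) (ht : t ≤ T) : eLpNorm (A t) (ENNReal.ofReal p) P
      ≤ ∫⁻ s, eLpNorm (Y t s - Y' t s) (ENNReal.ofReal p) P ∂lebUpTo t + ENNReal.ofReal Υ *
        (∫⁻ s, eLpNorm (Z t s - Z' t s) (ENNReal.ofReal p) P ^ 2 ∂lebUpTo t) ^ (1 / 2 : ℝ) := by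
    rcases eq_zero_or_pos t with rfl | ht0
    · have h1 := hW.stochIntegral_ae_eq_zero hUMD hType ht (Z := Z 0)
        fun ω => by rw [lebUpTo_zero]; rfl
      have h2 := hW.stochIntegral_ae_eq_zero hUMD hType ht (Z := Z' 0)
        fun ω => by rw [lebUpTo_zero]; rfl
      have h3 : A 0 =ᵐ[P] 0 := by
        filter_upwards [h1, h2] with ω h1 h2
        simp [hA, h1, h2, lebUpTo_zero]
      rw [eLpNorm_congr_ae h3, eLpNorm_zero]
      exact zero_le
    obtain ⟨h1, h2, h3, h4⟩ := hpred t ht0 ht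
    rw [hΥdef, ENNReal.ofReal_toReal hΥ.ne]
    refine hW.eLpNorm_mild_sub_le hUMD hType hp ht h1 h2 h3 h4 ?_ ?_ (hint t ht).1 (hint t ht).2 ?_
    · filter_upwards [hfin t ht0 ht] with ω hω
      exact lt_of_le_of_lt
        (lintegral_mono fun s => le_add_right (le_add_right le_self_add)) hω
    · filter_upwards [hfin t ht0 ht] with ω hω
      exact lt_of_le_of_lt
        (lintegral_mono fun s => le_add_right (le_add_right le_add_self)) hω
    · refine lt_of_le_of_lt (lintegral_sq_le_of_le_kernel fun s h1 h2 => (hbound t ht s h1 h2).2) ?_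
      have h5 := lintegral_kernel_mul_const_le hr ht
        (S := fun s => (⨆ u ≤ s, eLpNorm (X u - X' u) (ENNReal.ofReal p) P) ^ 2)
        (m := (⨆ s ≤ T, eLpNorm (X s - X' s) (ENNReal.ofReal p) P) ^ 2)
        fun s hs => pow_le_pow_left' (biSup_mono fun u hu => hu.trans hs) 2
      refine ENNReal.mul_lt_top (by finiteness) (h5.trans_lt ?_)
      finiteness
  refine ⟨hint, ?_, ?_⟩
  · refine iSup_le_aprioriConst_mul (e := fun t => eLpNorm (X t - X' t) (ENNReal.ofReal p) P)
      hϑ0 hϑ1 hy hz hΥ0 hXfin (fun t ht s h1 h2 => (hbound t ht s h1 h2).1)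
      (fun t ht s h1 h2 => (hbound t ht s h1 h2).2) fun t ht => ?_
    have hRm : AEStronglyMeasurable (R t) P := by
      rw [hRXA]; exact (hXm t ht).sub (hAm t ht)
    rw [hXRA t]
    exact (eLpNorm_add_le hRm (hAm t ht) hp1).trans (add_le_add le_rfl (hbd t ht))
  · refine iSup_le_reverseConst_mul (e := fun t => eLpNorm (X t - X' t) (ENNReal.ofReal p) P)
      hϑ1 hy hz hΥ0 (fun t ht s h1 h2 => (hbound t ht s h1 h2).1)
      (fun t ht s h1 h2 => (hbound t ht s h1 h2).2) fun t ht => ?_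
    change eLpNorm (R t) _ _ ≤ _
    rw [hRXA t]
    exact (eLpNorm_sub_le (hXm t ht) (hAm t ht) hp1).trans (add_le_add le_rfl (hbd t ht))

end Estimates

theorem mainTheorem8
    {V : Type u} [NormedAddCommGroup V] [NormedSpace ℝ V] [CompleteSpace V]
    [TopologicalSpace.SeparableSpace V] (hUMD : IsUMD.{w, u} V) (hType : HasTypeTwo V)
    {U : Type v} [NormedAddCommGroup U] [InnerProductSpace ℝ U] [CompleteSpace U]
    [TopologicalSpace.SeparableSpace U]
    {Ω : Type w} {mΩ : MeasurableSpace Ω} (P : Measure Ω) [IsProbabilityMeasure P]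
    (T : ℝ≥0) (hT : 0 < T)
    (𝓕 : Filtration ℝ≥0 mΩ) (h𝓕 : IsNormalFiltration P T 𝓕)
    (W : ℝ≥0 → U → Ω → ℝ) (hW : IsCylindricalWiener P T 𝓕 W)
    (p : ℝ) (hp : 2 ≤ p) (ϑ : ℝ) (hϑ0 : 0 ≤ ϑ) (hϑ1 : ϑ < 1)
    (y z : ℝ) (hy : 0 ≤ y) (hz : 0 ≤ z) :
    -- the constant `Υ_p` is finite
    bdgConst V P T 𝓕 W p < ⊤ ∧
    -- the a priori estimate
    (∀ (X : ℝ≥0 → Ω → V) (Y : ℝ≥0 → ℝ≥0 → Ω → V) (Z : ℝ≥0 → ℝ≥0 → Ω → GammaRad U V),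
      (∀ t ≤ T, StronglyMeasurable (X t)) →
      (⨆ s ≤ T, eLpNorm (X s) (ENNReal.ofReal p) P) < ⊤ →
      (∀ t, 0 < t → t ≤ T → IsPredictableUpTo 𝓕 t (Y t) ∧ IsPredictableUpTo 𝓕 t (Z t)) →
      (∀ t ≤ T, ∀ s, 0 < s → s < t →
        eLpNorm (Y t s) (ENNReal.ofReal p) P ≤
          ENNReal.ofReal y * (⨆ u ≤ s, eLpNorm (X u) (ENNReal.ofReal p) P) /
            ENNReal.ofReal (((t : ℝ) - s) ^ ϑ) ∧
        eLpNorm (Z t s) (ENNReal.ofReal p) P ≤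
          ENNReal.ofReal z * (⨆ u ≤ s, eLpNorm (X u) (ENNReal.ofReal p) P) /
            ENNReal.ofReal (((t : ℝ) - s) ^ (ϑ / 2))) →
      -- the integrals are well defined
      (∀ t ≤ T, ∀ᵐ ω ∂P, ∫⁻ s, (‖Y t s ω‖ₑ + ‖Z t s ω‖ₑ ^ 2) ∂lebUpTo t < ⊤) ∧
      (∀ t ≤ T, IsStochIntegral P 𝓕 W t (Z t) (stochIntegral P 𝓕 W t (Z t))) ∧
      -- the estimates
      (⨆ t ≤ T, eLpNorm (X t) (ENNReal.ofReal p) P) ≤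
        ENNReal.ofReal (aprioriConst T ϑ y z (bdgConst V P T 𝓕 W p).toReal) *
          (⨆ t ≤ T, eLpNorm (fun ω => X t ω -
            ((∫ s, Y t s ω ∂lebUpTo t) + stochIntegral P 𝓕 W t (Z t) ω))
            (ENNReal.ofReal p) P) ∧
      ENNReal.ofReal (aprioriConst T ϑ y z (bdgConst V P T 𝓕 W p).toReal) *
          (⨆ t ≤ T, eLpNorm (fun ω => X t ω -
            ((∫ s, Y t s ω ∂lebUpTo t) + stochIntegral P 𝓕 W t (Z t) ω))
            (ENNReal.ofReal p) P) ≤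
        ENNReal.ofReal (reverseConst T ϑ y z (bdgConst V P T 𝓕 W p).toReal) *
          ENNReal.ofReal (aprioriConst T ϑ y z (bdgConst V P T 𝓕 W p).toReal) *
          (⨆ t ≤ T, eLpNorm (X t) (ENNReal.ofReal p) P) ∧
      ENNReal.ofReal (reverseConst T ϑ y z (bdgConst V P T 𝓕 W p).toReal) *
          ENNReal.ofReal (aprioriConst T ϑ y z (bdgConst V P T 𝓕 W p).toReal) *
          (⨆ t ≤ T, eLpNorm (X t) (ENNReal.ofReal p) P) < ⊤) ∧
    -- the perturbation estimate
    (∀ (X X' : ℝ≥0 → Ω → V) (Y Y' : ℝ≥0 → ℝ≥0 → Ω → V)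
      (Z Z' : ℝ≥0 → ℝ≥0 → Ω → GammaRad U V),
      (∀ t ≤ T, StronglyMeasurable (X t) ∧ StronglyMeasurable (X' t)) →
      (⨆ s ≤ T, eLpNorm (X s - X' s) (ENNReal.ofReal p) P) < ⊤ →
      (∀ t, 0 < t → t ≤ T →
        IsPredictableUpTo 𝓕 t (Y t) ∧ IsPredictableUpTo 𝓕 t (Y' t) ∧
        IsPredictableUpTo 𝓕 t (Z t) ∧ IsPredictableUpTo 𝓕 t (Z' t)) →
      (∀ t, 0 < t → t ≤ T → ∀ᵐ ω ∂P, ∫⁻ r,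
        (‖Y t r ω‖ₑ + ‖Y' t r ω‖ₑ + ‖Z t r ω‖ₑ ^ 2 + ‖Z' t r ω‖ₑ ^ 2) ∂lebUpTo t < ⊤) →
      (∀ t ≤ T, ∀ s, 0 < s → s < t →
        eLpNorm (Y t s - Y' t s) (ENNReal.ofReal p) P ≤
          ENNReal.ofReal y * (⨆ u ≤ s, eLpNorm (X u - X' u) (ENNReal.ofReal p) P) /
            ENNReal.ofReal (((t : ℝ) - s) ^ ϑ) ∧
        eLpNorm (Z t s - Z' t s) (ENNReal.ofReal p) P ≤
          ENNReal.ofReal z * (⨆ u ≤ s, eLpNorm (X u - X' u) (ENNReal.ofReal p) P) /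
            ENNReal.ofReal (((t : ℝ) - s) ^ (ϑ / 2))) →
      -- the stochastic integrals are well defined
      (∀ t ≤ T, IsStochIntegral P 𝓕 W t (Z t) (stochIntegral P 𝓕 W t (Z t)) ∧
        IsStochIntegral P 𝓕 W t (Z' t) (stochIntegral P 𝓕 W t (Z' t))) ∧
      -- the estimates
      (⨆ t ≤ T, eLpNorm (X t - X' t) (ENNReal.ofReal p) P) ≤
        ENNReal.ofReal (aprioriConst T ϑ y z (bdgConst V P T 𝓕 W p).toReal) *
          (⨆ t ≤ T, eLpNorm (fun ω => X t ω -
              ((∫ s, Y t s ω ∂lebUpTo t) + stochIntegral P 𝓕 W t (Z t) ω) +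
              ((∫ s, Y' t s ω ∂lebUpTo t) + stochIntegral P 𝓕 W t (Z' t) ω) - X' t ω)
            (ENNReal.ofReal p) P) ∧
      ENNReal.ofReal (aprioriConst T ϑ y z (bdgConst V P T 𝓕 W p).toReal) *
          (⨆ t ≤ T, eLpNorm (fun ω => X t ω -
              ((∫ s, Y t s ω ∂lebUpTo t) + stochIntegral P 𝓕 W t (Z t) ω) +
              ((∫ s, Y' t s ω ∂lebUpTo t) + stochIntegral P 𝓕 W t (Z' t) ω) - X' t ω)
            (ENNReal.ofReal p) P) ≤
        ENNReal.ofReal (aprioriConst T ϑ y z (bdgConst V P T 𝓕 W p).toReal) *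
          ENNReal.ofReal (reverseConst T ϑ y z (bdgConst V P T 𝓕 W p).toReal) *
          (⨆ t ≤ T, eLpNorm (X t - X' t) (ENNReal.ofReal p) P) ∧
      ENNReal.ofReal (aprioriConst T ϑ y z (bdgConst V P T 𝓕 W p).toReal) *
          ENNReal.ofReal (reverseConst T ϑ y z (bdgConst V P T 𝓕 W p).toReal) *
          (⨆ t ≤ T, eLpNorm (X t - X' t) (ENNReal.ofReal p) P) < ⊤) := by
  have hΥ := hW.bdgConst_lt_top (V := V) hUMD hType hp
  refine ⟨hΥ, ?_, ?_⟩
  · intro X Y Z hX hXfin hpred hbound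
    have hfin (t : ℝ≥0) (ht : t ≤ T) :
        ∀ᵐ ω ∂P, ∫⁻ s, (‖Y t s ω‖ₑ + ‖Z t s ω‖ₑ ^ 2) ∂lebUpTo t < ⊤ := by
      rcases eq_zero_or_pos t with rfl | ht0
      · simp [lebUpTo_zero]
      · exact ae_lintegral_lt_top_of_le_kernel hp hϑ1 ht hXfin (hpred t ht0 ht).1
          (hpred t ht0 ht).2 (hbound t ht)
    -- the perturbation estimate with all comparison processes equal to zero
    obtain ⟨h1, h2, h3⟩ := perturbation_estimate hUMD hType hW hp hϑ0 hϑ1 hy hz X 0 Y 0 Z 0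
      (fun t ht => ⟨hX t ht, stronglyMeasurable_zero⟩) (by simpa using hXfin)
      (fun t ht0 ht => ⟨(hpred t ht0 ht).1, isPredictableUpTo_zero, (hpred t ht0 ht).2,
        isPredictableUpTo_zero⟩)
      (fun t _ ht => by simpa using hfin t ht) (by simpa using hbound)
    have hR (t : ℝ≥0) (ht : t ≤ T) : eLpNorm (fun ω => X t ω -
          ((∫ s, Y t s ω ∂lebUpTo t) + stochIntegral P 𝓕 W t (Z t) ω) +
          ((∫ s, (0 : ℝ≥0 → ℝ≥0 → Ω → V) t s ω ∂lebUpTo t) + stochIntegral P 𝓕 W t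
            ((0 : ℝ≥0 → ℝ≥0 → Ω → GammaRad U V) t) ω) - (0 : ℝ≥0 → Ω → V) t ω)
          (ENNReal.ofReal p) P
        = eLpNorm (fun ω => X t ω -
          ((∫ s, Y t s ω ∂lebUpTo t) + stochIntegral P 𝓕 W t (Z t) ω)) (ENNReal.ofReal p) P := by
      refine eLpNorm_congr_ae ?_
      filter_upwards [hW.stochIntegral_ae_eq_zero hUMD hType ht
        (Z := (0 : ℝ≥0 → ℝ≥0 → Ω → GammaRad U V) t) fun ω => ae_eq_refl _] with ω hω
      simp [show stochIntegral P 𝓕 W t (0 : ℝ≥0 → Ω → GammaRad U V) ω = 0 from hω]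
    rw [biSup_congr hR] at h2 h3
    simp only [Pi.zero_apply, sub_zero] at h2 h3
    refine ⟨hfin, fun t ht => (h1 t ht).1, h2, ?_, by finiteness⟩
    rw [mul_comm (ENNReal.ofReal (reverseConst _ _ _ _ _)), mul_assoc]
    gcongr
  · intro X X' Y Y' Z Z' hX hXfin hpred hfin hbound
    obtain ⟨h1, h2, h3⟩ := perturbation_estimate hUMD hType hW hp hϑ0 hϑ1 hy hz X X' Y Y' Z Z'
      hX hXfin hpred hfin hbound
    refine ⟨h1, h2, ?_, by finiteness⟩
    rw [mul_assoc]
    gcongr
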